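/- **Theorem (Escaping efficiency of distributed algorithms).** *Setting.* $K$ agents hold training data $x_{k,1},\dots,x_{k,N_k}$ ($N_k\ge 1$) and losses $Q_k(w;x)$, $w\in\mathbb R^M$, with $w\mapsto Q_k(w;x_{k,i})$ twice continuously differentiable and $\|\nabla Q_k(w_2;x_{k,i})-\nabla Q_k(w_1;x_{k,i})\|\le L\|w_2-w_1\|$ for all $w_1,w_2$. Put $J_k(w)=\frac1{N_k}\sum_i Q_k(w;x_{k,i})$, $J=\frac1K\sum_kJ_k$; let $w^\star$ be a local minimizer of $J$, $H_k^\star=\nabla^2J_k(w^\star)$, $\bar H=\frac1K\sum_kH_k^\star$, $d=\mathrm{col}\{\nabla J_k(w^\star)\}$, and suppose $\|H_k^\star-\bar H\|\le\epsilon$ for all $k$ (small Hessian disagreement). The agents form a strongly connected graph with at least one self-loop and symmetric doubly stochastic combination matrix $A=[a_{\ell k}]=VPV^{\sf T}$, where $V=[\frac1{\sqrt K}\mathbb 1\;\;V_\alpha]$ is orthogonal and $P=\mathrm{diag}\{1,P_\alpha\}$ is diagonal; $\mathcal V_\alpha=V_\alpha\otimes I_M$, $\mathcal P_\alpha=P_\alpha\otimes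 I_M$. At every iteration $n\ge0$ agent $k$ draws $B$ samples uniformly with replacement from its training data, all draws being independent (over agents, iterations, batch positions) and independent of the initial models $w_{k,-1}$; let $g_{k,n}(w)$ be the resulting mini-batch gradient. The algorithms, with step size $\mu>0$, are: centralized, $w_n=w_{n-1}-\frac{\mu}{K}\sum_k g_{k,n}(w_{n-1})$; consensus, $w_{k,n}=\sum_\ell a_{\ell k}w_{\ell,n-1}-\mu g_{k,n}(w_{k,n-1})$; diffusion, $w_{k,n}=\sum_\ell a_{\ell k}\big(w_{\ell,n-1}-\mu g_{\ell,n}(w_{\ell,n-1})\big)$. The excess risk is $\mathrm{ER}_n=\frac1K\sum_k\mathbb E J(w_{k,n})-J(w^\star)$ (with $w_{k,n}=w_n$ for all $k$ in the centralized method). The short-term model is the recursion $\widetilde{\mathcal W}'_n=\mathcal A_2(\mathcal A_1-\mu\,\mathrm{diag}\{H_k^\star\})\widetilde{\mathcal W}'_{n-1}+\mu\mathcal A_2d+\mu\mathcal A_2 s_n^B$, $\widetilde{\mathcal W}'_{-1}=\mathrm{col}\{w^\star-w_{k,-1}\}$, where $s^B_n=\mathrm{col}\{g_{k,n}(w_{k,n-1})-\nabla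 J_k(w_{k,n-1})\}$, $\mathcal A_i=A_i\otimes I_M$, and $(A_1,A_2)$ is $(I,\frac1K\mathbb 1\mathbb 1^{\sf T})$ for the centralized method, $(A,I)$ for consensus, $(I,A)$ for diffusion. *Claim.* Fix $T>0$, $c<\infty$, $\eta\ge0$, and consider $\mu\to0$ with batch sizes $B=B(\mu)$ such that $\frac1B\le c\mu^\eta$, and initial models with $\mathbb E\|w_{k,-1}-w^\star\|^4= o(\mu^2/B^2)$. Then, uniformly over all iterations $0\le n\le T/\mu$, the expectations defining $\mathrm{ER}_n$ exist and $$\mathrm{ER}_{n,cen}=\tfrac{\mu}{B}e(n)+ o(\mu^{1+\eta}),$$ $$\mathrm{ER}_{n,con}=\tfrac{\mu}{B}e(n)+\mu^2f_{con}(n)+O(\epsilon^2\|d\|^2\mu^2)+ o(\mu^2)+ o(\mu^{1+\eta}),$$ $$\mathrm{ER}_{n,dif}=\tfrac{\mu}{B}e(n)+\mu^2f_{dif}(n)+O(\epsilon^2\|d\|^2\mu^2)+ o(\mu^2)+ o(\mu^{1+\eta}),$$ where the constant in $O(\epsilon^2\|d\|^2\mu^2)$ depends only on $A$ (hence $K$),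 $M$, $L$ and $T$, the error terms have either sign, and, with $\|x\|_\Sigma^2=x^{\sf T}\Sigma x$ ($=x\Sigma x^{\sf T}$ for row vectors), $$e(n)=\tfrac14\mathrm{Tr}\big((I-(I-\mu\bar H)^{2(n+1)})\bar R_s\big),$$ $$f_{con}(n)=\tfrac1{2K}\big\|d^{\sf T}\mathcal V_\alpha(I-\mathcal P_\alpha)^{-1}(I-\mathcal P_\alpha^{n+1})\big\|^2_{I\otimes\bar H},$$ $$f_{dif}(n)=\tfrac1{2K}\big\|d^{\sf T}\mathcal V_\alpha\mathcal P_\alpha(I-\mathcal P_\alpha)^{-1}(I-\mathcal P_\alpha^{n+1})\big\|^2_{I\otimes\bar H},$$ and $\bar R_s$ is the covariance matrix of $\frac1K\sum_k\big(\nabla Q_k(w^\star;\boldsymbol x_k)-\nabla J_k(w^\star)\big)$, with $\boldsymbol x_k$ drawn independently and uniformly from the training data of agent $k$. The same three expansions hold for the excess risk evaluated from the short-term model, $\frac1{2K}\mathbb E\|\widetilde{\mathcal W}'_n\|^2_{I\otimes\bar H}$. -/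

import Mathlib

open MeasureTheory ProbabilityTheory

universe u v

noncomputable section

namespace DistributedLearning

/-- The parameter space `ℝ^M` with its Euclidean norm. -/
abbrev Param (M : ℕ) : Type := EuclideanSpace ℝ (Fin M)

/-- `K` agents; agent `k` has the loss `Q k w x` of the parameter `w` on the data point `x`, and the
training data `x k 0, …, x k (N k - 1)`. -/
structure Problem (K M : ℕ) (𝒳 : Type v) where
  Q : Fin K → Param M → 𝒳 → ℝ
  N : Fin K → ℕ
  N_pos : ∀ k, 0 < N k
  x : (k : Fin K) → Fin (N k) → 𝒳

/-- A realization of all mini-batches: `j k n b` is the index of the `b`-th training sample that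
agent `k` draws at iteration `n`. -/
abbrev Problem.Batches {K M : ℕ} {𝒳 : Type v} (p : Problem K M 𝒳) (B : ℕ) : Type :=
  (k : Fin K) → ℕ → Fin B → Fin (p.N k)

section Risk

variable {K M : ℕ} {𝒳 : Type v} (p : Problem K M 𝒳)

/-- `∇_w Q_k(w; x_{k,i})`. -/
def Problem.lossGrad (k : Fin K) (i : Fin (p.N k)) (w : Param M) : Param M :=
  gradient (fun v => p.Q k v (p.x k i)) w

/-- `J_k(w) = (1 / N_k) ∑_i Q_k(w; x_{k,i})`. -/
def Problem.localRisk (k : Fin K) (w : Param M) : ℝ :=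
  (1 / (p.N k : ℝ)) * ∑ i, p.Q k w (p.x k i)

/-- `J(w) = (1 / K) ∑_k J_k(w)`. -/
def Problem.risk (w : Param M) : ℝ :=
  (1 / (K : ℝ)) * ∑ k, p.localRisk k w

/-- The block vector `d = col {∇ J_k(w⋆)}`. -/
def Problem.localGrad (wstar : Param M) (k : Fin K) : Param M :=
  gradient (p.localRisk k) wstar

/-- The local Hessian `H_k⋆ = ∇² J_k(w⋆)`. -/
def Problem.hess (wstar : Param M) (k : Fin K) : Param M →L[ℝ] Param M :=
  fderiv ℝ (gradient (p.localRisk k)) wstar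

/-- The global Hessian `H̄ = (1 / K) ∑_k H_k⋆`. -/
def Problem.meanHess (wstar : Param M) : Param M →L[ℝ] Param M :=
  (1 / (K : ℝ)) • ∑ k, p.hess wstar k

/-- The covariance operator `R̄_s`, for batch size one, of the network average
`(1 / K) ∑_k (∇ Q_k(w⋆; x_k) - ∇ J_k(w⋆))` of the gradient noise, the agents drawing independent
uniform training samples: an average over all tuples of sample indices. -/
def Problem.noiseCov (wstar : Param M) : Param M →L[ℝ] Param M :=
  (1 / (Fintype.card ((k : Fin K) → Fin (p.N k)) : ℝ)) •
    ∑ i : (k : Fin K) → Fin (p.N k),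
      InnerProductSpace.rankOne ℝ
        ((1 / (K : ℝ)) • ∑ k, (p.lossGrad k (i k) wstar - p.localGrad wstar k))
        ((1 / (K : ℝ)) • ∑ k, (p.lossGrad k (i k) wstar - p.localGrad wstar k))

end Risk

section Algorithms

variable {K M : ℕ} {𝒳 : Type v}

/-- `(1 / B) ∑_b ∇_w Q_k(w; x_k^b)`. -/
def Problem.batchGrad (p : Problem K M 𝒳) {B : ℕ} (k : Fin K) (j : Fin B → Fin (p.N k)) (w : Param M) : Param M :=
  (1 / (B : ℝ)) • ∑ b, p.lossGrad k (j b) w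

/-- The mini-batch gradient noise `s_k^B(w)`. -/
def Problem.noise (p : Problem K M 𝒳) {B : ℕ} (k : Fin K) (j : Fin B → Fin (p.N k)) (w : Param M) : Param M :=
  p.batchGrad k j w - gradient (p.localRisk k) w

/-- The centralized method. In all recursions below, the value at `0` is the initial condition
`w_{-1}`, the value at `n + 1` is the `n`-th iterate `w_n`. -/
def Problem.centralized (p : Problem K M 𝒳) {B : ℕ} (μ : ℝ) (j : p.Batches B)
    (w₀ : Param M) : ℕ → Param M
  | 0 => w₀
  | n + 1 => p.centralized μ j w₀ n -
      μ • (1 / (K : ℝ)) • ∑ k, p.batchGrad k (j k n) (p.centralized μ j w₀ n)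

/-- The consensus strategy. -/
def Problem.consensus (p : Problem K M 𝒳) {B : ℕ} (A : Matrix (Fin K) (Fin K) ℝ) (μ : ℝ)
    (j : p.Batches B) (w₀ : Fin K → Param M) : ℕ → Fin K → Param M
  | 0 => w₀
  | n + 1 => fun k => (∑ l, A l k • p.consensus A μ j w₀ n l) -
      μ • p.batchGrad k (j k n) (p.consensus A μ j w₀ n k)

/-- The diffusion strategy. -/
def Problem.diffusion (p : Problem K M 𝒳) {B : ℕ} (A : Matrix (Fin K) (Fin K) ℝ) (μ : ℝ)
    (j : p.Batches B) (w₀ : Fin K → Param M) : ℕ → Fin K → Param M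
  | 0 => w₀
  | n + 1 => fun k => ∑ l, A l k • (p.diffusion A μ j w₀ n l -
      μ • p.batchGrad l (j l n) (p.diffusion A μ j w₀ n l))

/-- The short-term model of an algorithm with combination matrices `A₁`, `A₂` and true iterates
`w`: the error recursion
`W'_n = 𝒜₂ (𝒜₁ - μ ℋ) W'_{n-1} + μ 𝒜₂ d + μ 𝒜₂ s_n^B`, `W'_{-1} = col {w⋆ - w_{k,-1}}`,
written block by block, with `𝒜ᵢ = Aᵢ ⊗ I`, `ℋ = diag {H_k⋆}` and the gradient noise
`s_n^B = col {s_k^B(w_{k,n-1})}`. -/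
def Problem.shortTerm (p : Problem K M 𝒳) {B : ℕ} (A₁ A₂ : Matrix (Fin K) (Fin K) ℝ)
    (wstar : Param M) (μ : ℝ) (j : p.Batches B) (w : ℕ → Fin K → Param M) : ℕ → Fin K → Param M
  | 0 => fun k => wstar - w 0 k
  | n + 1 => fun k => ∑ l, A₂ k l •
      ((∑ m, A₁ l m • p.shortTerm A₁ A₂ wstar μ j w n m) -
        μ • p.hess wstar l (p.shortTerm A₁ A₂ wstar μ j w n l) +
        μ • p.localGrad wstar l + μ • p.noise l (j l n) (w n l))

end Algorithms

section Randomness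

variable {K M : ℕ} {𝒳 : Type v} (p : Problem K M 𝒳) {B : ℕ} {Ω : Type u} [MeasurableSpace Ω]

/-- All samples are drawn independently (over agents, iterations and batch positions), each one
uniformly with replacement from the training data of its agent. -/
structure Problem.IsUniformSampling (P : Measure Ω) (ξ : Ω → p.Batches B) : Prop where
  measurable : ∀ k n b, Measurable fun ω => ξ ω k n b
  uniform : ∀ k n b (i : Fin (p.N k)), P.real {ω | ξ ω k n b = i} = 1 / (p.N k : ℝ)
  indep : iIndepFun (fun (q : Fin K × ℕ × Fin B) ω => ξ ω q.1 q.2.1 q.2.2) P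

/-- The initial models are random vectors independent of the samples drawn later, and
`𝔼 ‖w_{k,-1} - w⋆‖⁴ ≤ r` for every agent `k`. -/
structure Problem.StartsNear (P : Measure Ω) (ξ : Ω → p.Batches B) (wstar : Param M)
    (w₀ : Ω → Fin K → Param M) (r : ℝ) : Prop where
  measurable : Measurable w₀
  indep : IndepFun w₀ ξ P
  integrable : ∀ k, Integrable (fun ω => ‖w₀ ω k - wstar‖ ^ 4) P
  moment : ∀ k, ∫ ω, ‖w₀ ω k - wstar‖ ^ 4 ∂P ≤ r

/-- The excess risk `ER = (1 / K) ∑_k 𝔼 J(w_k) - J(w⋆)`. -/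
def Problem.excessRisk (P : Measure Ω) (wstar : Param M) (w : Ω → Fin K → Param M) : ℝ :=
  (1 / (K : ℝ)) * (∑ k, ∫ ω, p.risk (w ω k) ∂P) - p.risk wstar

/-- `‖v‖²_{I ⊗ H} = ∑_a v_aᵀ H v_a` for a block vector `v`. -/
def weightedSq {ι : Type*} [Fintype ι] (H : Param M →L[ℝ] Param M) (v : ι → Param M) : ℝ :=
  ∑ a, inner ℝ (v a) (H (v a))

/-- The excess risk as evaluated from the short-term model,
`(1 / (2 K)) 𝔼 ‖W'‖²_{I ⊗ H̄}`. -/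
def Problem.shortTermRisk (P : Measure Ω) (wstar : Param M) (W : Ω → Fin K → Param M) : ℝ :=
  (1 / (2 * (K : ℝ))) * ∫ ω, weightedSq (p.meanHess wstar) (W ω) ∂P

/-- For the iterate `w` of an algorithm and the state `W` of its short-term model, the excess risk
is well defined and lies within `err` of `main`, whether it is evaluated from `w` or from `W`. -/
structure Problem.ExcessRiskExpansion (P : Measure Ω) (wstar : Param M)
    (w W : Ω → Fin K → Param M) (main err : ℝ) : Prop where
  integrable : ∀ k, Integrable (fun ω => p.risk (w ω k)) P
  integrable_shortTerm : Integrable (fun ω => weightedSq (p.meanHess wstar) (W ω)) P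
  bound : |p.excessRisk P wstar w - main| ≤ err
  bound_shortTerm : |p.shortTermRisk P wstar W - main| ≤ err

end Randomness

section Network

variable {K : ℕ}

/-- A strongly connected network with symmetric doubly stochastic combination matrix and at least
one self-loop. -/
structure IsCombinationMatrix (A : Matrix (Fin K) (Fin K) ℝ) : Prop where
  symm : A.IsSymm
  stochastic : A ∈ doublyStochastic ℝ (Fin K)
  connected : A.IsIrreducible
  selfLoop : ∃ k, 0 < A k k

/-- `[𝟙 / √K  V_α]`. -/
def fullBasis (Vα : Matrix (Fin K) (Fin (K - 1)) ℝ) :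
    Matrix (Fin K) (Unit ⊕ Fin (K - 1)) ℝ :=
  Matrix.fromCols (Matrix.of fun (_ : Fin K) (_ : Unit) => 1 / √(K : ℝ)) Vα

/-- `A = V P Vᵀ` with `V = [𝟙 / √K  V_α]` orthogonal and `P = diag {1, P_α}`, where
`P_α = diag ev`. -/
structure IsEigendecomposition (A : Matrix (Fin K) (Fin K) ℝ)
    (Vα : Matrix (Fin K) (Fin (K - 1)) ℝ) (ev : Fin (K - 1) → ℝ) : Prop where
  orthonormal_cols : (fullBasis Vα).transpose * fullBasis Vα = 1
  orthonormal_rows : fullBasis Vα * (fullBasis Vα).transpose = 1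
  decomp : A = fullBasis Vα * Matrix.fromBlocks (1 : Matrix Unit Unit ℝ) 0 0 (Matrix.diagonal ev) *
    (fullBasis Vα).transpose

end Network

section Expansion

variable {K M : ℕ} {𝒳 : Type v} (p : Problem K M 𝒳)

/-- The block row vector `dᵀ (G ⊗ I)`. -/
def blockRow {ι : Type*} (d : Fin K → Param M) (G : Matrix (Fin K) ι ℝ) : ι → Param M :=
  fun a => ∑ k, G k a • d k

/-- `e(n) = (1 / 4) Tr ((I - (I - μ H̄)^{2 (n + 1)}) R̄_s)`. -/
def Problem.noiseTerm (wstar : Param M) (μ : ℝ) (n : ℕ) : ℝ :=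
  (1 / 4) * LinearMap.trace ℝ (Param M)
    (((1 - (1 - μ • p.meanHess wstar) ^ (2 * (n + 1))) * p.noiseCov wstar :
      Param M →L[ℝ] Param M) : Param M →ₗ[ℝ] Param M)

/-- `f_con(n) = (1 / (2 K)) ‖dᵀ 𝒱_α (I - 𝒫_α)⁻¹ (I - 𝒫_α^{n + 1})‖²_{I ⊗ H̄}`. -/
def Problem.consensusTerm (wstar : Param M) (Vα : Matrix (Fin K) (Fin (K - 1)) ℝ)
    (ev : Fin (K - 1) → ℝ) (n : ℕ) : ℝ :=
  (1 / (2 * (K : ℝ))) * weightedSq (p.meanHess wstar)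
    (blockRow (p.localGrad wstar)
      (Vα * (1 - Matrix.diagonal ev)⁻¹ * (1 - Matrix.diagonal ev ^ (n + 1))))

/-- `f_dif(n) = (1 / (2 K)) ‖dᵀ 𝒱_α 𝒫_α (I - 𝒫_α)⁻¹ (I - 𝒫_α^{n + 1})‖²_{I ⊗ H̄}`. -/
def Problem.diffusionTerm (wstar : Param M) (Vα : Matrix (Fin K) (Fin (K - 1)) ℝ)
    (ev : Fin (K - 1) → ℝ) (n : ℕ) : ℝ :=
  (1 / (2 * (K : ℝ))) * weightedSq (p.meanHess wstar)
    (blockRow (p.localGrad wstar)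
      (Vα * Matrix.diagonal ev * (1 - Matrix.diagonal ev)⁻¹ * (1 - Matrix.diagonal ev ^ (n + 1))))

end Expansion

end DistributedLearning

end

/-! Collect the errors `w⋆ - w_k` of all agents in one block vector `X`. Each of the three methods
becomes `X' = A₂ (A₁ X + μ G X + μ s(X))`, and `NoisyRecursion` records what the argument uses of
it. Two time scales are at work. Over `T / μ` steps a factor `1 + O(μ)` per step costs only the
constant `exp(LT)`, so a forcing of size `μβ` accumulates to `O(β)` in the centroid. On the
complement of the consensus subspace `A₂ A₁` contracts by a fixed `q < 1`, so there the same forcing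
never exceeds `O(μβ)`.

Mean motion. Since `∇J(w⋆) = 0`, the blocks of `d` sum to zero, so `d` drives only the disagreement.
The result is `drift`, a geometric sum of order `μ` whose quadratic form is the term `μ² f(n)`. It
leaks into the centroid only through `H_k⋆ - H̄`, displacing it by `O(εμ)`; since `H̄` respects the
splitting there is no cross term, and the cost is of order `ε² μ²`
(`norm_affine_iterate_sub_drift_le`, `abs_quad_affine_iterate_sub_le`).

Noise. In the mean of a quadratic form of the linear model, cross terms with fresh noise vanish, so
each injection contributes just its own energy, with weight `μ² / B`
(`iterMean_quad_affine_iterate`). The disagreement part of an injection dies out geometrically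
(`norm_lin_pow_sub_le`). The centroid part moves by powers of `1 - μ H̄`, and the identity `‖x‖² -
‖(1 - μ H̄) x‖² = 2μ ⟨x, H̄ x⟩ - μ² ‖H̄ x‖²` telescopes the sum of energies to `(μ / B) e(n)`
(`abs_sum_quad_centroid_sub_le`); neither the sign nor the invertibility of `H̄` matters.

Linearization. The second moment of `X` is of order `scale = μ / B + g² μ²`, and the fourth moment
is of higher order (`iterMean_norm_pow_le`). The losses are merely `C²`, so there is no cubic Taylor
remainder. Instead, all remainders are bounded by `δ ‖x‖² + C ‖x‖⁴` with arbitrary `δ > 0`: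
differentiability gives this near `w⋆`, the Lipschitz gradient far away. This is negligible against
`scale`, both for the risk and for the distance between `X` and its linearization, which is driven
by the same noise.

All estimates are made for a fixed initial state, with expectations written as iterated finite
averages (`iterMean`); `integral_run` carries them to an arbitrary probability space. -/

namespace DistributedLearning

open Finset
open scoped BigOperators

/-! ### Iterated averages of recursions with uniform inputs -/

section Means

variable {Y S : Type*} [Fintype S]

/-- The mean of `f` after one step of a recursion driven by a uniform input from `S`. -/
noncomputable def stepMean (step : Y → S → Y) (f : Y → ℝ) (y : Y) : ℝ := 𝔼 s, f (step y s)

/-- The mean of `f` after `n` steps, from the initial state `y`. -/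
noncomputable def iterMean (step : Y → S → Y) (n : ℕ) (f : Y → ℝ) (y : Y) : ℝ :=
  (stepMean step)^[n] f y

variable {step : Y → S → Y}

lemma iterMean_succ (n : ℕ) (f : Y → ℝ) (y : Y) :
    iterMean step (n + 1) f y = iterMean step n (stepMean step f) y := rfl

lemma stepMean_mono {f g : Y → ℝ} (h : ∀ y, f y ≤ g y) (y : Y) :
    stepMean step f y ≤ stepMean step g y :=
  expect_le_expect fun _ _ => h _

lemma iterMean_mono {f g : Y → ℝ} (h : ∀ y, f y ≤ g y) (n : ℕ) (y : Y) :
    iterMean step n f y ≤ iterMean step n g y := by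
  induction n generalizing f g with
  | zero => exact h y
  | succ n ih => exact ih (stepMean_mono h)

lemma iterMean_add (f g : Y → ℝ) (n : ℕ) (y : Y) :
    iterMean step n (fun y => f y + g y) y = iterMean step n f y + iterMean step n g y := by
  induction n generalizing f g with
  | zero => rfl
  | succ n ih =>
    simp only [iterMean_succ]
    rw [← ih]
    congr 1
    funext y
    exact expect_add_distrib _ _ _

lemma iterMean_const_mul (c : ℝ) (f : Y → ℝ) (n : ℕ) (y : Y) :
    iterMean step n (fun y => c * f y) y = c * iterMean step n f y := by
  induction n generalizing f with
  | zero => rfl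
  | succ n ih =>
    simp only [iterMean_succ]
    rw [← ih]
    congr 1
    funext y
    exact (mul_expect _ _ _).symm

lemma iterMean_const [Nonempty S] (c : ℝ) (n : ℕ) (y : Y) :
    iterMean step n (fun _ => c) y = c := by
  induction n with
  | zero => rfl
  | succ n ih =>
    rw [iterMean_succ]
    convert ih using 2
    funext y
    exact Fintype.expect_const _

lemma iterMean_nonneg {f : Y → ℝ} (h : ∀ y, 0 ≤ f y) (n : ℕ) (y : Y) :
    0 ≤ iterMean step n f y := by
  induction n generalizing f with
  | zero => exact h y
  | succ n ih => exact ih fun y => expect_nonneg fun s _ => h _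

lemma iterMean_sub (f g : Y → ℝ) (n : ℕ) (y : Y) :
    iterMean step n (fun y => f y - g y) y = iterMean step n f y - iterMean step n g y := by
  have h1 := iterMean_add (step := step) f (fun y => (-1) * g y) n y
  rw [iterMean_const_mul] at h1
  rw [sub_eq_add_neg, ← neg_one_mul, ← h1]
  congr 1
  funext y
  ring

lemma abs_iterMean_sub_le {f g h : Y → ℝ} (hle : ∀ y, |f y - g y| ≤ h y) (n : ℕ) (y : Y) :
    |iterMean step n f y - iterMean step n g y| ≤ iterMean step n h y := by
  rw [abs_le]
  constructor
  · have := iterMean_mono (step := step) (fun y => (abs_le.1 (hle y)).1) n y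
    rw [iterMean_sub] at this
    have h2 := iterMean_const_mul (step := step) (-1) h n y
    simp only [neg_one_mul] at h2
    linarith
  · have := iterMean_mono (step := step) (fun y => (abs_le.1 (hle y)).2) n y
    rwa [iterMean_sub] at this

end Means

/-! ### Discrete Gronwall and contraction estimates -/

section Gronwall

lemma le_of_affine_recursion {a β : ℕ → ℝ} {α : ℝ} (hα : 0 ≤ α) (hβ : ∀ n, 0 ≤ β n) {n : ℕ}
    (h : ∀ m < n, a (m + 1) ≤ (1 + α) * a m + β m) :
    a n ≤ (1 + α) ^ n * (a 0 + ∑ i ∈ range n, β i) := by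
  induction n with
  | zero => simp
  | succ n ih =>
    have h1 := mul_le_mul_of_nonneg_left (ih fun m hm => h m (by omega))
      (show 0 ≤ 1 + α by linarith)
    have h2 : β n ≤ (1 + α) ^ (n + 1) * β n :=
      le_mul_of_one_le_left (hβ n) (one_le_pow₀ (by linarith))
    have h3 := h n (by omega)
    rw [sum_range_succ]
    rw [pow_succ] at *
    nlinarith

lemma one_add_pow_le_exp {α μ T : ℝ} (hα : 0 ≤ α) (hμ : 0 ≤ μ) {n : ℕ} (hn : n * μ ≤ T) :
    (1 + μ * α) ^ n ≤ Real.exp (α * T) := by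
  calc (1 + μ * α) ^ n ≤ Real.exp (μ * α) ^ n := by
        gcongr
        linarith [Real.add_one_le_exp (μ * α)]
    _ = Real.exp (α * (n * μ)) := by rw [← Real.exp_nat_mul]; ring_nf
    _ ≤ _ := by gcongr

lemma le_exp_of_affine_recursion {a β : ℕ → ℝ} {α μ T : ℝ} (hα : 0 ≤ α) (hμ : 0 ≤ μ)
    (h0 : 0 ≤ a 0) (hβ : ∀ n, 0 ≤ β n) {n : ℕ}
    (h : ∀ m < n, a (m + 1) ≤ (1 + μ * α) * a m + β m) (hn : n * μ ≤ T) :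
    a n ≤ Real.exp (α * T) * (a 0 + ∑ i ∈ range n, β i) :=
  (le_of_affine_recursion (mul_nonneg hμ hα) hβ h).trans <|
    mul_le_mul_of_nonneg_right (one_add_pow_le_exp hα hμ hn)
      (add_nonneg h0 (sum_nonneg fun i _ => hβ i))

/-- The form used on the slow time scale: at most `T / μ` increments of size `μ β` add up to `T β`,
with no loss in `μ`. -/
lemma le_exp_of_affine_recursion_const {a : ℕ → ℝ} {α β μ T : ℝ} (hα : 0 ≤ α) (hμ : 0 ≤ μ)
    (h0 : 0 ≤ a 0) (hβ : 0 ≤ β) {n : ℕ} (h : ∀ m < n, a (m + 1) ≤ (1 + μ * α) * a m + μ * β)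
    (hn : n * μ ≤ T) :
    a n ≤ Real.exp (α * T) * (a 0 + T * β) := by
  refine (le_exp_of_affine_recursion hα hμ h0 (fun _ => mul_nonneg hμ hβ) h hn).trans ?_
  have := mul_le_mul_of_nonneg_right hn hβ
  rw [sum_const, card_range, nsmul_eq_mul]
  exact mul_le_mul_of_nonneg_left (by linarith) (Real.exp_nonneg _)

/-- The fixed point `β / (1 - q)` of the affine map is a barrier. In contrast to the Gronwall bound,
increments of size `μ β` yield `O(μ)` uniformly in time, which is the gain available for
disagreements. -/
lemma le_of_contraction {a : ℕ → ℝ} {q β : ℝ} (hq0 : 0 ≤ q) (hq : q < 1) (h0 : a 0 = 0)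
    (hβ : 0 ≤ β) {n : ℕ} (h : ∀ m < n, a (m + 1) ≤ q * a m + β) : a n ≤ β / (1 - q) := by
  have h1q : 0 < 1 - q := by linarith
  induction n with
  | zero => rw [h0]; positivity
  | succ n ih =>
    have h1 := mul_le_mul_of_nonneg_left (ih fun m hm => h m (by omega)) hq0
    have h2 : q * (β / (1 - q)) + β = β / (1 - q) := by field_simp; ring
    linarith [h n (by omega)]

lemma sum_pow_le_inv {q : ℝ} (hq0 : 0 ≤ q) (hq : q < 1) (n : ℕ) :
    ∑ i ∈ range n, q ^ i ≤ (1 - q)⁻¹ := by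
  rw [← tsum_geometric_of_lt_one hq0 hq]
  exact (summable_geometric_of_lt_one hq0 hq).sum_le_tsum _ fun i _ => pow_nonneg hq0 i

end Gronwall

/-! ### Moments of sums of independent centred samples -/

section Batches

variable {E τ : Type*} [NormedAddCommGroup E] [InnerProductSpace ℝ E] [Fintype τ]

lemma expect_fin_succ (B : ℕ) (f : (Fin (B + 1) → τ) → ℝ) :
    𝔼 s, f s = 𝔼 s : Fin B → τ, 𝔼 t, f (Fin.cons t s) := by
  rw [← Fintype.expect_equiv (Fin.consEquiv fun _ : Fin (B + 1) => τ)
    (fun p => f (Fin.cons p.1 p.2)) f fun p => rfl, expect_comm, ← univ_product_univ,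
    expect_product]

lemma expect_inner_right {S : Type*} [Fintype S] (f : S → E) (v : E) :
    𝔼 s, inner ℝ v (f s) = inner ℝ v ((Fintype.card S : ℝ)⁻¹ • ∑ s, f s) := by
  rw [Fintype.expect_eq_sum_div_card, inner_smul_right, inner_sum, div_eq_inv_mul]

lemma expect_inner_left {S : Type*} [Fintype S] (f : S → E) (v : E) :
    𝔼 s, inner ℝ (f s) v = inner ℝ ((Fintype.card S : ℝ)⁻¹ • ∑ s, f s) v := by
  simp_rw [real_inner_comm v]
  exact expect_inner_right f v

variable [Nonempty τ]

lemma expect_inner_batchSum {z : τ → E} (hz : ∑ t, z t = 0) (v : E) (B : ℕ) :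
    𝔼 s : Fin B → τ, inner ℝ v (∑ b, z (s b)) = 0 := by
  induction B with
  | zero => simp
  | succ B ih =>
    rw [expect_fin_succ]
    simp only [Fin.sum_univ_succ, Fin.cons_zero, Fin.cons_succ, inner_add_right,
      expect_add_distrib, Fintype.expect_const, ih, add_zero]
    rw [expect_inner_right, hz]
    simp

/-- Distinct batch positions are uncorrelated, so only the `B` diagonal terms survive; after
division by `B²` this is the source of every factor `1 / B`. The operator `O` is arbitrary because
the same count is needed for norms and for the quadratic form of `Hm`. -/
lemma expect_quadratic_batchSum {z : τ → E} (hz : ∑ t, z t = 0) (O : E →ₗ[ℝ] E) (B : ℕ) :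
    𝔼 s : Fin B → τ, inner ℝ (∑ b, z (s b)) (O (∑ b, z (s b))) =
      B * 𝔼 t, inner ℝ (z t) (O (z t)) := by
  induction B with
  | zero => simp
  | succ B ih =>
    rw [expect_fin_succ]
    simp only [Fin.sum_univ_succ, Fin.cons_zero, Fin.cons_succ, inner_add_right, map_add,
      inner_add_left, expect_add_distrib, Fintype.expect_const]
    rw [ih]
    have h1 : ∀ s : Fin B → τ, 𝔼 t, inner ℝ (z t) (O (∑ b, z (s b))) = 0 := by
      intro s
      rw [expect_inner_left, hz]; simp
    have h2 : ∀ s : Fin B → τ, 𝔼 t, inner ℝ (∑ b, z (s b)) (O (z t)) = 0 := by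
      intro s
      rw [expect_inner_right, ← map_sum, hz]; simp
    simp only [h1, h2]
    simp
    ring

end Batches

end DistributedLearning

/-! ### The abstract recursion and its linear dynamics -/

namespace DistributedLearning

open Finset
open scoped BigOperators

/-- A stochastic recursion for the error `X` of a distributed gradient method,
`X' = A₂ (A₁ X + μ G X + μ s(X))`, where the noise `s` averages independent uniform samples of
`z X`, together with its linearization `W' = A₂ (A₁ W - μ H W + μ d + μ s(X))`. The operator `Pj`
projects onto the consensus subspace, on whose complement `A₂ A₁` contracts by the factor `q`;
`Hm` is the average of the diagonal blocks of `H`. -/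
structure NoisyRecursion (E τ : Type*) [NormedAddCommGroup E] [InnerProductSpace ℝ E]
    [Fintype τ] where
  A₁ : E →ₗ[ℝ] E
  A₂ : E →ₗ[ℝ] E
  H : E →ₗ[ℝ] E
  Hm : E →ₗ[ℝ] E
  Pj : E →ₗ[ℝ] E
  d : E
  G : E → E
  z : E → τ → E
  L : ℝ
  q : ℝ
  ε : ℝ
  g : ℝ
  σ : ℝ
  L_nonneg : 0 ≤ L
  q_nonneg : 0 ≤ q
  q_lt_one : q < 1
  ε_nonneg : 0 ≤ ε
  g_nonneg : 0 ≤ g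
  σ_nonneg : 0 ≤ σ
  norm_A₁ : ∀ x, ‖A₁ x‖ ≤ ‖x‖
  norm_A₂ : ∀ x, ‖A₂ x‖ ≤ ‖x‖
  norm_H : ∀ x, ‖H x‖ ≤ L * ‖x‖
  norm_Hm : ∀ x, ‖Hm x‖ ≤ L * ‖x‖
  norm_H_sub : ∀ x, ‖H x - Hm x‖ ≤ ε * ‖x‖
  Hm_symm : ∀ x y, inner ℝ (Hm x) y = inner ℝ x (Hm y)
  Pj_idem : ∀ x, Pj (Pj x) = Pj x
  Pj_symm : ∀ x y, inner ℝ (Pj x) y = inner ℝ x (Pj y)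
  Pj_A₁ : ∀ x, Pj (A₁ x) = Pj x
  Pj_A₂ : ∀ x, Pj (A₂ x) = Pj x
  A₁_Pj : ∀ x, A₁ (Pj x) = Pj x
  A₂_Pj : ∀ x, A₂ (Pj x) = Pj x
  Hm_Pj : ∀ x, Hm (Pj x) = Pj (Hm x)
  Pj_H_Pj : ∀ x, Pj (H (Pj x)) = Hm (Pj x)
  Pj_d : Pj d = 0
  gap : ∀ x, Pj x = 0 → ‖A₂ (A₁ x)‖ ≤ q * ‖x‖
  -- A bound of its own rather than a multiple of `‖d‖`: it is `0` for the centralized method, which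
  -- removes every `μ²` term there.
  norm_drift_sum : ∀ n : ℕ, ‖∑ j ∈ range n, ((A₂ ∘ₗ A₁) ^ j) (A₂ d)‖ ≤ g
  norm_G_sub : ∀ x, ‖G x - d‖ ≤ L * ‖x‖
  -- The substitute for a higher-order Taylor bound, available without a Lipschitz Hessian.
  remainder : ∀ δ > 0, ∃ C, 0 ≤ C ∧ ∀ x, ‖G x - d + H x‖ ^ 2 ≤ δ * ‖x‖ ^ 2 + C * ‖x‖ ^ 4
  sum_z : ∀ x, ∑ t, z x t = 0
  norm_z_zero : ∀ t, ‖z 0 t‖ ≤ σ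
  norm_z_sub : ∀ x t, ‖z x t - z 0 t‖ ≤ σ * ‖x‖

namespace NoisyRecursion

variable {E τ : Type*} [NormedAddCommGroup E] [InnerProductSpace ℝ E] [Fintype τ]
  (m : NoisyRecursion E τ)

/-- The linear part `A₂ (A₁ - μ H)` of the recursion. -/
def lin (μ : ℝ) : E →ₗ[ℝ] E := m.A₂ ∘ₗ (m.A₁ - μ • m.H)

/-- The noiseless linearized recursion. -/
def affine (μ : ℝ) (w : E) : E := m.lin μ w + μ • m.A₂ m.d

/-- The state reached from `0` when only `d` drives the network. -/
noncomputable def drift (μ : ℝ) (n : ℕ) : E :=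
  μ • ∑ j ∈ range n, ((m.A₂ ∘ₗ m.A₁) ^ j) (m.A₂ m.d)

/-- The recursion of the centroid, `1 - μ Hm`. -/
def centroid (μ : ℝ) : E →ₗ[ℝ] E := 1 - μ • m.Hm

/-- The component orthogonal to the consensus subspace. -/
def Pc : E →ₗ[ℝ] E := 1 - m.Pj

lemma Pc_apply (x : E) : m.Pc x = x - m.Pj x := rfl

lemma Pj_add_Pc (x : E) : m.Pj x + m.Pc x = x := by simp [Pc_apply]

lemma Pj_Pc (x : E) : m.Pj (m.Pc x) = 0 := by simp [Pc_apply, m.Pj_idem]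

lemma Pc_Pj (x : E) : m.Pc (m.Pj x) = 0 := by simp [Pc_apply, m.Pj_idem]

lemma Pc_of_Pj_eq_zero {x : E} (h : m.Pj x = 0) : m.Pc x = x := by simp [Pc_apply, h]

lemma inner_Pj_Pc (x y : E) : inner ℝ (m.Pj x) (m.Pc y) = 0 := by
  rw [m.Pj_symm, m.Pj_Pc, inner_zero_right]

lemma norm_sq_eq (x : E) : ‖x‖ ^ 2 = ‖m.Pj x‖ ^ 2 + ‖m.Pc x‖ ^ 2 := by
  conv_lhs => rw [← m.Pj_add_Pc x, norm_add_sq_real, m.inner_Pj_Pc]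
  ring

lemma norm_Pj_le (x : E) : ‖m.Pj x‖ ≤ ‖x‖ :=
  abs_le_of_sq_le_sq' (by rw [m.norm_sq_eq x]; nlinarith [sq_nonneg ‖m.Pc x‖]) (norm_nonneg _) |>.2

lemma norm_Pc_le (x : E) : ‖m.Pc x‖ ≤ ‖x‖ :=
  abs_le_of_sq_le_sq' (by rw [m.norm_sq_eq x]; nlinarith [sq_nonneg ‖m.Pj x‖]) (norm_nonneg _) |>.2

lemma lin_apply (μ : ℝ) (x : E) :
    m.lin μ x = m.A₂ (m.A₁ x) - μ • m.A₂ (m.H x) := by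
  simp [lin]

lemma norm_lin_le {μ : ℝ} (hμ : 0 ≤ μ) (x : E) : ‖m.lin μ x‖ ≤ (1 + μ * m.L) * ‖x‖ := by
  rw [lin_apply]
  calc _ ≤ ‖m.A₂ (m.A₁ x)‖ + ‖μ • m.A₂ (m.H x)‖ := norm_sub_le _ _
    _ ≤ ‖x‖ + μ * (m.L * ‖x‖) := by
      rw [norm_smul, Real.norm_of_nonneg hμ]
      gcongr
      · exact (m.norm_A₂ _).trans (m.norm_A₁ _)
      · exact (m.norm_A₂ _).trans (m.norm_H _)
    _ = _ := by ring

lemma norm_lin_pow_le {μ T : ℝ} (hμ : 0 ≤ μ) {n : ℕ} (hn : n * μ ≤ T) (x : E) :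
    ‖(m.lin μ ^ n) x‖ ≤ Real.exp (m.L * T) * ‖x‖ := by
  have : ∀ n : ℕ, ‖(m.lin μ ^ n) x‖ ≤ (1 + μ * m.L) ^ n * ‖x‖ := by
    intro n
    induction n with
    | zero => simp
    | succ n ih =>
      rw [pow_succ', Module.End.mul_apply, pow_succ', mul_assoc]
      refine (m.norm_lin_le hμ _).trans ?_
      have := mul_nonneg hμ m.L_nonneg
      gcongr
  exact (this n).trans (mul_le_mul_of_nonneg_right (one_add_pow_le_exp m.L_nonneg hμ hn)
    (norm_nonneg _))

lemma norm_centroid_le {μ : ℝ} (hμ : 0 ≤ μ) (x : E) :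
    ‖m.centroid μ x‖ ≤ (1 + μ * m.L) * ‖x‖ := by
  calc _ ≤ ‖x‖ + ‖μ • m.Hm x‖ := norm_sub_le _ _
    _ ≤ ‖x‖ + μ * (m.L * ‖x‖) := by
      rw [norm_smul, Real.norm_of_nonneg hμ]
      gcongr
      exact m.norm_Hm _
    _ = _ := by ring

lemma norm_centroid_pow_le {μ T : ℝ} (hμ : 0 ≤ μ) {n : ℕ} (hn : n * μ ≤ T) (x : E) :
    ‖(m.centroid μ ^ n) x‖ ≤ Real.exp (m.L * T) * ‖x‖ := by
  have : ∀ n : ℕ, ‖(m.centroid μ ^ n) x‖ ≤ (1 + μ * m.L) ^ n * ‖x‖ := by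
    intro n
    induction n with
    | zero => simp
    | succ n ih =>
      rw [pow_succ', Module.End.mul_apply, pow_succ', mul_assoc]
      refine (m.norm_centroid_le hμ _).trans ?_
      have := mul_nonneg hμ m.L_nonneg
      gcongr
  exact (this n).trans (mul_le_mul_of_nonneg_right (one_add_pow_le_exp m.L_nonneg hμ hn)
    (norm_nonneg _))

lemma centroid_pow_Pj (μ : ℝ) (n : ℕ) (x : E) :
    m.Pj ((m.centroid μ ^ n) (m.Pj x)) = (m.centroid μ ^ n) (m.Pj x) := by
  induction n with
  | zero => simp [m.Pj_idem]
  | succ n ih =>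
    rw [pow_succ', Module.End.mul_apply, ← ih]
    simp [centroid, m.Pj_idem, m.Hm_Pj]

lemma Pc_A₂_A₁ (x : E) : m.Pc (m.A₂ (m.A₁ x)) = m.A₂ (m.A₁ (m.Pc x)) := by
  simp [Pc_apply, m.Pj_A₁, m.Pj_A₂, m.A₁_Pj, m.A₂_Pj]

lemma norm_Pc_A₂_A₁_le (x : E) : ‖m.Pc (m.A₂ (m.A₁ x))‖ ≤ m.q * ‖m.Pc x‖ := by
  rw [Pc_A₂_A₁]
  exact m.gap _ (m.Pj_Pc x)

lemma drift_succ (μ : ℝ) (n : ℕ) :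
    m.drift μ (n + 1) = m.A₂ (m.A₁ (m.drift μ n)) + μ • m.A₂ m.d := by
  simp only [drift, sum_range_succ', pow_succ', map_smul, map_sum, smul_add, pow_zero]
  rfl

lemma Pj_drift (μ : ℝ) (n : ℕ) : m.Pj (m.drift μ n) = 0 := by
  induction n with
  | zero => simp [drift]
  | succ n ih => rw [drift_succ, map_add, m.Pj_A₂, m.Pj_A₁, ih, map_smul, m.Pj_A₂, m.Pj_d]; simp

lemma norm_drift_le {μ : ℝ} (hμ : 0 ≤ μ) (n : ℕ) : ‖m.drift μ n‖ ≤ m.g * μ := by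
  rw [drift, norm_smul, Real.norm_of_nonneg hμ, mul_comm]
  exact mul_le_mul_of_nonneg_right (m.norm_drift_sum n) hμ

lemma norm_contraction_pow_le {x : E} (hx : m.Pj x = 0) (n : ℕ) :
    m.Pj (((m.A₂ ∘ₗ m.A₁) ^ n) x) = 0 ∧ ‖((m.A₂ ∘ₗ m.A₁) ^ n) x‖ ≤ m.q ^ n * ‖x‖ := by
  induction n with
  | zero => simp [hx]
  | succ n ih =>
    rw [pow_succ', Module.End.mul_apply, LinearMap.comp_apply]
    refine ⟨by rw [m.Pj_A₂, m.Pj_A₁, ih.1], (m.gap _ ih.1).trans ?_⟩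
    rw [pow_succ', mul_assoc]
    exact mul_le_mul_of_nonneg_left ih.2 m.q_nonneg

lemma norm_smul_le {μ c : ℝ} (hμ : 0 ≤ μ) {x : E} (hx : ‖x‖ ≤ c) : ‖μ • x‖ ≤ μ * c := by
  rw [norm_smul, Real.norm_of_nonneg hμ]
  exact mul_le_mul_of_nonneg_left hx hμ

/-- Over a horizon of order `1 / μ`, noise injected at some time acts through its centroid, up to a
geometrically decaying disagreement and a term of order `μ`. -/
lemma norm_lin_pow_sub_le {T : ℝ} : ∃ C, 0 ≤ C ∧ ∀ (μ : ℝ) (n : ℕ), 0 ≤ μ → n * μ ≤ T →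
    ∀ v, ‖(m.lin μ ^ n) (m.A₂ v) - (m.centroid μ ^ n) (m.Pj v)‖ ≤ (C * μ + m.q ^ n) * ‖v‖ := by
  have hq : 0 < 1 - m.q := by linarith [m.q_lt_one]
  have hL := m.L_nonneg
  have hq0 := m.q_nonneg
  set c := Real.exp (m.L * T) with hc
  have hc0 : 0 < c := Real.exp_pos _
  set k := m.L * c / (1 - m.q) with hk
  have hk0 : 0 ≤ k := by positivity
  refine ⟨c * (|T| * m.L * k + m.L * (1 - m.q)⁻¹) + k, by positivity, fun μ n hμ hn v => ?_⟩
  -- Ansatz: the disagreement `e` evolves as if `μ` were `0`, the centroid `Ψ` by `1 - μ Hm`; the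
  -- remainder `r` starts at `0` and has to be `O(μ)`.
  set e : ℕ → E := fun i => ((m.A₂ ∘ₗ m.A₁) ^ i) (m.A₂ (m.Pc v)) with he
  set F : ℕ → E := fun i => (m.lin μ ^ i) (m.A₂ v) with hF
  set Ψ : ℕ → E := fun i => (m.centroid μ ^ i) (m.Pj v) with hΨ
  set r : ℕ → E := fun i => F i - Ψ i - e i with hr
  have hPjv : m.Pj (m.A₂ (m.Pc v)) = 0 := by rw [m.Pj_A₂, m.Pj_Pc]
  have he_norm : ∀ i, ‖e i‖ ≤ m.q ^ i * ‖v‖ := fun i =>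
    (m.norm_contraction_pow_le hPjv i).2.trans (mul_le_mul_of_nonneg_left
      ((m.norm_A₂ _).trans (m.norm_Pc_le _)) (pow_nonneg hq0 _))
  have hPje : ∀ i, m.Pj (e i) = 0 := fun i => (m.norm_contraction_pow_le hPjv i).1
  have hPjΨ : ∀ i, m.Pj (Ψ i) = Ψ i := fun i => m.centroid_pow_Pj μ i v
  have hF_norm : ∀ i : ℕ, (i : ℝ) * μ ≤ T → ‖F i‖ ≤ c * ‖v‖ := fun i hi =>
    (m.norm_lin_pow_le hμ hi _).trans (mul_le_mul_of_nonneg_left (m.norm_A₂ v) hc0.le)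
  have hAΨ : ∀ i, m.A₂ (m.A₁ (Ψ i)) = Ψ i := fun i => by
    rw [← hPjΨ, m.A₁_Pj, m.A₂_Pj]
  have hr0 : r 0 = 0 := by
    have : m.A₂ (m.Pj v) = m.Pj v := m.A₂_Pj v
    simp [hr, hF, hΨ, he, Pc_apply, this]
  have hrs : ∀ i, r (i + 1) = m.A₂ (m.A₁ (r i)) - μ • m.A₂ (m.H (F i)) + μ • m.Hm (Ψ i) := by
    intro i
    have h1 : F (i + 1) = m.A₂ (m.A₁ (F i)) - μ • m.A₂ (m.H (F i)) := by
      simp only [hF]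
      rw [pow_succ', Module.End.mul_apply, lin_apply]
    have h2 : Ψ (i + 1) = Ψ i - μ • m.Hm (Ψ i) := by
      simp only [hΨ]
      rw [pow_succ', Module.End.mul_apply]
      rfl
    have h3 : e (i + 1) = m.A₂ (m.A₁ (e i)) := by
      simp only [he]
      rw [pow_succ', Module.End.mul_apply]
      rfl
    simp only [hr, h1, h2, h3, map_sub, hAΨ]
    abel
  -- On the complement the forcing of `r` is `O(μ)` and `A₂ A₁` contracts, so nothing accumulates.
  have hPcr : ∀ i ≤ n, ‖m.Pc (r i)‖ ≤ μ * k * ‖v‖ := by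
    intro i hi
    have hle : ∀ j ≤ i, (j : ℝ) * μ ≤ T := fun j hj => le_trans (by gcongr; omega) hn
    have := le_of_contraction (a := fun i => ‖m.Pc (r i)‖) (q := m.q) (β := μ * (m.L * (c * ‖v‖)))
      hq0 m.q_lt_one (by simp [hr0]) (by positivity) (n := i) (by
        intro j hj
        have h1 : m.Pc (r (j + 1)) =
            m.Pc (m.A₂ (m.A₁ (r j))) - μ • m.Pc (m.A₂ (m.H (F j))) := by
          rw [hrs, map_add, map_sub, map_smul, map_smul, ← hPjΨ j, m.Hm_Pj, m.Pc_Pj]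
          simp
        rw [h1]
        refine (norm_sub_le _ _).trans (add_le_add (m.norm_Pc_A₂_A₁_le _) (norm_smul_le hμ ?_))
        refine (m.norm_Pc_le _).trans ((m.norm_A₂ _).trans ((m.norm_H _).trans ?_))
        exact mul_le_mul_of_nonneg_left (hF_norm j (hle j hj.le)) hL)
    refine this.trans (le_of_eq ?_)
    rw [hk]; ring
  -- In the centroid the drive of `Ψ` cancels because `Pj H Pj = Hm Pj`. The remaining forcing `μ (μ
  -- k + q ^ i)` sums to `O(μ)`: the first part over `T / μ` steps, the second as a geometric
  -- series.
  have hPjr : ‖m.Pj (r n)‖ ≤ c * (|T| * m.L * k + m.L * (1 - m.q)⁻¹) * μ * ‖v‖ := by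
    have := le_exp_of_affine_recursion (a := fun i => ‖m.Pj (r i)‖) (α := m.L) (μ := μ)
      (β := fun i => μ * (m.L * (μ * k * ‖v‖ + m.q ^ i * ‖v‖))) hL hμ (norm_nonneg _)
      (fun i => by positivity) (n := n) (by
        intro i hi
        have h1 : m.Pj (r (i + 1)) = m.Pj (r i) - μ • m.Pj (m.H (m.Pj (r i))) -
            μ • m.Pj (m.H (m.Pc (r i) + e i)) := by
          have h2 : F i = m.Pj (r i) + (m.Pc (r i) + e i) + Ψ i := by
            rw [← add_assoc, m.Pj_add_Pc]; simp [hr]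
          have h3 : m.Pj (m.H (Ψ i)) = m.Hm (Ψ i) := by rw [← hPjΨ, m.Pj_H_Pj]
          have h4 : m.Pj (m.Hm (Ψ i)) = m.Hm (Ψ i) := by
            rw [← hPjΨ, m.Hm_Pj, m.Pj_idem]
          rw [hrs, map_add, map_sub, m.Pj_A₂, m.Pj_A₁, map_smul, map_smul, m.Pj_A₂, h4]
          rw [h2, map_add m.H, map_add m.Pj, h3, map_add m.H, map_add m.Pj]
          simp only [smul_add]
          abel
        rw [h1]
        have h5 : ‖m.Pj (m.H (m.Pj (r i)))‖ ≤ m.L * ‖m.Pj (r i)‖ :=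
          (m.norm_Pj_le _).trans (m.norm_H _)
        have h6 : ‖m.Pj (m.H (m.Pc (r i) + e i))‖ ≤ m.L * (μ * k * ‖v‖ + m.q ^ i * ‖v‖) :=
          (m.norm_Pj_le _).trans ((m.norm_H _).trans (mul_le_mul_of_nonneg_left
            ((norm_add_le _ _).trans (add_le_add (hPcr i hi.le) (he_norm i))) hL))
        calc _ ≤ ‖m.Pj (r i)‖ + ‖μ • m.Pj (m.H (m.Pj (r i)))‖ +
              ‖μ • m.Pj (m.H (m.Pc (r i) + e i))‖ :=
              (norm_sub_le _ _).trans (add_le_add_left (norm_sub_le _ _) _)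
          _ ≤ ‖m.Pj (r i)‖ + μ * (m.L * ‖m.Pj (r i)‖) +
              μ * (m.L * (μ * k * ‖v‖ + m.q ^ i * ‖v‖)) := by
              gcongr
              exacts [norm_smul_le hμ h5, norm_smul_le hμ h6]
          _ = _ := by ring) hn
    refine this.trans ?_
    rw [hr0, map_zero, norm_zero, zero_add, show
      c * (|T| * m.L * k + m.L * (1 - m.q)⁻¹) * μ * ‖v‖ =
      c * ((|T| * m.L * k + m.L * (1 - m.q)⁻¹) * (μ * ‖v‖)) by ring]
    refine mul_le_mul_of_nonneg_left ?_ hc0.le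
    have hsum : ∑ i ∈ range n, μ * (m.L * (μ * k * ‖v‖ + m.q ^ i * ‖v‖)) =
        (n * μ) * (m.L * k * (μ * ‖v‖)) + (∑ i ∈ range n, m.q ^ i) * (m.L * (μ * ‖v‖)) := by
      simp only [mul_add, sum_add_distrib, sum_const, card_range, nsmul_eq_mul, sum_mul]
      congr 1
      · ring
      · exact sum_congr rfl fun i _ => by ring
    rw [hsum]
    have h1 : (n * μ) * (m.L * k * (μ * ‖v‖)) ≤ |T| * (m.L * k * (μ * ‖v‖)) := by
      gcongr
      exact hn.trans (le_abs_self T)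
    have h2 : (∑ i ∈ range n, m.q ^ i) * (m.L * (μ * ‖v‖)) ≤
        (1 - m.q)⁻¹ * (m.L * (μ * ‖v‖)) := by
      gcongr
      exact sum_pow_le_inv hq0 m.q_lt_one n
    calc _ ≤ _ := add_le_add h1 h2
      _ = _ := by ring
  have hfin : F n - Ψ n = m.Pj (r n) + m.Pc (r n) + e n := by rw [m.Pj_add_Pc]; simp [hr]
  change ‖F n - Ψ n‖ ≤ _
  rw [hfin]
  calc _ ≤ ‖m.Pj (r n)‖ + ‖m.Pc (r n)‖ + ‖e n‖ :=
        (norm_add_le _ _).trans (add_le_add_left (norm_add_le _ _) _)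
    _ ≤ _ := by
      have := hPcr n le_rfl
      have := he_norm n
      nlinarith

/-- The mean of the linearized recursion started at `0` is close to the drift. -/
lemma norm_affine_iterate_sub_drift_le {T : ℝ} (hT : 0 ≤ T) : ∃ C, 0 ≤ C ∧ ∀ (μ : ℝ) (n : ℕ),
    0 ≤ μ → μ ≤ 1 → n * μ ≤ T →
    ‖m.Pc ((m.affine μ)^[n] 0 - m.drift μ n)‖ ≤ C * m.g * μ ^ 2 ∧
    ‖m.Pj ((m.affine μ)^[n] 0)‖ ≤
      Real.exp (m.L * T) * T * m.ε * m.g * μ + C * m.g * μ ^ 2 := by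
  have hq : 0 < 1 - m.q := by linarith [m.q_lt_one]
  have hL := m.L_nonneg
  have hq0 := m.q_nonneg
  have hg := m.g_nonneg
  have hε := m.ε_nonneg
  set c := Real.exp (m.L * T) with hc
  have hc0 : 0 < c := Real.exp_pos _
  set k := m.L * (c * T * m.L + 1) / (1 - m.q) with hk
  have hk0 : 0 ≤ k := by positivity
  refine ⟨k + c * T * m.L * k, by positivity, fun μ n hμ hμ1 hn => ?_⟩
  set R : ℕ → E := fun i => (m.affine μ)^[i] 0 - m.drift μ i with hR
  have hR0 : R 0 = 0 := by simp [hR, drift]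
  have hRs : ∀ i, R (i + 1) = m.A₂ (m.A₁ (R i)) - μ • m.A₂ (m.H (R i + m.drift μ i)) := by
    intro i
    simp only [hR, Function.iterate_succ_apply', drift_succ, affine, lin_apply, sub_add_cancel,
      map_sub]
    abel
  have hle : ∀ j ≤ n, (j : ℝ) * μ ≤ T := fun j hj => le_trans (by gcongr) hn
  -- A first, crude bound of order `g μ`; the contraction then improves the disagreement part to
  -- order `g μ²`.
  have hRn : ∀ i ≤ n, ‖R i‖ ≤ c * (T * (m.L * (m.g * μ))) := by
    intro i hi
    have := le_exp_of_affine_recursion_const (a := fun i => ‖R i‖) (α := m.L) (μ := μ)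
      (β := m.L * (m.g * μ)) hL hμ (norm_nonneg _) (by positivity) (n := i) (by
        intro j hj
        rw [hRs]
        calc _ ≤ ‖m.A₂ (m.A₁ (R j))‖ + ‖μ • m.A₂ (m.H (R j + m.drift μ j))‖ := norm_sub_le _ _
          _ ≤ ‖R j‖ + μ * (m.L * (‖R j‖ + m.g * μ)) := by
            refine add_le_add ((m.norm_A₂ _).trans (m.norm_A₁ _)) (norm_smul_le hμ ?_)
            refine (m.norm_A₂ _).trans ((m.norm_H _).trans (mul_le_mul_of_nonneg_left ?_ hL))
            exact (norm_add_le _ _).trans (by gcongr; exact m.norm_drift_le hμ j)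
          _ = _ := by ring) (hle i hi)
    simpa [hR0] using this
  have hPcR : ∀ i ≤ n, ‖m.Pc (R i)‖ ≤ k * m.g * μ ^ 2 := by
    intro i hi
    have := le_of_contraction (a := fun i => ‖m.Pc (R i)‖) (q := m.q)
      (β := μ * (m.L * (c * (T * (m.L * (m.g * μ))) + m.g * μ)))
      hq0 m.q_lt_one (by simp [hR0]) (by positivity) (n := i) (by
        intro j hj
        rw [hRs, map_sub, map_smul]
        refine (norm_sub_le _ _).trans (add_le_add (m.norm_Pc_A₂_A₁_le _) (norm_smul_le hμ ?_))
        refine (m.norm_Pc_le _).trans ((m.norm_A₂ _).trans ((m.norm_H _).trans ?_))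
        refine mul_le_mul_of_nonneg_left ((norm_add_le _ _).trans ?_) hL
        exact add_le_add (hRn j (by omega)) (m.norm_drift_le hμ j))
    refine this.trans (le_of_eq ?_)
    rw [hk]; ring
  refine ⟨(hPcR n le_rfl).trans ?_, ?_⟩
  · have : 0 ≤ c * T * m.L * k := by positivity
    gcongr
    linarith
  · have hPjR : m.Pj ((m.affine μ)^[n] 0) = m.Pj (R n) := by simp [hR, m.Pj_drift]
    rw [hPjR]
    have := le_exp_of_affine_recursion_const (a := fun i => ‖m.Pj (R i)‖) (α := m.L) (μ := μ)
      (β := m.L * (k * m.g * μ ^ 2) + m.ε * (m.g * μ)) hL hμ (norm_nonneg _) (by positivity)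
      (n := n) (by
        intro j hj
        -- The drift has no centroid and `Hm` commutes with `Pj`, so only the Hessian disagreement
        -- `H - Hm` moves the centroid. This is the only place where `ε` enters.
        have h1 : m.Pj (m.H (m.drift μ j)) = m.Pj (m.H (m.drift μ j) - m.Hm (m.drift μ j)) := by
          rw [map_sub, ← m.Hm_Pj, m.Pj_drift, map_zero, sub_zero]
        have h2 : m.Pj (R (j + 1)) = m.Pj (R j) - μ • (m.Pj (m.H (m.Pj (R j))) +
            m.Pj (m.H (m.Pc (R j))) +
            m.Pj (m.H (m.drift μ j) - m.Hm (m.drift μ j))) := by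
          rw [hRs, map_sub, map_smul, m.Pj_A₂, m.Pj_A₁, m.Pj_A₂, ← h1]
          rw [← map_add, ← map_add, ← map_add, ← map_add, m.Pj_add_Pc]
        rw [h2]
        calc _ ≤ ‖m.Pj (R j)‖ + μ * (m.L * ‖m.Pj (R j)‖ + m.L * (k * m.g * μ ^ 2) +
              m.ε * (m.g * μ)) := by
              refine (norm_sub_le _ _).trans (add_le_add le_rfl (norm_smul_le hμ ?_))
              refine (norm_add_le _ _).trans (add_le_add ((norm_add_le _ _).trans
                (add_le_add ?_ ?_)) ?_)
              · exact (m.norm_Pj_le _).trans (m.norm_H _)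
              · exact (m.norm_Pj_le _).trans ((m.norm_H _).trans
                  (mul_le_mul_of_nonneg_left (hPcR j hj.le) hL))
              · exact (m.norm_Pj_le _).trans ((m.norm_H_sub _).trans
                  (mul_le_mul_of_nonneg_left (m.norm_drift_le hμ j) hε))
          _ = _ := by ring) hn
    rw [hR0, map_zero, norm_zero, zero_add] at this
    refine this.trans (le_of_sub_nonneg ?_)
    have : 0 ≤ k * m.g * μ ^ 2 := by positivity
    refine this.trans (le_of_eq ?_)
    ring

end NoisyRecursion

end DistributedLearning

/-! ### Second and fourth moments of the error -/

namespace DistributedLearning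

open Finset
open scoped BigOperators

/-- The term linear in `w` is kept exactly, because it averages to zero when `w` is noise. The rest
is Cauchy–Schwarz together with `4 ‖v‖ ‖w‖³ ≤ 2 ‖v‖² ‖w‖² + 2 ‖w‖⁴`. -/
lemma norm_add_pow_four_le {E : Type*} [NormedAddCommGroup E] [InnerProductSpace ℝ E] (v w : E) :
    ‖v + w‖ ^ 4 ≤ ‖v‖ ^ 4 + 4 * ‖v‖ ^ 2 * inner ℝ v w + 8 * ‖v‖ ^ 2 * ‖w‖ ^ 2 + 3 * ‖w‖ ^ 4 := by
  have h1 : ‖v + w‖ ^ 4 = (‖v‖ ^ 2 + 2 * inner ℝ v w + ‖w‖ ^ 2) ^ 2 := by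
    rw [← norm_add_sq_real]; ring
  have h2 := abs_le.1 (abs_real_inner_le_norm v w)
  rw [h1]
  set p := inner ℝ v w
  have hv := norm_nonneg v
  have hw := norm_nonneg w
  have h3 : p ^ 2 ≤ (‖v‖ * ‖w‖) ^ 2 := sq_le_sq' h2.1 h2.2
  have h4 : p * ‖w‖ ^ 2 ≤ ‖v‖ * ‖w‖ * ‖w‖ ^ 2 := mul_le_mul_of_nonneg_right h2.2 (sq_nonneg _)
  nlinarith [mul_nonneg (sq_nonneg ‖w‖) (sq_nonneg (‖v‖ - ‖w‖))]

/-- Every cross term carries a factor `μ`, so squaring preserves the shape `(1 + O(μ)) a² + O(μ) e²`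
that the Gronwall lemma requires. -/
lemma sq_affine_le {a e μ L p : ℝ} (hL : 0 ≤ L) (hμ : 0 ≤ μ)
    (hμ1 : μ ≤ 1) (hp : 0 ≤ p) (h : p ≤ (1 + μ * L) * a + μ * L * e) :
    p ^ 2 ≤ (1 + μ * (3 * L + 2 * L ^ 2)) * a ^ 2 + μ * (3 * L + 2 * L ^ 2) * e ^ 2 := by
  have h1 : p ^ 2 ≤ ((1 + μ * L) * a + μ * L * e) ^ 2 := by gcongr
  have h2 : 0 ≤ μ * L := mul_nonneg hμ hL
  have h3 : 0 ≤ μ * (1 - μ) * L ^ 2 := by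
    have : 0 ≤ 1 - μ := by linarith
    positivity
  nlinarith [mul_nonneg h2 (sq_nonneg (a - e)), mul_nonneg h3 (sq_nonneg (a - e)),
    mul_nonneg h3 (sq_nonneg a), mul_nonneg h3 (sq_nonneg e), mul_nonneg h2 (sq_nonneg e),
    mul_nonneg (mul_nonneg hμ (sq_nonneg L)) (sq_nonneg (a - e))]

/-- Here `b = 1 / B`, the number `N` stands for `1 + ‖x‖`, and `a`, `e` for the squares of the
deviation from the drift and of the bound on the drift. One factor `μ` is set aside for the Gronwall
step; the state-dependent part of the variance gives up its factor `μ b ≤ 1`. -/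
lemma batch_noise_le {μ b a e σ N : ℝ} (hμ : 0 ≤ μ) (hμ1 : μ ≤ 1) (hb : 0 ≤ b) (hb1 : b ≤ 1)
    (ha : 0 ≤ a) (he : 0 ≤ e) (hN : N ^ 2 ≤ 3 * (1 + a + e)) :
    μ ^ 2 * (b * (σ * N) ^ 2) ≤ μ * (3 * σ ^ 2) * (μ * b + a + e) := by
  calc _ = μ ^ 2 * b * σ ^ 2 * N ^ 2 := by ring
    _ ≤ μ ^ 2 * b * σ ^ 2 * (3 * (1 + a + e)) := by gcongr
    _ = μ * (3 * σ ^ 2) * (μ * b * 1 + (μ * b) * (a + e)) := by ring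
    _ ≤ μ * (3 * σ ^ 2) * (μ * b * 1 + 1 * (a + e)) := by
      gcongr
      exact mul_le_one₀ hμ1 hb hb1
    _ = _ := by ring

lemma second_moment_step_le {μ b a e σ N l p : ℝ} (hμ : 0 ≤ μ) (hμ1 : μ ≤ 1) (hb : 0 ≤ b)
    (hb1 : b ≤ 1) (ha : 0 ≤ a) (he : 0 ≤ e) (hl : 0 ≤ l) (hN : N ^ 2 ≤ 3 * (1 + a + e))
    (hp : p ≤ (1 + μ * l) * a + μ * l * e) :
    p + μ ^ 2 * (b * (σ * N) ^ 2) ≤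
      (1 + μ * (l + 3 * σ ^ 2)) * a + μ * ((l + 3 * σ ^ 2) * (μ * b + e)) := by
  have h1 := batch_noise_le (σ := σ) hμ hμ1 hb hb1 ha he hN
  have h2 : 0 ≤ μ * l * (μ * b) := by positivity
  linarith

lemma fourth_moment_cross_le {μ b a e σ N l p : ℝ} (hμ : 0 ≤ μ) (hμ1 : μ ≤ 1) (hb : 0 ≤ b)
    (hb1 : b ≤ 1) (ha : 0 ≤ a) (he : 0 ≤ e) (hl : 0 ≤ l) (hN : N ^ 2 ≤ 3 * (1 + a + e))
    (hp : p ≤ (1 + l) * (a + e)) :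
    8 * p * (μ ^ 2 * (b * (σ * N) ^ 2)) ≤
      μ * (24 * σ ^ 2 * (3 * (1 + l))) * (μ ^ 2 * b + a ^ 2 + e ^ 2) := by
  have h1 := batch_noise_le (σ := σ) hμ hμ1 hb hb1 ha he hN
  have hbb : (μ * b) ^ 2 ≤ μ ^ 2 * b := by
    rw [mul_pow]
    gcongr
    nlinarith
  have h2 : (a + e) * (μ * b + a + e) ≤ 3 * (μ ^ 2 * b + a ^ 2 + e ^ 2) := by
    have : 0 ≤ μ ^ 2 * b := by positivity
    nlinarith [sq_nonneg (a - μ * b), sq_nonneg (e - μ * b), sq_nonneg (a - e)]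
  calc _ ≤ 8 * ((1 + l) * (a + e)) * (μ * (3 * σ ^ 2) * (μ * b + a + e)) := by gcongr
    _ = μ * (24 * σ ^ 2) * (1 + l) * ((a + e) * (μ * b + a + e)) := by ring
    _ ≤ μ * (24 * σ ^ 2) * (1 + l) * (3 * (μ ^ 2 * b + a ^ 2 + e ^ 2)) := by gcongr
    _ = _ := by ring

lemma fourth_moment_noise_le {μ b a e σ N : ℝ} (hμ : 0 ≤ μ) (hμ1 : μ ≤ 1) (hb : 0 ≤ b) (hb1 : b ≤ 1)
    (hN : N ^ 2 ≤ 3 * (1 + a + e)) :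
    3 * (μ ^ 4 * (b * (σ * N) ^ 4)) ≤ μ * (81 * σ ^ 4) * (μ ^ 2 * b + a ^ 2 + e ^ 2) := by
  have hs4 : N ^ 4 ≤ 27 * (1 + a ^ 2 + e ^ 2) := by
    calc N ^ 4 = (N ^ 2) ^ 2 := by ring
      _ ≤ (3 * (1 + a + e)) ^ 2 := by gcongr
      _ ≤ _ := by nlinarith [sq_nonneg (1 - a), sq_nonneg (1 - e), sq_nonneg (a - e)]
  have hμ4 : μ ^ 4 * b ≤ μ * (μ ^ 2 * b) := by
    have : μ ^ 4 * b = μ * (μ * (μ ^ 2 * b)) := by ring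
    rw [this]
    refine mul_le_mul_of_nonneg_left ?_ hμ
    exact mul_le_of_le_one_left (by positivity) hμ1
  have hμ5 : μ ^ 4 * b ≤ μ * 1 := hμ4.trans
    (mul_le_mul_of_nonneg_left (mul_le_one₀ (pow_le_one₀ hμ hμ1) hb hb1) hμ)
  calc _ = 3 * σ ^ 4 * (μ ^ 4 * b * N ^ 4) := by ring
    _ ≤ 3 * σ ^ 4 * (μ ^ 4 * b * (27 * (1 + a ^ 2 + e ^ 2))) := by gcongr
    _ = 81 * σ ^ 4 * (μ ^ 4 * b + (μ ^ 4 * b) * (a ^ 2 + e ^ 2)) := by ring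
    _ ≤ 81 * σ ^ 4 * (μ * (μ ^ 2 * b) + μ * 1 * (a ^ 2 + e ^ 2)) := by gcongr
    _ = _ := by ring

/-- The source per step is `μ · (μ² b + e²)`, hence `O(μ² / B)` after `T / μ` steps. The sharper `μ²
/ B²` is not needed, since `μ² / B` is already of higher order than the second moment. -/
lemma fourth_moment_step_le {μ b a e σ N l p : ℝ} (hμ : 0 ≤ μ) (hμ1 : μ ≤ 1) (hb : 0 ≤ b)
    (hb1 : b ≤ 1) (ha : 0 ≤ a) (he : 0 ≤ e) (hl : 0 ≤ l) (hN : N ^ 2 ≤ 3 * (1 + a + e))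
    (hp0 : 0 ≤ p) (hp : p ≤ (1 + μ * l) * a + μ * l * e) {γ : ℝ}
    (hγ : γ = 3 * l + 2 * l ^ 2 + 24 * σ ^ 2 * (3 * (1 + l)) + 81 * σ ^ 4) :
    p ^ 2 + 8 * p * (μ ^ 2 * (b * (σ * N) ^ 2)) + 3 * (μ ^ 4 * (b * (σ * N) ^ 4)) ≤
      (1 + μ * γ) * a ^ 2 + μ * (γ * (μ ^ 2 * b + e ^ 2)) := by
  have hpa : p ≤ (1 + l) * (a + e) := by
    have : μ * l ≤ 1 * l := by gcongr
    nlinarith [mul_nonneg (sub_nonneg.2 this) ha, mul_nonneg (sub_nonneg.2 this) he]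
  have h1 := fourth_moment_cross_le (σ := σ) hμ hμ1 hb hb1 ha he hl hN hpa
  have h2 := fourth_moment_noise_le (σ := σ) hμ hμ1 hb hb1 hN
  have h3 := sq_affine_le hl hμ hμ1 hp0 hp
  have h4 : 0 ≤ μ * (3 * l + 2 * l ^ 2) * (μ ^ 2 * b) := by positivity
  calc _ ≤ _ := add_le_add (add_le_add h3 h1) h2
    _ ≤ _ := by rw [hγ]; linarith

namespace NoisyRecursion

variable {E τ : Type*} [NormedAddCommGroup E] [InnerProductSpace ℝ E] [Fintype τ]
  (m : NoisyRecursion E τ)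

/-- The average of the samples in a batch. -/
noncomputable def noise (B : ℕ) (x : E) (s : Fin B → τ) : E := (B : ℝ)⁻¹ • ∑ b, m.z x (s b)

/-- One step of the recursion and of its linearization. -/
noncomputable def step (μ : ℝ) (B : ℕ) (y : E × E) (s : Fin B → τ) : E × E :=
  (m.A₂ (m.A₁ y.1 + μ • m.G y.1 + μ • m.noise B y.1 s),
    m.A₂ (m.A₁ y.2 - μ • m.H y.2 + μ • m.d + μ • m.noise B y.1 s))

/-- The quadratic form of `Hm`. -/
noncomputable def quad (x : E) : ℝ := inner ℝ x (m.Hm x)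

lemma norm_z_le (x : E) (t : τ) : ‖m.z x t‖ ≤ m.σ * (1 + ‖x‖) := by
  calc ‖m.z x t‖ = ‖m.z 0 t + (m.z x t - m.z 0 t)‖ := by congr 1; abel
    _ ≤ m.σ + m.σ * ‖x‖ := (norm_add_le _ _).trans (add_le_add (m.norm_z_zero t) (m.norm_z_sub x t))
    _ = _ := by ring

lemma norm_noise_le {B : ℕ} (hB : 0 < B) (x : E) (s : Fin B → τ) :
    ‖m.noise B x s‖ ≤ m.σ * (1 + ‖x‖) := by
  have hB' : (0 : ℝ) < B := Nat.cast_pos.2 hB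
  rw [noise, norm_smul, norm_inv, Real.norm_natCast, inv_mul_le_iff₀ hB']
  refine (norm_sum_le _ _).trans ((sum_le_sum fun b _ => m.norm_z_le x (s b)).trans ?_)
  simp

/-- The deviation from the drift before the noise of a step is added. -/
lemma step_fst_sub_drift (μ : ℝ) (B n : ℕ) (y : E × E) (s : Fin B → τ) :
    (m.step μ B y s).1 - m.drift μ (n + 1) =
      m.A₂ (m.A₁ (y.1 - m.drift μ n) + μ • (m.G y.1 - m.d)) + μ • m.A₂ (m.noise B y.1 s) := by
  simp only [step, drift_succ, map_add, map_sub, map_smul, smul_sub]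
  abel

/-- Subtracting the drift removes `d` from the recursion, leaving a forcing of order `g μ²`. Left in
place, the forcing `μ d` would accumulate to order one over the horizon. -/
lemma norm_deviation_le {μ : ℝ} (hμ : 0 ≤ μ) (n : ℕ) (x : E) :
    ‖m.A₂ (m.A₁ (x - m.drift μ n) + μ • (m.G x - m.d))‖ ≤
      (1 + μ * m.L) * ‖x - m.drift μ n‖ + μ * m.L * (m.g * μ) := by
  have hx : ‖x‖ ≤ ‖x - m.drift μ n‖ + m.g * μ := by
    calc ‖x‖ = ‖(x - m.drift μ n) + m.drift μ n‖ := by congr 1; abel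
      _ ≤ _ := (norm_add_le _ _).trans (add_le_add_right (m.norm_drift_le hμ n) _)
  calc _ ≤ ‖m.A₁ (x - m.drift μ n)‖ + ‖μ • (m.G x - m.d)‖ := (m.norm_A₂ _).trans (norm_add_le _ _)
    _ ≤ ‖x - m.drift μ n‖ + μ * (m.L * ‖x‖) :=
      add_le_add (m.norm_A₁ _) (norm_smul_le hμ (m.norm_G_sub x))
    _ ≤ ‖x - m.drift μ n‖ + μ * (m.L * (‖x - m.drift μ n‖ + m.g * μ)) := by
      have := m.L_nonneg
      gcongr
    _ = _ := by ring

section Means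

variable [Nonempty τ]

lemma expect_inner_map_noise (O : E →ₗ[ℝ] E) (v : E) (B : ℕ) (x : E) :
    𝔼 s : Fin B → τ, inner ℝ v (O (m.noise B x s)) = 0 := by
  have h := expect_inner_batchSum (z := fun t => O (m.z x t))
    (by rw [← map_sum, m.sum_z, map_zero]) v B
  simp only [noise, map_smul, map_sum, inner_smul_right]
  rw [← mul_expect, h, mul_zero]

lemma expect_inner_noise_map_noise (O O' : E →ₗ[ℝ] E) {B : ℕ} (hB : 0 < B) (x : E) :
    𝔼 s : Fin B → τ, inner ℝ (O (m.noise B x s)) (O' (O (m.noise B x s))) =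
      (B : ℝ)⁻¹ * 𝔼 t, inner ℝ (O (m.z x t)) (O' (O (m.z x t))) := by
  have hB' : (0 : ℝ) < B := Nat.cast_pos.2 hB
  have h := expect_quadratic_batchSum (z := fun t => O (m.z x t))
    (by rw [← map_sum, m.sum_z, map_zero]) O' B
  simp only [noise, map_smul, map_sum O, inner_smul_right, real_inner_smul_left]
  rw [← mul_expect, ← mul_expect, h]
  field_simp

lemma expect_norm_noise_sq_le {B : ℕ} (hB : 0 < B) (x : E) :
    𝔼 s : Fin B → τ, ‖m.noise B x s‖ ^ 2 ≤ (B : ℝ)⁻¹ * (m.σ * (1 + ‖x‖)) ^ 2 := by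
  have h := m.expect_inner_noise_map_noise 1 1 hB x
  simp only [Module.End.one_apply, real_inner_self_eq_norm_sq] at h
  rw [h]
  refine mul_le_mul_of_nonneg_left ?_ (by positivity)
  refine (expect_le_expect (g := fun _ => (m.σ * (1 + ‖x‖)) ^ 2) fun t _ => ?_).trans
    (Fintype.expect_const _).le
  have := m.norm_z_le x t
  gcongr

lemma expect_norm_add_noise_sq_le {B : ℕ} (hB : 0 < B) (x v : E) (μ : ℝ) :
    𝔼 s : Fin B → τ, ‖v + μ • m.A₂ (m.noise B x s)‖ ^ 2 ≤
      ‖v‖ ^ 2 + μ ^ 2 * ((B : ℝ)⁻¹ * (m.σ * (1 + ‖x‖)) ^ 2) := by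
  have h1 : ∀ s : Fin B → τ, ‖v + μ • m.A₂ (m.noise B x s)‖ ^ 2 ≤
      ‖v‖ ^ 2 + 2 * μ * inner ℝ v (m.A₂ (m.noise B x s)) + μ ^ 2 * ‖m.noise B x s‖ ^ 2 := by
    intro s
    rw [norm_add_sq_real, inner_smul_right, norm_smul, mul_pow, Real.norm_eq_abs, sq_abs]
    have := m.norm_A₂ (m.noise B x s)
    have : ‖m.A₂ (m.noise B x s)‖ ^ 2 ≤ ‖m.noise B x s‖ ^ 2 := by gcongr
    nlinarith [mul_le_mul_of_nonneg_left this (sq_nonneg μ)]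
  refine (expect_le_expect fun s _ => h1 s).trans ?_
  rw [expect_add_distrib, expect_add_distrib, Fintype.expect_const, ← mul_expect,
    m.expect_inner_map_noise, ← mul_expect, mul_zero, add_zero]
  gcongr
  exact m.expect_norm_noise_sq_le hB x

/-- Two of the four noise factors are bounded uniformly and the variance is taken of the other two,
so the last term gains a single `1 / B`. -/
lemma expect_norm_add_noise_pow_four_le {B : ℕ} (hB : 0 < B) (x v : E) (μ : ℝ) :
    𝔼 s : Fin B → τ, ‖v + μ • m.A₂ (m.noise B x s)‖ ^ 4 ≤
      ‖v‖ ^ 4 + 8 * ‖v‖ ^ 2 * (μ ^ 2 * ((B : ℝ)⁻¹ * (m.σ * (1 + ‖x‖)) ^ 2)) +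
        3 * (μ ^ 4 * ((B : ℝ)⁻¹ * (m.σ * (1 + ‖x‖)) ^ 4)) := by
  have h1 : ∀ s : Fin B → τ, ‖v + μ • m.A₂ (m.noise B x s)‖ ^ 4 ≤
      ‖v‖ ^ 4 + 4 * ‖v‖ ^ 2 * μ * inner ℝ v (m.A₂ (m.noise B x s)) +
        (8 * ‖v‖ ^ 2 * μ ^ 2 + 3 * μ ^ 4 * (m.σ * (1 + ‖x‖)) ^ 2) * ‖m.noise B x s‖ ^ 2 := by
    intro s
    refine (norm_add_pow_four_le _ _).trans ?_
    have hn : ‖μ • m.A₂ (m.noise B x s)‖ ^ 2 ≤ μ ^ 2 * ‖m.noise B x s‖ ^ 2 := by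
      have := m.norm_A₂ (m.noise B x s)
      rw [norm_smul, mul_pow, Real.norm_eq_abs, sq_abs]
      gcongr
    have hn4 : ‖μ • m.A₂ (m.noise B x s)‖ ^ 4 ≤
        μ ^ 4 * (m.σ * (1 + ‖x‖)) ^ 2 * ‖m.noise B x s‖ ^ 2 := by
      calc _ = (‖μ • m.A₂ (m.noise B x s)‖ ^ 2) ^ 2 := by ring
        _ ≤ (μ ^ 2 * ‖m.noise B x s‖ ^ 2) ^ 2 := by gcongr
        _ = μ ^ 4 * ‖m.noise B x s‖ ^ 2 * ‖m.noise B x s‖ ^ 2 := by ring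
        _ ≤ _ := by
          have := m.norm_noise_le hB x s
          gcongr
    rw [inner_smul_right]
    nlinarith [mul_le_mul_of_nonneg_left hn (sq_nonneg ‖v‖)]
  refine (expect_le_expect fun s _ => h1 s).trans ?_
  rw [expect_add_distrib, expect_add_distrib, Fintype.expect_const, ← mul_expect,
    m.expect_inner_map_noise, ← mul_expect, mul_zero, add_zero]
  have h2 := mul_le_mul_of_nonneg_left (m.expect_norm_noise_sq_le hB x)
    (show 0 ≤ 8 * ‖v‖ ^ 2 * μ ^ 2 + 3 * μ ^ 4 * (m.σ * (1 + ‖x‖)) ^ 2 by positivity)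
  refine (add_le_add_right h2 _).trans (le_of_eq ?_)
  ring

/-- The second and fourth moments of the error. -/
lemma iterMean_norm_pow_le {T : ℝ} (hT : 0 ≤ T) : ∃ C, 0 ≤ C ∧ ∀ (μ : ℝ) (B n : ℕ) (y : E × E),
    0 ≤ μ → μ ≤ 1 → 0 < B → n * μ ≤ T →
    iterMean (m.step μ B) n (fun y => ‖y.1‖ ^ 2) y ≤
      C * (‖y.1‖ ^ 2 + μ * (B : ℝ)⁻¹ + m.g ^ 2 * μ ^ 2) ∧
    iterMean (m.step μ B) n (fun y => ‖y.1‖ ^ 4) y ≤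
      C * (‖y.1‖ ^ 4 + μ ^ 2 * (B : ℝ)⁻¹ + m.g ^ 2 * μ ^ 3) := by
  have hL := m.L_nonneg
  have hg := m.g_nonneg
  set l := 3 * m.L + 2 * m.L ^ 2 with hl
  have hl0 : 0 ≤ l := by positivity
  set α := l + 3 * m.σ ^ 2 with hα
  have hα0 : 0 ≤ α := by positivity
  set γ := 3 * l + 2 * l ^ 2 + 24 * m.σ ^ 2 * (3 * (1 + l)) + 81 * m.σ ^ 4 with hγ
  have hγ0 : 0 ≤ γ := by positivity
  set C₂ := 2 * (Real.exp (α * T) * (1 + T * α)) + 2 with hC₂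
  set C₄ := 8 * (Real.exp (γ * T) * (1 + T * γ)) + 8 with hC₄
  have hC₂0 : 0 ≤ C₂ := by positivity
  have hC₄0 : 0 ≤ C₄ := by positivity
  refine ⟨C₂ + C₄ * (1 + m.g ^ 2), by positivity, fun μ B n y hμ hμ1 hB hn => ?_⟩
  have hB1 : (1 : ℝ) ≤ B := by exact_mod_cast hB
  set b : ℝ := (B : ℝ)⁻¹ with hb
  have hb0 : 0 ≤ b := by positivity
  have hb1 : b ≤ 1 := inv_le_one_of_one_le₀ hB1
  set e := m.g * μ with he
  have he0 : 0 ≤ e := by positivity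
  have hx : ∀ (k : ℕ) (x : E), ‖x‖ ≤ ‖x - m.drift μ k‖ + e := by
    intro k x
    calc ‖x‖ = ‖(x - m.drift μ k) + m.drift μ k‖ := by congr 1; abel
      _ ≤ _ := (norm_add_le _ _).trans (add_le_add_right (m.norm_drift_le hμ k) _)
  have hsq : ∀ (k : ℕ) (x : E), (1 + ‖x‖) ^ 2 ≤ 3 * (1 + ‖x - m.drift μ k‖ ^ 2 + e ^ 2) := by
    intro k x
    have h := hx k x
    have h1 : (1 + ‖x‖) ^ 2 ≤ (1 + (‖x - m.drift μ k‖ + e)) ^ 2 := by gcongr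
    nlinarith [sq_nonneg (1 - ‖x - m.drift μ k‖), sq_nonneg (1 - e),
      sq_nonneg (‖x - m.drift μ k‖ - e)]
  have hp : ∀ (k : ℕ) (x : E), ‖m.A₂ (m.A₁ (x - m.drift μ k) + μ • (m.G x - m.d))‖ ^ 2 ≤
      (1 + μ * l) * ‖x - m.drift μ k‖ ^ 2 + μ * l * e ^ 2 := fun k x =>
    sq_affine_le hL hμ hμ1 (norm_nonneg _) (m.norm_deviation_le hμ k x)
  have step2 : ∀ (k : ℕ) (y : E × E),
      stepMean (m.step μ B) (fun y => ‖y.1 - m.drift μ (k + 1)‖ ^ 2) y ≤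
        (1 + μ * α) * ‖y.1 - m.drift μ k‖ ^ 2 + μ * (α * (μ * b + e ^ 2)) := by
    intro k y
    simp only [stepMean, step_fst_sub_drift]
    exact (m.expect_norm_add_noise_sq_le hB _ _ μ).trans
      (second_moment_step_le hμ hμ1 hb0 hb1 (sq_nonneg _) (sq_nonneg _) hl0 (hsq k y.1) (hp k y.1))
  have step4 : ∀ (k : ℕ) (y : E × E),
      stepMean (m.step μ B) (fun y => ‖y.1 - m.drift μ (k + 1)‖ ^ 4) y ≤
        (1 + μ * γ) * ‖y.1 - m.drift μ k‖ ^ 4 + μ * (γ * (μ ^ 2 * b + e ^ 4)) := by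
    intro k y
    simp only [stepMean, step_fst_sub_drift]
    refine (m.expect_norm_add_noise_pow_four_le hB _ _ μ).trans ?_
    have := fourth_moment_step_le hμ hμ1 hb0 hb1 (sq_nonneg _) (sq_nonneg _) hl0 (hsq k y.1)
      (sq_nonneg _) (hp k y.1) hγ
    simpa only [← pow_mul] using this
  have hy0 : y.1 - m.drift μ 0 = y.1 := by simp [drift]
  -- The test function depends on time because the drift does, so the one-step bound compares `V (k
  -- + 1)` after the step with `V k` before it.
  have hdevi : ∀ (V : ℕ → E × E → ℝ) (α β : ℝ), 0 ≤ α → 0 ≤ β → 0 ≤ V 0 y →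
      (∀ k y, stepMean (m.step μ B) (V (k + 1)) y ≤ (1 + μ * α) * V k y + μ * β) →
      iterMean (m.step μ B) n (V n) y ≤ Real.exp (α * T) * (V 0 y + T * β) := by
    intro V α β hα hβ h0 h
    refine le_exp_of_affine_recursion_const (a := fun k => iterMean (m.step μ B) k (V k) y)
      hα hμ h0 hβ (fun k _ => ?_) hn
    have := iterMean_mono (step := m.step μ B) (h k) k y
    rwa [iterMean_add, iterMean_const_mul, iterMean_const] at this
  have main2 := hdevi (fun k y => ‖y.1 - m.drift μ k‖ ^ 2) α (α * (μ * b + e ^ 2)) hα0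
    (by positivity) (by positivity) step2
  have main4 := hdevi (fun k y => ‖y.1 - m.drift μ k‖ ^ 4) γ (γ * (μ ^ 2 * b + e ^ 4)) hγ0
    (by positivity) (by positivity) step4
  simp only [hy0] at main2 main4
  constructor
  · have h1 : ∀ y : E × E, ‖y.1‖ ^ 2 ≤ 2 * ‖y.1 - m.drift μ n‖ ^ 2 + 2 * e ^ 2 := by
      intro y
      have h : ‖y.1‖ ^ 2 ≤ (‖y.1 - m.drift μ n‖ + e) ^ 2 := by gcongr; exact hx n y.1
      nlinarith [sq_nonneg (‖y.1 - m.drift μ n‖ - e)]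
    have h2 := iterMean_mono (step := m.step μ B) h1 n y
    rw [iterMean_add, iterMean_const_mul, iterMean_const] at h2
    have hge : m.g ^ 2 * μ ^ 2 = e ^ 2 := by rw [he]; ring
    rw [hge]
    set Z := ‖y.1‖ ^ 2 + μ * b + e ^ 2 with hZ
    have hZ0 : 0 ≤ Z := by positivity
    have h3 : ‖y.1‖ ^ 2 + T * (α * (μ * b + e ^ 2)) ≤ (1 + T * α) * Z := by
      have : 0 ≤ T * α * ‖y.1‖ ^ 2 + μ * b + e ^ 2 := by positivity
      exact le_of_sub_nonneg (this.trans_eq (by rw [hZ]; ring))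
    have h4 : e ^ 2 ≤ Z := by
      have : 0 ≤ ‖y.1‖ ^ 2 + μ * b := by positivity
      linarith
    have h5 : iterMean (m.step μ B) n (fun y => ‖y.1‖ ^ 2) y ≤ C₂ * Z := by
      have := mul_le_mul_of_nonneg_left h3 (Real.exp_nonneg (α * T))
      rw [hC₂]
      linarith
    have h6 : 0 ≤ C₄ * (1 + m.g ^ 2) * Z := by positivity
    linarith
  · have h1 : ∀ y : E × E, ‖y.1‖ ^ 4 ≤ 8 * ‖y.1 - m.drift μ n‖ ^ 4 + 8 * e ^ 4 := by
      intro y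
      have h : ‖y.1‖ ^ 4 ≤ (‖y.1 - m.drift μ n‖ + e) ^ 4 := by gcongr; exact hx n y.1
      have := add_pow_le (norm_nonneg (y.1 - m.drift μ n)) he0 4
      norm_num at this
      linarith
    have h2 := iterMean_mono (step := m.step μ B) h1 n y
    rw [iterMean_add, iterMean_const_mul, iterMean_const] at h2
    have hge : e ^ 4 ≤ (1 + m.g ^ 2) * (m.g ^ 2 * μ ^ 3) := by
      have h0 : e ^ 4 = μ * (m.g ^ 2 * (m.g ^ 2 * μ ^ 3)) := by rw [he]; ring
      rw [h0]
      have : 0 ≤ m.g ^ 2 * μ ^ 3 := by positivity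
      have h1 : μ * (m.g ^ 2 * (m.g ^ 2 * μ ^ 3)) ≤ 1 * (m.g ^ 2 * (m.g ^ 2 * μ ^ 3)) := by gcongr
      linarith
    set Z := ‖y.1‖ ^ 4 + μ ^ 2 * b + e ^ 4 with hZ
    have h3 : ‖y.1‖ ^ 4 + T * (γ * (μ ^ 2 * b + e ^ 4)) ≤ (1 + T * γ) * Z := by
      have : 0 ≤ T * γ * ‖y.1‖ ^ 4 + μ ^ 2 * b + e ^ 4 := by positivity
      exact le_of_sub_nonneg (this.trans_eq (by rw [hZ]; ring))
    have h4 : e ^ 4 ≤ Z := by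
      have : 0 ≤ ‖y.1‖ ^ 4 + μ ^ 2 * b := by positivity
      linarith
    have h5 : iterMean (m.step μ B) n (fun y => ‖y.1‖ ^ 4) y ≤ C₄ * Z := by
      have := mul_le_mul_of_nonneg_left h3 (Real.exp_nonneg (γ * T))
      rw [hC₄]
      linarith
    have h7 : Z ≤ (1 + m.g ^ 2) * (‖y.1‖ ^ 4 + μ ^ 2 * b + m.g ^ 2 * μ ^ 3) := by
      have : 0 ≤ m.g ^ 2 * (‖y.1‖ ^ 4 + μ ^ 2 * b) := by positivity
      rw [hZ]
      linarith
    have h8 := mul_le_mul_of_nonneg_left h7 hC₄0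
    have h6 : 0 ≤ C₂ * (‖y.1‖ ^ 4 + μ ^ 2 * b + m.g ^ 2 * μ ^ 3) := by positivity
    linarith

end Means

end NoisyRecursion

end DistributedLearning

/-! ### Expansion of the mean quadratic loss -/

namespace DistributedLearning

open Finset
open scoped BigOperators

namespace NoisyRecursion

variable {E τ : Type*} [NormedAddCommGroup E] [InnerProductSpace ℝ E] [Fintype τ]
  (m : NoisyRecursion E τ)

/-- The order of the second moment of the error. -/
noncomputable def scale (μ : ℝ) (B : ℕ) : ℝ := μ * (B : ℝ)⁻¹ + m.g ^ 2 * μ ^ 2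

/-- Terms of higher order than `scale`, for small step sizes and initial errors. -/
noncomputable def tail (μ : ℝ) (B : ℕ) (x : E) : ℝ :=
  ‖x‖ ^ 2 + ‖x‖ ^ 4 + μ ^ 2 * (B : ℝ)⁻¹ + m.g ^ 2 * μ ^ 3

lemma scale_nonneg {μ : ℝ} (hμ : 0 ≤ μ) (B : ℕ) : 0 ≤ m.scale μ B := by
  unfold scale; positivity

lemma tail_nonneg {μ : ℝ} (hμ : 0 ≤ μ) (B : ℕ) (x : E) : 0 ≤ m.tail μ B x := by
  unfold tail; positivity

/-- `δ * scale` with arbitrarily small `δ` absorbs a fixed multiple. -/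
lemma div_add_one_mul_le {P δ s : ℝ} (hP : 0 ≤ P) (hδ : 0 < δ) (hs : 0 ≤ s) :
    P * (δ / (P + 1) * s) ≤ δ * s := by
  have : P * (δ / (P + 1) * s) = P / (P + 1) * (δ * s) := by field_simp
  rw [this]
  refine mul_le_of_le_one_left (by positivity) ?_
  rw [div_le_one (by positivity)]
  linarith

section Quad

lemma abs_quad_le (x : E) : |m.quad x| ≤ m.L * ‖x‖ ^ 2 := by
  refine (abs_real_inner_le_norm _ _).trans ?_
  nlinarith [mul_le_mul_of_nonneg_left (m.norm_Hm x) (norm_nonneg x)]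

lemma quad_add (x h : E) : m.quad (x + h) = m.quad x + 2 * inner ℝ (m.Hm x) h + m.quad h := by
  simp only [quad, map_add, inner_add_left, inner_add_right]
  rw [← m.Hm_symm x h, real_inner_comm (m.Hm x) h]
  ring

lemma abs_quad_add_sub_le (x h : E) :
    |m.quad (x + h) - m.quad x| ≤ 2 * m.L * ‖x‖ * ‖h‖ + m.L * ‖h‖ ^ 2 := by
  have h1 : m.quad (x + h) - m.quad x = 2 * inner ℝ (m.Hm x) h + m.quad h := by
    rw [quad_add]; ring
  have h2 : |inner ℝ (m.Hm x) h| ≤ m.L * ‖x‖ * ‖h‖ := (abs_real_inner_le_norm _ _).trans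
    (mul_le_mul_of_nonneg_right (m.norm_Hm x) (norm_nonneg h))
  rw [h1]
  refine (abs_add_le _ _).trans ?_
  rw [abs_mul, abs_two]
  linarith [m.abs_quad_le h]

/-- Young's inequality on the cross term: the known point `x` pays an arbitrarily small `δ`, and the
large factor `1 / δ` falls on the difference, which is of higher order wherever the lemma is used.
-/
lemma abs_quad_sub_le {δ : ℝ} (hδ : 0 < δ) (x y : E) :
    |m.quad y - m.quad x| ≤ δ * ‖x‖ ^ 2 + (m.L ^ 2 / δ + m.L) * ‖y - x‖ ^ 2 := by
  have h := m.abs_quad_add_sub_le x (y - x)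
  rw [add_sub_cancel] at h
  refine h.trans ?_
  have h1 : 0 ≤ (δ * ‖x‖ - m.L * ‖y - x‖) ^ 2 / δ := by positivity
  have h2 : (δ * ‖x‖ - m.L * ‖y - x‖) ^ 2 / δ =
      δ * ‖x‖ ^ 2 - 2 * m.L * ‖x‖ * ‖y - x‖ + m.L ^ 2 / δ * ‖y - x‖ ^ 2 := by
    field_simp; ring
  linarith

lemma quad_eq_add (x : E) : m.quad x = m.quad (m.Pj x) + m.quad (m.Pc x) := by
  conv_lhs => rw [← m.Pj_add_Pc x, quad_add]
  rw [m.Hm_Pj, m.inner_Pj_Pc]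
  ring

end Quad

lemma affine_iterate_add (μ : ℝ) (n : ℕ) (w h : E) :
    (m.affine μ)^[n] (w + h) = (m.affine μ)^[n] w + (m.lin μ ^ n) h := by
  induction n generalizing w h with
  | zero => simp
  | succ n ih =>
    have : m.affine μ (w + h) = m.affine μ w + m.lin μ h := by simp [affine]; abel
    rw [Function.iterate_succ_apply, this, ih, Function.iterate_succ_apply, pow_succ,
      Module.End.mul_apply]

/-- The mean of the linearized recursion has the excess risk of the drift, up to a multiple of
`ε²`. -/
lemma abs_quad_affine_iterate_sub_le {T : ℝ} (hT : 0 ≤ T) {δ : ℝ} (hδ : 0 < δ) :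
    ∃ C, 0 ≤ C ∧ ∀ (μ : ℝ) (B n : ℕ) (x : E), 0 ≤ μ → μ ≤ 1 → n * μ ≤ T →
      |m.quad ((m.affine μ)^[n] x) - m.quad (m.drift μ n)| ≤
        2 * m.L * (Real.exp (m.L * T) * T) ^ 2 * (m.ε ^ 2 * m.g ^ 2 * μ ^ 2) +
          δ * m.scale μ B + C * m.tail μ B x := by
  obtain ⟨C, hC, h⟩ := m.norm_affine_iterate_sub_drift_le hT
  have hL := m.L_nonneg
  have hg := m.g_nonneg
  have hε := m.ε_nonneg
  set c := Real.exp (m.L * T) with hc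
  have hc0 : 0 < c := Real.exp_pos _
  set P := (c * T * m.ε + 2 * C + 1) ^ 2 with hP
  have hP0 : 0 ≤ P := by positivity
  set δ' := δ / (P + 1) with hδ'
  have hδ'0 : 0 < δ' := by positivity
  set C₁ := (m.L ^ 2 / δ' + m.L) * c ^ 2 with hC₁
  have hC₁0 : 0 ≤ C₁ := by positivity
  set C₂ := 2 * m.L * C ^ 2 + (2 * m.L * C + m.L * C ^ 2) with hC₂
  have hC₂0 : 0 ≤ C₂ := by positivity
  refine ⟨C₁ + C₂, by positivity, fun μ B n x hμ hμ1 hn => ?_⟩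
  obtain ⟨h1, h2⟩ := h μ n hμ hμ1 hn
  set D := (m.affine μ)^[n] 0 with hD
  have hdr := m.norm_drift_le hμ n
  have hPcD : m.Pc D = m.drift μ n + m.Pc (D - m.drift μ n) := by
    rw [map_sub, m.Pc_of_Pj_eq_zero (m.Pj_drift μ n)]; abel
  have hμ2 : μ ^ 2 ≤ μ := by nlinarith
  have hμ4 : μ ^ 4 ≤ μ ^ 3 := pow_le_pow_of_le_one hμ hμ1 (by norm_num)
  have hDn : ‖D‖ ≤ (c * T * m.ε + 2 * C + 1) * (m.g * μ) := by
    calc ‖D‖ = ‖m.Pj D + (m.drift μ n + m.Pc (D - m.drift μ n))‖ := by rw [← hPcD, m.Pj_add_Pc]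
      _ ≤ (c * T * m.ε * m.g * μ + C * m.g * μ ^ 2) + (m.g * μ + C * m.g * μ ^ 2) :=
        (norm_add_le _ _).trans (add_le_add h2 ((norm_add_le _ _).trans (add_le_add hdr h1)))
      _ ≤ (c * T * m.ε * m.g * μ + C * m.g * μ) + (m.g * μ + C * m.g * μ) := by gcongr
      _ = _ := by ring
  have hx : (m.affine μ)^[n] x = D + (m.lin μ ^ n) x := by
    rw [hD, ← m.affine_iterate_add, zero_add]
  -- The initial state is a linear perturbation of the trajectory from `0`. Dividing `δ` by `P + 1`
  -- makes its cross term with `D`, of size `O(g μ)`, cost only `δ g² μ²`.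
  have e1 : |m.quad ((m.affine μ)^[n] x) - m.quad D| ≤ δ * (m.g ^ 2 * μ ^ 2) + C₁ * ‖x‖ ^ 2 := by
    refine (m.abs_quad_sub_le hδ'0 D _).trans ?_
    rw [hx, add_sub_cancel_left]
    have h3 : ‖D‖ ^ 2 ≤ P * (m.g ^ 2 * μ ^ 2) := by
      calc ‖D‖ ^ 2 ≤ ((c * T * m.ε + 2 * C + 1) * (m.g * μ)) ^ 2 := by gcongr
        _ = _ := by rw [hP]; ring
    have h4 : ‖(m.lin μ ^ n) x‖ ^ 2 ≤ c ^ 2 * ‖x‖ ^ 2 := by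
      rw [← mul_pow]
      have := m.norm_lin_pow_le hμ hn x
      gcongr
    refine add_le_add ?_ ?_
    · calc δ' * ‖D‖ ^ 2 ≤ δ' * (P * (m.g ^ 2 * μ ^ 2)) := by gcongr
        _ = P * (δ / (P + 1) * (m.g ^ 2 * μ ^ 2)) := by rw [hδ']; ring
        _ ≤ _ := div_add_one_mul_le hP0 hδ (by positivity)
    · calc _ ≤ (m.L ^ 2 / δ' + m.L) * (c ^ 2 * ‖x‖ ^ 2) := by gcongr
        _ = _ := by rw [hC₁]; ring
  have e2 : |m.quad (m.Pj D)| ≤ 2 * m.L * (c * T) ^ 2 * (m.ε ^ 2 * m.g ^ 2 * μ ^ 2) +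
      2 * m.L * C ^ 2 * (m.g ^ 2 * μ ^ 3) := by
    refine (m.abs_quad_le _).trans ?_
    calc m.L * ‖m.Pj D‖ ^ 2 ≤ m.L * (c * T * m.ε * m.g * μ + C * m.g * μ ^ 2) ^ 2 := by gcongr
      _ ≤ m.L * (2 * (c * T * m.ε * m.g * μ) ^ 2 + 2 * (C * m.g * μ ^ 2) ^ 2) := by
        gcongr
        nlinarith [sq_nonneg (c * T * m.ε * m.g * μ - C * m.g * μ ^ 2)]
      _ = 2 * m.L * (c * T) ^ 2 * (m.ε ^ 2 * m.g ^ 2 * μ ^ 2) +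
          2 * m.L * C ^ 2 * (m.g ^ 2 * μ ^ 4) := by ring
      _ ≤ _ := by gcongr
  have e3 : |m.quad (m.Pc D) - m.quad (m.drift μ n)| ≤
      (2 * m.L * C + m.L * C ^ 2) * (m.g ^ 2 * μ ^ 3) := by
    rw [hPcD]
    refine (m.abs_quad_add_sub_le _ _).trans ?_
    calc _ ≤ 2 * m.L * (m.g * μ) * (C * m.g * μ ^ 2) + m.L * (C * m.g * μ ^ 2) ^ 2 := by gcongr
      _ = 2 * m.L * C * (m.g ^ 2 * μ ^ 3) + m.L * C ^ 2 * (m.g ^ 2 * μ ^ 4) := by ring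
      _ ≤ 2 * m.L * C * (m.g ^ 2 * μ ^ 3) + m.L * C ^ 2 * (m.g ^ 2 * μ ^ 3) := by gcongr
      _ = _ := by ring
  -- The quadratic form splits without a cross term between the centroid, of order `ε g μ`, and the
  -- drift, of order `g μ`. Hence the error is quadratic in `ε`; a cross term would make it linear.
  have hQ := m.quad_eq_add D
  have hsplit : m.quad ((m.affine μ)^[n] x) - m.quad (m.drift μ n) =
      (m.quad ((m.affine μ)^[n] x) - m.quad D) + m.quad (m.Pj D) +
        (m.quad (m.Pc D) - m.quad (m.drift μ n)) := by rw [hQ]; ring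
  rw [hsplit]
  refine (abs_add_three _ _ _).trans ((add_le_add (add_le_add e1 e2) e3).trans ?_)
  have p1 : 0 ≤ δ * (μ * (B : ℝ)⁻¹) := by positivity
  have p2 : 0 ≤ C₁ * (‖x‖ ^ 4 + μ ^ 2 * (B : ℝ)⁻¹ + m.g ^ 2 * μ ^ 3) := by positivity
  have p3 : 0 ≤ C₂ * (‖x‖ ^ 2 + ‖x‖ ^ 4 + μ ^ 2 * (B : ℝ)⁻¹) := by positivity
  refine le_of_sub_nonneg ((add_nonneg (add_nonneg p1 p2) p3).trans_eq ?_)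
  rw [hC₂, scale, tail]
  ring

/-- The accumulated energy of the centroid of the noise, in closed form up to a higher order. -/
lemma abs_sum_quad_centroid_sub_le {μ T : ℝ} (hμ : 0 ≤ μ) {n : ℕ} (hn : n * μ ≤ T) {ζ : E}
    (hζ : ‖ζ‖ ≤ m.σ) :
    |μ ^ 2 * ∑ i ∈ range n, m.quad ((m.centroid μ ^ i) ζ) -
      μ / 2 * (‖ζ‖ ^ 2 - ‖(m.centroid μ ^ n) ζ‖ ^ 2)| ≤
      T * (m.L * (Real.exp (m.L * T) * m.σ)) ^ 2 * μ ^ 2 := by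
  have hL := m.L_nonneg
  set c := Real.exp (m.L * T) with hc
  have hc0 : 0 < c := Real.exp_pos _
  -- One centroid step changes the squared norm by `2 μ` times the quadratic form, up to `μ² ‖Hm
  -- x‖²`. Summation telescopes, and the defect is `O(μ³)` per step, thus `O(μ²)` over the horizon.
  have h1 : ∀ x : E, μ ^ 2 * m.quad x =
      μ / 2 * (‖x‖ ^ 2 - ‖m.centroid μ x‖ ^ 2) + μ ^ 3 / 2 * ‖m.Hm x‖ ^ 2 := by
    intro x
    have : m.centroid μ x = x - μ • m.Hm x := rfl
    rw [this, norm_sub_sq_real, inner_smul_right, norm_smul, mul_pow, Real.norm_eq_abs, sq_abs,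
      quad]
    ring
  have h2 : μ ^ 2 * ∑ i ∈ range n, m.quad ((m.centroid μ ^ i) ζ) =
      μ / 2 * (‖ζ‖ ^ 2 - ‖(m.centroid μ ^ n) ζ‖ ^ 2) +
        ∑ i ∈ range n, μ ^ 3 / 2 * ‖m.Hm ((m.centroid μ ^ i) ζ)‖ ^ 2 := by
    rw [mul_sum, sum_congr rfl fun i _ => h1 _, sum_add_distrib, ← mul_sum]
    congr 2
    have := sum_range_sub' (fun i => ‖(m.centroid μ ^ i) ζ‖ ^ 2) n
    simp only [pow_zero, Module.End.one_apply] at this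
    rw [← this]
    refine sum_congr rfl fun i _ => ?_
    rw [pow_succ' (m.centroid μ) i, Module.End.mul_apply]
  rw [h2, add_sub_cancel_left, abs_of_nonneg (sum_nonneg fun i _ => by positivity)]
  have h3 : ∀ i ∈ range n, μ ^ 3 / 2 * ‖m.Hm ((m.centroid μ ^ i) ζ)‖ ^ 2 ≤
      μ ^ 3 / 2 * (m.L * (c * m.σ)) ^ 2 := by
    intro i hi
    have hi' : (i : ℝ) * μ ≤ T := le_trans (by have := (mem_range.1 hi).le; gcongr) hn
    have : ‖m.Hm ((m.centroid μ ^ i) ζ)‖ ≤ m.L * (c * m.σ) :=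
      (m.norm_Hm _).trans (mul_le_mul_of_nonneg_left ((m.norm_centroid_pow_le hμ hi' _).trans
        (mul_le_mul_of_nonneg_left hζ hc0.le)) hL)
    gcongr
  refine (sum_le_sum h3).trans ?_
  rw [sum_const, card_range, nsmul_eq_mul]
  set Z := (m.L * (c * m.σ)) ^ 2
  have hZ : 0 ≤ μ ^ 2 * Z := by positivity
  have h4 := mul_le_mul_of_nonneg_right hn hZ
  have h5 : 0 ≤ n * μ * (μ ^ 2 * Z) := by positivity
  linarith

section Means

variable [Nonempty τ]

lemma iterMean_norm_pow_le_tail {T : ℝ} (hT : 0 ≤ T) : ∃ C, 0 ≤ C ∧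
    ∀ (μ : ℝ) (B n : ℕ) (y : E × E), 0 ≤ μ → μ ≤ 1 → 0 < B → n * μ ≤ T →
    iterMean (m.step μ B) n (fun y => ‖y.1‖ ^ 2) y ≤ C * (m.scale μ B + m.tail μ B y.1) ∧
    iterMean (m.step μ B) n (fun y => ‖y.1‖ ^ 4) y ≤ C * m.tail μ B y.1 := by
  obtain ⟨C, hC, h⟩ := m.iterMean_norm_pow_le hT
  refine ⟨C, hC, fun μ B n y hμ hμ1 hB hn => ?_⟩
  obtain ⟨h1, h2⟩ := h μ B n y hμ hμ1 hB hn
  refine ⟨h1.trans (mul_le_mul_of_nonneg_left ?_ hC), h2.trans (mul_le_mul_of_nonneg_left ?_ hC)⟩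
  · have : 0 ≤ ‖y.1‖ ^ 4 + μ ^ 2 * (B : ℝ)⁻¹ + m.g ^ 2 * μ ^ 3 := by positivity
    unfold scale tail
    linarith
  · have : 0 ≤ ‖y.1‖ ^ 2 := by positivity
    unfold tail
    linarith

/-- Any function with at most quadratic-quartic growth, the quadratic part being arbitrarily small,
has a mean of higher order. -/
lemma iterMean_le_of_growth {T : ℝ} (hT : 0 ≤ T) {f : E → ℝ}
    (hf : ∀ δ > 0, ∃ C, 0 ≤ C ∧ ∀ x, f x ≤ δ * ‖x‖ ^ 2 + C * ‖x‖ ^ 4) {δ : ℝ} (hδ : 0 < δ) :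
    ∃ C, 0 ≤ C ∧ ∀ (μ : ℝ) (B n : ℕ) (y : E × E), 0 ≤ μ → μ ≤ 1 → 0 < B → n * μ ≤ T →
      iterMean (m.step μ B) n (fun y => f y.1) y ≤ δ * m.scale μ B + C * m.tail μ B y.1 := by
  obtain ⟨P, hP, h⟩ := m.iterMean_norm_pow_le_tail hT
  obtain ⟨C, hC, hf⟩ := hf (δ / (P + 1)) (by positivity)
  refine ⟨δ + C * P, by positivity, fun μ B n y hμ hμ1 hB hn => ?_⟩
  obtain ⟨h1, h2⟩ := h μ B n y hμ hμ1 hB hn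
  have h3 := iterMean_mono (step := m.step μ B) (fun y : E × E => hf y.1) n y
  rw [iterMean_add, iterMean_const_mul, iterMean_const_mul] at h3
  have h4 := div_add_one_mul_le hP hδ
    (add_nonneg (m.scale_nonneg hμ B) (m.tail_nonneg hμ B y.1))
  have h5 := mul_le_mul_of_nonneg_left h1 (show 0 ≤ δ / (P + 1) by positivity)
  have h6 := mul_le_mul_of_nonneg_left h2 hC
  linarith

/-- The linearized recursion follows the recursion. -/
lemma iterMean_norm_sub_sq_le {T : ℝ} (hT : 0 ≤ T) {δ : ℝ} (hδ : 0 < δ) :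
    ∃ C, 0 ≤ C ∧ ∀ (μ : ℝ) (B n : ℕ) (x : E), 0 ≤ μ → μ ≤ 1 → 0 < B → n * μ ≤ T →
      iterMean (m.step μ B) n (fun y => ‖y.1 - y.2‖ ^ 2) (x, x) ≤
        δ * m.scale μ B + C * m.tail μ B x := by
  have hL := m.L_nonneg
  -- `L + 1` in place of `L`: the linearization residual enters with coefficient `μ` instead of `μ
  -- L`.
  set l := 3 * (m.L + 1) + 2 * (m.L + 1) ^ 2 with hl
  have hl0 : 0 ≤ l := by positivity
  set P := Real.exp (l * T) * (T * l) with hP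
  have hP0 : 0 ≤ P := by positivity
  obtain ⟨C, hC, h⟩ := m.iterMean_le_of_growth hT m.remainder
    (show 0 < δ / (P + 1) by positivity)
  refine ⟨P * C, by positivity, fun μ B n x hμ hμ1 hB hn => ?_⟩
  have hle : ∀ j ≤ n, (j : ℝ) * μ ≤ T := fun j hj => le_trans (by gcongr) hn
  have hstep : ∀ y : E × E, stepMean (m.step μ B) (fun y => ‖y.1 - y.2‖ ^ 2) y ≤
      (1 + μ * l) * ‖y.1 - y.2‖ ^ 2 + μ * l * ‖m.G y.1 - m.d + m.H y.1‖ ^ 2 := by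
    intro y
    -- Both components receive the noise of the true state, so it cancels: the next difference
    -- depends on the current states only.
    have h1 : ∀ s : Fin B → τ, (m.step μ B y s).1 - (m.step μ B y s).2 =
        m.A₂ (m.A₁ (y.1 - y.2) - μ • m.H (y.1 - y.2) + μ • (m.G y.1 - m.d + m.H y.1)) := by
      intro s
      simp only [step, ← map_sub]
      congr 1
      simp only [map_sub, smul_sub, smul_add]
      abel
    simp only [stepMean, h1, Fintype.expect_const]
    refine sq_affine_le (by positivity) hμ hμ1 (norm_nonneg _) ?_
    refine (m.norm_A₂ _).trans ((norm_add_le _ _).trans (add_le_add ((norm_sub_le _ _).trans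
      (add_le_add (m.norm_A₁ _) (norm_smul_le hμ (m.norm_H _)))) (norm_smul_le hμ le_rfl)) |>.trans ?_)
    have p1 : 0 ≤ μ * ‖y.1 - y.2‖ := by positivity
    have p2 : 0 ≤ μ * m.L * ‖m.G y.1 - m.d + m.H y.1‖ := by positivity
    linarith
  set β := δ / (P + 1) * m.scale μ B + C * m.tail μ B x with hβ
  have hβ0 : 0 ≤ β := by
    have := m.scale_nonneg hμ B
    have := m.tail_nonneg hμ B x
    positivity
  have hrec := le_exp_of_affine_recursion_const
    (a := fun k => iterMean (m.step μ B) k (fun y => ‖y.1 - y.2‖ ^ 2) (x, x)) (α := l)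
    (β := l * β) (μ := μ) hl0 hμ (iterMean_nonneg (fun y => sq_nonneg _) _ _) (by positivity)
    (n := n) (by
      intro k hk
      have h1 := iterMean_mono (step := m.step μ B) hstep k (x, x)
      rw [iterMean_add, iterMean_const_mul, iterMean_const_mul] at h1
      have h2 := h μ B k (x, x) hμ hμ1 hB (hle k hk.le)
      refine h1.trans (add_le_add_right ?_ _)
      rw [mul_assoc]
      gcongr) hn
  have h0 : iterMean (m.step μ B) 0 (fun y => ‖y.1 - y.2‖ ^ 2) (x, x) = 0 := by
    simp [iterMean]
  rw [h0, zero_add] at hrec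
  refine hrec.trans ?_
  have h3 := div_add_one_mul_le hP0 hδ (m.scale_nonneg hμ B)
  calc _ = P * (δ / (P + 1) * m.scale μ B) + P * C * m.tail μ B x := by rw [hP, hβ]; ring
    _ ≤ _ := by gcongr

/-- A loss that agrees with the quadratic form up to the third order has nearly the same mean as
the quadratic form of the linearized recursion. -/
lemma abs_iterMean_loss_sub_le {T : ℝ} (hT : 0 ≤ T) {f : E → ℝ}
    (hf : ∀ δ > 0, ∃ C, 0 ≤ C ∧ ∀ x, |f x - m.quad x| ≤ δ * ‖x‖ ^ 2 + C * ‖x‖ ^ 4)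
    {δ : ℝ} (hδ : 0 < δ) :
    ∃ C, 0 ≤ C ∧ ∀ (μ : ℝ) (B n : ℕ) (x : E), 0 ≤ μ → μ ≤ 1 → 0 < B → n * μ ≤ T →
      |iterMean (m.step μ B) n (fun y => f y.1) (x, x) -
        iterMean (m.step μ B) n (fun y => m.quad y.2) (x, x)| ≤
        δ * m.scale μ B + C * m.tail μ B x := by
  have hL := m.L_nonneg
  obtain ⟨P, hP, h₁⟩ := m.iterMean_norm_pow_le_tail hT
  obtain ⟨C₁, hC₁, h₂⟩ := m.iterMean_le_of_growth hT hf (show 0 < δ / 3 by positivity)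
  -- Three errors share `δ`: the Taylor remainder of the loss, and the two terms of Young's
  -- inequality when the true error is replaced by its linearization.
  set δ' := δ / 3 / (P + 1) with hδ'
  have hδ'0 : 0 < δ' := by positivity
  set R := m.L ^ 2 / δ' + m.L with hR
  have hR0 : 0 ≤ R := by positivity
  obtain ⟨C₂, hC₂, h₃⟩ := m.iterMean_norm_sub_sq_le hT (show 0 < δ / 3 / (R + 1) by positivity)
  refine ⟨C₁ + δ / 3 + R * C₂, by positivity, fun μ B n x hμ hμ1 hB hn => ?_⟩
  have hs := m.scale_nonneg hμ B
  have ht := m.tail_nonneg hμ B x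
  have hpt : ∀ y : E × E, |f y.1 - m.quad y.2| ≤
      |f y.1 - m.quad y.1| + (δ' * ‖y.1‖ ^ 2 + R * ‖y.1 - y.2‖ ^ 2) := by
    intro y
    have := m.abs_quad_sub_le hδ'0 y.1 y.2
    rw [norm_sub_rev, abs_sub_comm] at this
    exact (abs_sub_le _ (m.quad y.1) _).trans (add_le_add_right this _)
  refine (abs_iterMean_sub_le hpt n (x, x)).trans ?_
  rw [iterMean_add, iterMean_add, iterMean_const_mul, iterMean_const_mul]
  have e1 := h₂ μ B n (x, x) hμ hμ1 hB hn
  have e2 := mul_le_mul_of_nonneg_left (h₁ μ B n (x, x) hμ hμ1 hB hn).1 hδ'0.le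
  have e3 := mul_le_mul_of_nonneg_left (h₃ μ B n x hμ hμ1 hB hn) hR0
  have e4 := div_add_one_mul_le hP (show 0 < δ / 3 by positivity) (add_nonneg hs ht)
  have e5 := div_add_one_mul_le hR0 (show 0 < δ / 3 by positivity) hs
  rw [← hδ'] at e4
  linarith

/-- The mean of the quadratic form of the noise injected `i` steps earlier, for a given state of
the recursion. -/
noncomputable def noiseEnergy (μ : ℝ) (i : ℕ) (x : E) : ℝ :=
  𝔼 t, m.quad ((m.lin μ ^ i) (m.A₂ (m.z x t)))

/-- The quadratic form after `i` further noiseless steps acts as a value function. A noisy step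
changes its mean only by the energy of the new noise carried forward `i` steps, as the cross term
averages to zero. -/
lemma stepMean_quad_affine_iterate {μ : ℝ} {B : ℕ} (hB : 0 < B) (i : ℕ) (y : E × E) :
    stepMean (m.step μ B) (fun y => m.quad ((m.affine μ)^[i] y.2)) y =
      m.quad ((m.affine μ)^[i + 1] y.2) + μ ^ 2 * ((B : ℝ)⁻¹ * m.noiseEnergy μ i y.1) := by
  set O : E →ₗ[ℝ] E := (m.lin μ ^ i) ∘ₗ m.A₂ with hO
  have h1 : ∀ s : Fin B → τ, (m.affine μ)^[i] (m.step μ B y s).2 =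
      (m.affine μ)^[i + 1] y.2 + μ • O (m.noise B y.1 s) := by
    intro s
    have : (m.step μ B y s).2 = m.affine μ y.2 + μ • m.A₂ (m.noise B y.1 s) := by
      simp only [step, affine, lin_apply, map_add, map_sub, map_smul]
    rw [this, affine_iterate_add, Function.iterate_succ_apply, map_smul]
    rfl
  have h2 : ∀ s : Fin B → τ, m.quad ((m.affine μ)^[i] (m.step μ B y s).2) =
      m.quad ((m.affine μ)^[i + 1] y.2) +
        2 * μ * inner ℝ (m.Hm ((m.affine μ)^[i + 1] y.2)) (O (m.noise B y.1 s)) +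
        μ ^ 2 * inner ℝ (O (m.noise B y.1 s)) (m.Hm (O (m.noise B y.1 s))) := by
    intro s
    rw [h1, quad_add, inner_smul_right]
    simp only [quad, map_smul, inner_smul_right, real_inner_smul_left]
    ring
  simp only [stepMean, h2]
  rw [expect_add_distrib, expect_add_distrib, Fintype.expect_const, ← mul_expect, ← mul_expect,
    m.expect_inner_map_noise, m.expect_inner_noise_map_noise O m.Hm hB, mul_zero, add_zero]
  rfl

/-- `iterMean` averages over the last step first, so the induction runs backwards in time and must
hold for all horizons `i`. The noise that ages `j` more steps was drawn at the state reached after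
`n - 1 - j` steps. -/
lemma iterMean_quad_affine_iterate {μ : ℝ} {B : ℕ} (hB : 0 < B) (n i : ℕ) (y : E × E) :
    iterMean (m.step μ B) n (fun y => m.quad ((m.affine μ)^[i] y.2)) y =
      m.quad ((m.affine μ)^[i + n] y.2) + μ ^ 2 * ((B : ℝ)⁻¹ * ∑ j ∈ range n,
        iterMean (m.step μ B) (n - 1 - j) (fun y => m.noiseEnergy μ (i + j) y.1) y) := by
  induction n generalizing i with
  | zero => simp [iterMean]
  | succ n ih =>
    rw [iterMean_succ]
    have : stepMean (m.step μ B) (fun y => m.quad ((m.affine μ)^[i] y.2)) = fun y =>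
        m.quad ((m.affine μ)^[i + 1] y.2) + (μ ^ 2 * (B : ℝ)⁻¹) * m.noiseEnergy μ i y.1 := by
      funext y
      rw [m.stepMean_quad_affine_iterate hB]; ring
    rw [this, iterMean_add, iterMean_const_mul, ih, sum_range_succ', add_right_comm i 1 n]
    have h2 : ∀ j ∈ range n, iterMean (m.step μ B) (n + 1 - 1 - (j + 1))
        (fun y => m.noiseEnergy μ (i + (j + 1)) y.1) y =
        iterMean (m.step μ B) (n - 1 - j) (fun y => m.noiseEnergy μ (i + 1 + j) y.1) y := by
      intro j _
      rw [show n + 1 - 1 - (j + 1) = n - 1 - j by omega, show i + (j + 1) = i + 1 + j by ring]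
    rw [sum_congr rfl h2]
    simp only [add_tsub_cancel_right, tsub_zero, add_zero]
    rw [add_assoc i n 1]
    ring

/-- The centroid of the samples at the origin. -/
noncomputable def centroidNoise (t : τ) : E := m.Pj (m.z 0 t)

/-- Freezing the noise at the origin costs `σ ‖x‖`, and replacing the network propagator by the
centroid costs `C μ + q ^ i`; Young's inequality turns these into squares at the price of `δ`.
Weighted by `μ² / B` and summed over `T / μ` steps, `δ` becomes `O(δ μ / B)` and the geometric part
`O(μ² / B)`. -/
lemma abs_noiseEnergy_sub_le {T : ℝ} {δ : ℝ} (hδ : 0 < δ) : ∃ C, 0 ≤ C ∧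
    ∀ (μ : ℝ) (i : ℕ) (x : E), 0 ≤ μ → μ ≤ 1 → i * μ ≤ T →
      |m.noiseEnergy μ i x - 𝔼 t, m.quad ((m.centroid μ ^ i) (m.centroidNoise t))| ≤
        δ + C * (‖x‖ ^ 2 + μ + m.q ^ i) := by
  obtain ⟨C, hC, h⟩ := m.norm_lin_pow_sub_le (T := T)
  have hL := m.L_nonneg
  have hq0 := m.q_nonneg
  have hσ := m.σ_nonneg
  set c := Real.exp (m.L * T) with hc
  have hc0 : 0 < c := Real.exp_pos _
  set P := (c * m.σ) ^ 2 with hP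
  have hP0 : 0 ≤ P := by positivity
  set δ' := δ / (P + 1) with hδ'
  have hδ'0 : 0 < δ' := by positivity
  set R := m.L ^ 2 / δ' + m.L with hR
  have hR0 : 0 ≤ R := by positivity
  set S := 3 * m.σ ^ 2 * (c ^ 2 + C ^ 2 + 1) with hS
  refine ⟨R * S, by positivity, fun μ i x hμ hμ1 hi => ?_⟩
  rw [noiseEnergy, ← expect_sub_distrib]
  refine (abs_expect_le _ _).trans ((expect_le_expect
    (g := fun _ => δ + R * S * (‖x‖ ^ 2 + μ + m.q ^ i)) fun t _ => ?_).trans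
    (Fintype.expect_const _).le)
  refine (m.abs_quad_sub_le hδ'0 _ _).trans (add_le_add ?_ ?_)
  · have h1 : ‖(m.centroid μ ^ i) (m.centroidNoise t)‖ ≤ c * m.σ :=
      (m.norm_centroid_pow_le hμ hi _).trans (mul_le_mul_of_nonneg_left
        ((m.norm_Pj_le _).trans (m.norm_z_zero t)) hc0.le)
    calc _ ≤ δ' * (c * m.σ) ^ 2 := by gcongr
      _ = P * (δ / (P + 1) * 1) := by rw [hδ', hP]; ring
      _ ≤ δ * 1 := div_add_one_mul_le hP0 hδ zero_le_one
      _ = δ := mul_one δ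
  · rw [mul_assoc]
    refine mul_le_mul_of_nonneg_left ?_ hR0
    have h1 : (m.lin μ ^ i) (m.A₂ (m.z x t)) - (m.centroid μ ^ i) (m.centroidNoise t) =
        (m.lin μ ^ i) (m.A₂ (m.z x t - m.z 0 t)) +
          ((m.lin μ ^ i) (m.A₂ (m.z 0 t)) - (m.centroid μ ^ i) (m.centroidNoise t)) := by
      simp only [map_sub]; abel
    have h2 : ‖(m.lin μ ^ i) (m.A₂ (m.z x t - m.z 0 t))‖ ≤ c * (m.σ * ‖x‖) :=
      (m.norm_lin_pow_le hμ hi _).trans (mul_le_mul_of_nonneg_left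
        ((m.norm_A₂ _).trans (m.norm_z_sub x t)) hc0.le)
    have hqi : 0 ≤ m.q ^ i := pow_nonneg hq0 i
    have hqi1 : m.q ^ i ≤ 1 := pow_le_one₀ hq0 m.q_lt_one.le
    have h3 : ‖(m.lin μ ^ i) (m.A₂ (m.z 0 t)) - (m.centroid μ ^ i) (m.centroidNoise t)‖ ≤
        (C * μ + m.q ^ i) * m.σ :=
      (h μ i hμ hi _).trans (mul_le_mul_of_nonneg_left (m.norm_z_zero t) (by positivity))
    calc _ ≤ (c * (m.σ * ‖x‖) + (C * μ + m.q ^ i) * m.σ) ^ 2 := by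
          rw [h1]
          gcongr
          exact (norm_add_le _ _).trans (add_le_add h2 h3)
      _ = m.σ ^ 2 * (c * ‖x‖ + C * μ + m.q ^ i) ^ 2 := by ring
      _ ≤ m.σ ^ 2 * (3 * (c ^ 2 * ‖x‖ ^ 2 + C ^ 2 * μ ^ 2 + (m.q ^ i) ^ 2)) := by
        gcongr
        nlinarith [sq_nonneg (c * ‖x‖ - C * μ), sq_nonneg (c * ‖x‖ - m.q ^ i),
          sq_nonneg (C * μ - m.q ^ i)]
      _ ≤ m.σ ^ 2 * (3 * (c ^ 2 * ‖x‖ ^ 2 + C ^ 2 * μ + m.q ^ i)) := by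
        have : μ ^ 2 ≤ μ := by nlinarith
        have : (m.q ^ i) ^ 2 ≤ m.q ^ i := by nlinarith
        gcongr
      _ ≤ m.σ ^ 2 * (3 * ((c ^ 2 + C ^ 2 + 1) * (‖x‖ ^ 2 + μ + m.q ^ i))) := by
        gcongr
        have : 0 ≤ c ^ 2 * (μ + m.q ^ i) + C ^ 2 * (‖x‖ ^ 2 + m.q ^ i) + (‖x‖ ^ 2 + μ) := by
          positivity
        linarith
      _ = _ := by rw [hS]; ring

/-- The leading terms of the mean of the quadratic form. -/
noncomputable def leading (μ : ℝ) (B n : ℕ) : ℝ :=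
  m.quad (m.drift μ n) + (B : ℝ)⁻¹ * (μ / 2 *
    𝔼 t, (‖m.centroidNoise t‖ ^ 2 - ‖(m.centroid μ ^ n) (m.centroidNoise t)‖ ^ 2))

/-- The expansion of the mean of the quadratic form of the linearized recursion. -/
theorem abs_iterMean_quad_sub_le {T : ℝ} (hT : 0 ≤ T) {δ : ℝ} (hδ : 0 < δ) :
    ∃ C, 0 ≤ C ∧ ∀ (μ : ℝ) (B n : ℕ) (x : E), 0 ≤ μ → μ ≤ 1 → 0 < B → n * μ ≤ T →
      |iterMean (m.step μ B) n (fun y => m.quad y.2) (x, x) - m.leading μ B n| ≤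
        2 * m.L * (Real.exp (m.L * T) * T) ^ 2 * (m.ε ^ 2 * m.g ^ 2 * μ ^ 2) +
          δ * m.scale μ B + C * m.tail μ B x := by
  have hL := m.L_nonneg
  have hq0 := m.q_nonneg
  have hq : 0 < 1 - m.q := by linarith [m.q_lt_one]
  obtain ⟨C₁, hC₁, h₁⟩ := m.abs_quad_affine_iterate_sub_le hT (show 0 < δ / 2 by positivity)
  obtain ⟨C₂, hC₂, h₂⟩ := m.abs_noiseEnergy_sub_le (T := T) (show 0 < δ / 2 / (T + 1) by positivity)
  obtain ⟨C₃, hC₃, h₃⟩ := m.iterMean_norm_pow_le_tail hT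
  set C₄ := T * (m.L * (Real.exp (m.L * T) * m.σ)) ^ 2 with hC₄
  have hC₄0 : 0 ≤ C₄ := by positivity
  set C₅ := T * C₂ * (2 * C₃ + 1) + C₂ * (1 - m.q)⁻¹ with hC₅
  have hC₅0 : 0 ≤ C₅ := by positivity
  refine ⟨C₁ + C₅ + C₄, by positivity, fun μ B n x hμ hμ1 hB hn => ?_⟩
  have hle : ∀ j ≤ n, (j : ℝ) * μ ≤ T := fun j hj => le_trans (by gcongr) hn
  set b : ℝ := (B : ℝ)⁻¹ with hb
  have hb0 : 0 ≤ b := by positivity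
  have hb1 : b ≤ 1 := inv_le_one_of_one_le₀ (by exact_mod_cast hB)
  have hs := m.scale_nonneg hμ B
  have ht := m.tail_nonneg hμ B x
  set γ : ℕ → ℝ := fun i => 𝔼 t, m.quad ((m.centroid μ ^ i) (m.centroidNoise t)) with hγ
  set M : ℕ → ℝ := fun j =>
    iterMean (m.step μ B) (n - 1 - j) (fun y => m.noiseEnergy μ (0 + j) y.1) (x, x) with hM
  have hexp := m.iterMean_quad_affine_iterate (μ := μ) hB n 0 (x, x)
  simp only [Function.iterate_zero, id_eq] at hexp
  rw [zero_add] at hexp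
  have e1 := h₁ μ B n x hμ hμ1 hn
  have e2 : ∀ j ∈ range n, |M j - γ j| ≤
      δ / 2 / (T + 1) + C₂ * (C₃ * (m.scale μ B + m.tail μ B x) + μ + m.q ^ j) := by
    intro j hj
    have hj' := mem_range.1 hj
    have h4 := abs_iterMean_sub_le (step := m.step μ B)
      (fun y : E × E => h₂ μ (0 + j) y.1 hμ hμ1 (by rw [zero_add]; exact hle j hj'.le))
      (n - 1 - j) (x, x)
    simp only [iterMean_add, iterMean_const_mul, iterMean_const] at h4
    rw [zero_add] at h4
    simp only [hM, zero_add] at h4 ⊢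
    refine h4.trans ?_
    gcongr
    exact (h₃ μ B (n - 1 - j) (x, x) hμ hμ1 hB (hle _ (by omega))).1
  have e3 : |μ ^ 2 * (b * ∑ j ∈ range n, M j) - μ ^ 2 * (b * ∑ j ∈ range n, γ j)| ≤
      δ / 2 * m.scale μ B + C₅ * m.tail μ B x := by
    rw [← mul_sub, ← mul_sub, ← sum_sub_distrib, abs_mul, abs_mul, abs_of_nonneg (sq_nonneg μ),
      abs_of_nonneg hb0]
    have h4 := (abs_sum_le_sum_abs _ _).trans (sum_le_sum e2)
    have h5 : ∑ j ∈ range n, (δ / 2 / (T + 1) + C₂ * (C₃ * (m.scale μ B + m.tail μ B x) + μ +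
        m.q ^ j)) = n * (δ / 2 / (T + 1) + C₂ * (C₃ * (m.scale μ B + m.tail μ B x) + μ)) +
        C₂ * ∑ j ∈ range n, m.q ^ j := by
      rw [mul_sum, ← nsmul_eq_mul, ← card_range n, ← sum_const, card_range, ← sum_add_distrib]
      exact sum_congr rfl fun j _ => by ring
    rw [h5] at h4
    have hμb : μ * b ≤ m.scale μ B := by
      have : 0 ≤ m.g ^ 2 * μ ^ 2 := by positivity
      unfold scale; linarith
    have hμb1 : μ * b ≤ 1 := mul_le_one₀ hμ1 hb0 hb1
    have hμ2b : μ ^ 2 * b ≤ m.tail μ B x := by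
      have : 0 ≤ ‖x‖ ^ 2 + ‖x‖ ^ 4 + m.g ^ 2 * μ ^ 3 := by positivity
      unfold tail; linarith
    -- The dependence of the noise on the state carries the variance factor `μ b` on top of the
    -- second moment, and is therefore of higher order.
    have hμs : μ * b * m.scale μ B ≤ m.tail μ B x := by
      have h6 : μ * b * (m.g ^ 2 * μ ^ 2) ≤ m.g ^ 2 * μ ^ 3 := by
        have : b * (m.g ^ 2 * μ ^ 3) ≤ m.g ^ 2 * μ ^ 3 := mul_le_of_le_one_left (by positivity) hb1
        linarith
      have h7 : μ * b * (μ * b) ≤ μ ^ 2 * b := by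
        have : b * (μ ^ 2 * b) ≤ μ ^ 2 * b := mul_le_of_le_one_left (by positivity) hb1
        linarith
      have : 0 ≤ ‖x‖ ^ 2 + ‖x‖ ^ 4 := by positivity
      unfold tail scale
      rw [mul_add]
      linarith
    have hμt : μ * b * m.tail μ B x ≤ m.tail μ B x := mul_le_of_le_one_left ht hμb1
    set Z := δ / 2 / (T + 1) + C₂ * (C₃ * (m.scale μ B + m.tail μ B x) + μ) with hZ
    have hZ0 : 0 ≤ Z := by positivity
    calc _ ≤ μ ^ 2 * (b * (n * Z + C₂ * ∑ j ∈ range n, m.q ^ j)) := by gcongr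
      _ = (n * μ) * (μ * b * Z) + μ ^ 2 * b * (C₂ * ∑ j ∈ range n, m.q ^ j) := by ring
      _ ≤ T * (μ * b * Z) + μ ^ 2 * b * (C₂ * (1 - m.q)⁻¹) := by
        gcongr
        exact sum_pow_le_inv hq0 m.q_lt_one n
      _ = T * (δ / 2 / (T + 1) * (μ * b)) + (T * C₂ * C₃) * (μ * b * m.scale μ B) +
          (T * C₂ * C₃) * (μ * b * m.tail μ B x) + (T * C₂) * (μ ^ 2 * b) +
          (C₂ * (1 - m.q)⁻¹) * (μ ^ 2 * b) := by rw [hZ]; ring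
      _ ≤ δ / 2 * m.scale μ B + (T * C₂ * C₃) * m.tail μ B x + (T * C₂ * C₃) * m.tail μ B x +
          (T * C₂) * m.tail μ B x + (C₂ * (1 - m.q)⁻¹) * m.tail μ B x := by
        have h6 : T * (δ / 2 / (T + 1) * (μ * b)) ≤ δ / 2 * m.scale μ B :=
          (div_add_one_mul_le hT (show 0 < δ / 2 by positivity) (by positivity)).trans (by gcongr)
        refine add_le_add (add_le_add (add_le_add (add_le_add h6 ?_) ?_) ?_) ?_ <;> gcongr
      _ = _ := by rw [hC₅]; ring
  have e4 : |μ ^ 2 * (b * ∑ j ∈ range n, γ j) - b * (μ / 2 *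
      𝔼 t, (‖m.centroidNoise t‖ ^ 2 - ‖(m.centroid μ ^ n) (m.centroidNoise t)‖ ^ 2))| ≤
      C₄ * m.tail μ B x := by
    have h4 : μ ^ 2 * (b * ∑ j ∈ range n, γ j) - b * (μ / 2 *
        𝔼 t, (‖m.centroidNoise t‖ ^ 2 - ‖(m.centroid μ ^ n) (m.centroidNoise t)‖ ^ 2)) =
        b * 𝔼 t, (μ ^ 2 * ∑ i ∈ range n, m.quad ((m.centroid μ ^ i) (m.centroidNoise t)) -
          μ / 2 * (‖m.centroidNoise t‖ ^ 2 - ‖(m.centroid μ ^ n) (m.centroidNoise t)‖ ^ 2)) := by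
      conv_rhs => rw [expect_sub_distrib, ← mul_expect, ← mul_expect, expect_sum_comm]
      ring
    rw [h4, abs_mul, abs_of_nonneg hb0]
    have h5 : |𝔼 t, (μ ^ 2 * ∑ i ∈ range n, m.quad ((m.centroid μ ^ i) (m.centroidNoise t)) -
          μ / 2 * (‖m.centroidNoise t‖ ^ 2 - ‖(m.centroid μ ^ n) (m.centroidNoise t)‖ ^ 2))| ≤
          C₄ * μ ^ 2 :=
      (abs_expect_le _ _).trans ((expect_le_expect (g := fun _ => C₄ * μ ^ 2) fun t _ =>
        m.abs_sum_quad_centroid_sub_le hμ hn ((m.norm_Pj_le _).trans (m.norm_z_zero t))).trans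
        (Fintype.expect_const _).le)
    calc _ ≤ b * (C₄ * μ ^ 2) := by gcongr
      _ = C₄ * (μ ^ 2 * b) := by ring
      _ ≤ _ := by
        gcongr
        have : 0 ≤ ‖x‖ ^ 2 + ‖x‖ ^ 4 + m.g ^ 2 * μ ^ 3 := by positivity
        unfold tail; linarith
  rw [hexp, leading]
  rw [abs_le] at e1 e3 e4 ⊢
  constructor <;> linarith [e1.1, e1.2, e3.1, e3.2, e4.1, e4.2]

end Means

end NoisyRecursion

end DistributedLearning

/-! ### From iterated averages to expectations -/

namespace DistributedLearning

open Finset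
open scoped BigOperators

section Sampling

variable {Ω : Type*} [MeasurableSpace Ω] {P : Measure Ω}

/-- Both hypotheses say that joint laws are product measures; associativity of the product regroups
the factors. -/
lemma IndepFun.prodMk_left_of_prodMk_right {α β γ : Type*} [MeasurableSpace α] [MeasurableSpace β]
    [MeasurableSpace γ] [IsProbabilityMeasure P] {w : Ω → α} {u : Ω → β} {v : Ω → γ} (hw : Measurable w)
    (hu : Measurable u) (hv : Measurable v) (h : IndepFun w (fun ω => (u ω, v ω)) P)
    (h' : IndepFun u v P) : IndepFun (fun ω => (w ω, u ω)) v P := by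
  have h1 := (indepFun_iff_map_prod_eq_prod_map_map hw.aemeasurable
    (hu.prodMk hv).aemeasurable).1 h
  have h2 := (indepFun_iff_map_prod_eq_prod_map_map hu.aemeasurable hv.aemeasurable).1 h'
  have h3 := (indepFun_iff_map_prod_eq_prod_map_map hw.aemeasurable hu.aemeasurable).1
    (show IndepFun w u P from h.comp measurable_id measurable_fst)
  have : IsProbabilityMeasure (P.map w) := Measure.isProbabilityMeasure_map hw.aemeasurable
  have : IsProbabilityMeasure (P.map u) := Measure.isProbabilityMeasure_map hu.aemeasurable
  have : IsProbabilityMeasure (P.map v) := Measure.isProbabilityMeasure_map hv.aemeasurable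
  rw [indepFun_iff_map_prod_eq_prod_map_map (hw.prodMk hu).aemeasurable hv.aemeasurable]
  rw [h3]
  have h4 := (measurePreserving_prodAssoc (P.map w) (P.map u) (P.map v)).symm.map_eq
  rw [← h4, ← h2, ← h1, Measure.map_map (MeasurableEquiv.measurable _)
    (hw.prodMk (hu.prodMk hv))]
  rfl

variable {Y S : Type*}

/-- The states of a recursion driven by the inputs `s`. -/
def run (step : Y → S → Y) (y : Y) (s : ℕ → S) : ℕ → Y
  | 0 => y
  | n + 1 => step (run step y s n) (s n)

lemma run_congr {step : Y → S → Y} {y : Y} {s s' : ℕ → S} {n : ℕ} (h : ∀ i < n, s i = s' i) :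
    run step y s n = run step y s' n := by
  induction n with
  | zero => rfl
  | succ n ih => simp only [run, ih fun i hi => h i (by omega), h n (by omega)]

variable [MeasurableSpace Y] [Fintype S] [MeasurableSpace S] [MeasurableSingletonClass S]

lemma measurable_run {step : Y → S → Y} (hstep : ∀ s, Measurable fun y => step y s) (n : ℕ) :
    Measurable fun q : Y × (ℕ → S) => run step q.1 q.2 n := by
  induction n with
  | zero => exact measurable_fst
  | succ n ih =>
    have h1 : Measurable fun q : Y × S => step q.1 q.2 := measurable_from_prod_countable_left hstep
    exact h1.comp (ih.prodMk ((measurable_pi_apply n).comp measurable_snd))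

variable [Nonempty S]

lemma indepFun_run {step : Y → S → Y} (hstep : ∀ s, Measurable fun y => step y s) {y₀ : Ω → Y}
    {ζ : ℕ → Ω → S} {n : ℕ} (h : IndepFun (fun ω => (y₀ ω, fun i : Fin n => ζ i ω)) (ζ n) P) :
    IndepFun (fun ω => run step (y₀ ω) (fun i => ζ i ω) n) (ζ n) P := by
  -- The state at time `n` reads only the first `n` inputs, so they may be padded by an arbitrary
  -- value.
  let ext : (Fin n → S) → ℕ → S := fun s i => if hi : i < n then s ⟨i, hi⟩ else Classical.arbitrary S
  have hext : Measurable ext := by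
    refine measurable_pi_lambda _ fun i => ?_
    by_cases hi : i < n
    · simpa only [ext, hi, dif_pos] using measurable_pi_apply _
    · simpa only [ext, hi, dif_neg, not_false_iff] using measurable_const
  have h1 := h.comp ((measurable_run hstep n).comp
    (measurable_fst.prodMk (hext.comp measurable_snd))) measurable_id
  refine IndepFun.congr h1 (Filter.Eventually.of_forall fun ω => ?_) (Filter.Eventually.of_forall
    fun ω => rfl)
  exact run_congr fun i hi => by simp [ext, hi]

/-- The expectation of a function of the state of a recursion with independent uniform inputs is
the expectation of its iterated mean. -/
theorem integral_run [IsProbabilityMeasure P] {step : Y → S → Y} (hstep : ∀ s, Measurable fun y => step y s) {y₀ : Ω → Y}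
    (hy₀ : Measurable y₀) {ζ : ℕ → Ω → S} (hζ : ∀ n, Measurable (ζ n))
    (hind : ∀ n, IndepFun (fun ω => (y₀ ω, fun i : Fin n => ζ i ω)) (ζ n) P)
    (hunif : ∀ n s, P.real (ζ n ⁻¹' {s}) = (Fintype.card S : ℝ)⁻¹)
    {V : Y → ℝ} (hV : Measurable V) (hV0 : ∀ y, 0 ≤ V y) {C : ℝ}
    (hVC : ∀ y s, V (step y s) ≤ C * V y) (hint : Integrable (fun ω => V (y₀ ω)) P) (n : ℕ)
    {f : Y → ℝ} (hf : Measurable f) {c : ℝ} (hfc : ∀ y, |f y| ≤ c * V y) :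
    Integrable (fun ω => f (run step (y₀ ω) (fun i => ζ i ω) n)) P ∧
      Integrable (fun ω => iterMean step n f (y₀ ω)) P ∧
      ∫ ω, f (run step (y₀ ω) (fun i => ζ i ω) n) ∂P = ∫ ω, iterMean step n f (y₀ ω) ∂P := by
  have hrun : ∀ n, Measurable fun ω => run step (y₀ ω) (fun i => ζ i ω) n := fun n =>
    (measurable_run hstep n).comp (hy₀.prodMk (measurable_pi_lambda _ fun i => hζ i))
  induction n generalizing f c with
  | zero =>
    have h0 := (hint.const_mul c).mono' (hf.comp hy₀).aestronglyMeasurable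
      (Filter.Eventually.of_forall fun ω => hfc _)
    exact ⟨h0, h0, rfl⟩
  | succ n ih =>
    -- `V` is a Lyapunov function: it is itself an admissible test function, and this yields the
    -- integrability of everything it dominates.
    have hintV : Integrable (fun ω => V (run step (y₀ ω) (fun i => ζ i ω) n)) P :=
      (ih hV (c := 1) fun y => by rw [abs_of_nonneg (hV0 y), one_mul]).1
    have hc : ∀ y, 0 ≤ c * V y := fun y => (abs_nonneg _).trans (hfc y)
    have hbd : ∀ y s, |f (step y s)| ≤ |c| * C * V y := fun y s => by
      calc |f (step y s)| ≤ c * V (step y s) := hfc _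
        _ ≤ |c| * V (step y s) := mul_le_mul_of_nonneg_right (le_abs_self c) (hV0 _)
        _ ≤ |c| * (C * V y) := mul_le_mul_of_nonneg_left (hVC y s) (abs_nonneg c)
        _ = _ := by ring
    have hfs : ∀ s, Measurable fun y => f (step y s) := fun s => hf.comp (hstep s)
    have hmean : Measurable (stepMean step f) := by
      have : stepMean step f = fun y => (∑ s, f (step y s)) / Fintype.card S := by
        funext y; exact Fintype.expect_eq_sum_div_card _
      rw [this]
      exact (measurable_fun_sum _ fun s _ => hfs s).div_const _
    have hints : ∀ s, Integrable (fun ω => f (step (run step (y₀ ω) (fun i => ζ i ω) n) s)) P :=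
      fun s => (hintV.const_mul (|c| * C)).mono' ((hfs s).comp (hrun n)).aestronglyMeasurable
        (Filter.Eventually.of_forall fun ω => hbd _ _)
    -- The induction hypothesis is applied to the one-step mean of `f`, which is again dominated by
    -- a multiple of `V`.
    have hih' := (ih hmean (c := |c| * C) fun y => (abs_expect_le _ _).trans
      ((expect_le_expect (g := fun _ => |c| * C * V y) fun s _ => hbd y s).trans
        (Fintype.expect_const _).le)).2
    have hih := hih'.2
    simp only [iterMean_succ]
    refine ⟨(hintV.const_mul (|c| * C)).mono' (hf.comp (hrun (n + 1))).aestronglyMeasurable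
        (Filter.Eventually.of_forall fun ω => hbd _ _), hih'.1, ?_⟩
    rw [← hih]
    set ind : S → S → ℝ := fun s => Set.indicator {s} 1 with hindicator
    have hindm : ∀ s, Measurable (ind s) := fun s =>
      measurable_one.indicator (measurableSet_singleton s)
    -- Splitting by the value `s` of the last input leaves products of a function of the past state
    -- with an indicator of that input; independence factors each of them.
    have hsplit : ∀ ω, f (run step (y₀ ω) (fun i => ζ i ω) (n + 1)) =
        ∑ s, f (step (run step (y₀ ω) (fun i => ζ i ω) n) s) * ind s (ζ n ω) := by
      intro ω
      rw [Fintype.sum_eq_single (ζ n ω)]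
      · simp [ind, run]
      · intro s hs
        simp [ind, hs.symm]
    have hprod : ∀ s, ∫ ω, f (step (run step (y₀ ω) (fun i => ζ i ω) n) s) * ind s (ζ n ω) ∂P =
        (∫ ω, f (step (run step (y₀ ω) (fun i => ζ i ω) n) s) ∂P) * (Fintype.card S : ℝ)⁻¹ := by
      intro s
      have h1 := ((indepFun_run hstep (hind n)).comp (hfs s) (hindm s)).integral_mul_eq_mul_integral
        ((hfs s).comp (hrun n)).aestronglyMeasurable ((hindm s).comp (hζ n)).aestronglyMeasurable
      have h2 : ∫ ω, ind s (ζ n ω) ∂P = (Fintype.card S : ℝ)⁻¹ := by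
        rw [← hunif n s, ← integral_indicator_one (hζ n (measurableSet_singleton s))]
        rfl
      simp only [Pi.mul_apply, Function.comp_apply] at h1
      change ∫ ω, f (step (run step (y₀ ω) (fun i => ζ i ω) n) s) * ind s (ζ n ω) ∂P = _ at h1
      rw [h1, ← h2]
    have hintp : ∀ s ∈ (univ : Finset S), Integrable (fun ω =>
        f (step (run step (y₀ ω) (fun i => ζ i ω) n) s) * ind s (ζ n ω)) P := by
      intro s _
      refine (hints s).mul_bdd (c := 1) ((hindm s).comp (hζ n)).aestronglyMeasurable
        (Filter.Eventually.of_forall fun ω => ?_)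
      simp only [ind, Set.indicator]
      split_ifs <;> simp
    calc _ = ∫ ω, ∑ s, f (step (run step (y₀ ω) (fun i => ζ i ω) n) s) * ind s (ζ n ω) ∂P :=
          integral_congr_ae (Filter.Eventually.of_forall hsplit)
      _ = (∑ s, ∫ ω, f (step (run step (y₀ ω) (fun i => ζ i ω) n) s) ∂P) *
          (Fintype.card S : ℝ)⁻¹ := by
        rw [integral_finsetSum _ hintp, sum_congr rfl fun s _ => hprod s, sum_mul]
      _ = _ := by
        rw [← integral_finsetSum _ fun s _ => hints s, ← integral_mul_const]
        refine integral_congr_ae (Filter.Eventually.of_forall fun ω => ?_)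
        simp only [stepMean, Fintype.expect_eq_sum_div_card, div_eq_mul_inv]

end Sampling

/-! ### Independence and uniformity of the samples of one iteration -/

section Slices

variable {K M : ℕ} {𝒳 : Type v} {p : Problem K M 𝒳} {B : ℕ} {Ω : Type u} [MeasurableSpace Ω]
  {P : Measure Ω} {ξ : Ω → p.Batches B}

/-- The samples drawn by all agents at iteration `n`. -/
def Problem.slice (p : Problem K M 𝒳) (j : p.Batches B) (n : ℕ) : Fin B → (k : Fin K) → Fin (p.N k) :=
  fun b k => j k n b

lemma Problem.measurable_slice (n : ℕ) : Measurable fun j : p.Batches B => p.slice j n := by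
  refine measurable_pi_lambda _ fun b => measurable_pi_lambda _ fun k => ?_
  exact (measurable_pi_apply b).comp ((measurable_pi_apply n).comp (measurable_pi_apply k))

lemma Problem.IsUniformSampling.measurable_batches (h : p.IsUniformSampling P ξ) :
    Measurable ξ :=
  measurable_pi_lambda _ fun k => measurable_pi_lambda _ fun n => measurable_pi_lambda _ fun b =>
    h.measurable k n b

lemma Problem.IsUniformSampling.real_slice_eq (h : p.IsUniformSampling P ξ) (n : ℕ)
    (s : Fin B → (k : Fin K) → Fin (p.N k)) :
    P.real ((fun ω => p.slice (ξ ω) n) ⁻¹' {s}) =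
      (Fintype.card (Fin B → (k : Fin K) → Fin (p.N k)) : ℝ)⁻¹ := by
  -- Independence is stated for the whole family of draws; it is used on the finite set of those
  -- made at iteration `n`.
  have h1 := h.indep.measure_inter_preimage_eq_mul
    ((univ : Finset (Fin K × Fin B)).image fun q => (q.1, n, q.2))
    (sets := fun q => {s q.2.2 q.1}) (fun q _ => measurableSet_singleton _)
  have h2 : (fun ω => p.slice (ξ ω) n) ⁻¹' {s} =
      ⋂ q ∈ (univ : Finset (Fin K × Fin B)).image fun q => (q.1, n, q.2),
        (fun ω => ξ ω q.1 q.2.1 q.2.2) ⁻¹' {s q.2.2 q.1} := by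
    ext ω
    simp only [Set.mem_preimage, Set.mem_singleton_iff, Set.mem_iInter, mem_image, mem_univ,
      true_and, forall_exists_index, Prod.forall, Prod.mk.injEq]
    constructor
    · rintro rfl k m b k' b' ⟨rfl, rfl, rfl⟩
      rfl
    · intro h
      funext b k
      exact h k n b k b ⟨rfl, rfl, rfl⟩
  rw [measureReal_def, h2, h1, ENNReal.toReal_prod, prod_image fun a _ b _ hab => by
    simp only [Prod.mk.injEq, true_and] at hab
    exact Prod.ext hab.1 hab.2]
  have h3 : ∀ q : Fin K × Fin B,
      (P ((fun ω => ξ ω q.1 n q.2) ⁻¹' {s q.2 q.1})).toReal = 1 / (p.N q.1 : ℝ) := fun q =>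
    h.uniform q.1 n q.2 (s q.2 q.1)
  rw [prod_congr rfl fun q _ => h3 q, ← univ_product_univ, prod_product]
  simp [Fintype.card_pi, prod_pow]

lemma Problem.IsUniformSampling.indepFun_slice [IsProbabilityMeasure P] (h : p.IsUniformSampling P ξ) (n : ℕ) :
    IndepFun (fun ω (i : Fin n) => p.slice (ξ ω) i) (fun ω => p.slice (ξ ω) n) P := by
  obtain ⟨F, hF⟩ : ∃ F : Finset (Fin K × ℕ × Fin B), ∀ q, q ∈ F ↔ q.2.1 < n :=
    ⟨univ ×ˢ range n ×ˢ univ, fun q => by simp⟩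
  obtain ⟨G, hG⟩ : ∃ G : Finset (Fin K × ℕ × Fin B), ∀ q, q ∈ G ↔ q.2.1 = n :=
    ⟨univ ×ˢ {n} ×ˢ univ, fun q => by rw [mem_product, mem_product]; simp⟩
  have hFG : Disjoint F G := by
    rw [Finset.disjoint_left]
    intro q h1 h2
    rw [hF] at h1
    rw [hG] at h2
    omega
  have h1 := h.indep.indepFun_finset F G hFG fun q => h.measurable _ _ _
  let φ : (∀ q : F, Fin (p.N q.1.1)) → Fin n → Fin B → (k : Fin K) → Fin (p.N k) :=
    fun g i b k => g ⟨(k, i, b), (hF _).2 i.2⟩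
  let ψ : (∀ q : G, Fin (p.N q.1.1)) → Fin B → (k : Fin K) → Fin (p.N k) :=
    fun g b k => g ⟨(k, n, b), (hG _).2 rfl⟩
  have hφ : Measurable φ := measurable_pi_lambda _ fun i => measurable_pi_lambda _ fun b =>
    measurable_pi_lambda _ fun k => measurable_pi_apply (⟨(k, i, b), (hF _).2 i.2⟩ : F)
  have hψ : Measurable ψ := measurable_pi_lambda _ fun b =>
    measurable_pi_lambda _ fun k => measurable_pi_apply (⟨(k, n, b), (hG _).2 rfl⟩ : G)
  exact h1.comp hφ hψ

lemma Problem.IsUniformSampling.indepFun_start_slice [IsProbabilityMeasure P]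
    (h : p.IsUniformSampling P ξ)
    {α Y : Type*} [MeasurableSpace α] [MeasurableSpace Y] {w₀ : Ω → α} (hw : Measurable w₀)
    (hind : IndepFun w₀ ξ P) {y : α → Y} (hy : Measurable y) (n : ℕ) :
    IndepFun (fun ω => (y (w₀ ω), fun i : Fin n => p.slice (ξ ω) i))
      (fun ω => p.slice (ξ ω) n) P := by
  have hpast : Measurable fun j : p.Batches B => fun i : Fin n => p.slice j i :=
    measurable_pi_lambda _ fun i => Problem.measurable_slice _
  have h1 : IndepFun (fun ω => y (w₀ ω))
      (fun ω => ((fun i : Fin n => p.slice (ξ ω) i), p.slice (ξ ω) n)) P :=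
    hind.comp hy (hpast.prodMk (Problem.measurable_slice n))
  exact IndepFun.prodMk_left_of_prodMk_right (hy.comp hw)
    (hpast.comp h.measurable_batches) ((Problem.measurable_slice n).comp h.measurable_batches) h1
    (h.indepFun_slice n)

end Slices

end DistributedLearning

namespace DistributedLearning

open Finset
open scoped BigOperators

/-! ### The spectral gap of the combination matrix -/

section Spectrum

variable {K : ℕ} {A : Matrix (Fin K) (Fin K) ℝ}

lemma eq_of_isIrreducible (hA : A.IsIrreducible) {f : Fin K → ℝ}
    (hf : ∀ k l, 0 < A k l → f k = f l) (k l : Fin K) : f k = f l := by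
  let _ : Quiver (Fin K) := A.toQuiver
  obtain ⟨p, -⟩ := hA.connected k l
  induction p with
  | nil => rfl
  | cons q e ih => rw [ih, hf _ _ e.down]

namespace IsCombinationMatrix

lemma nonneg (hA : IsCombinationMatrix A) (k l : Fin K) : 0 ≤ A k l :=
  (mem_doublyStochastic_iff_sum.1 hA.stochastic).1 k l

lemma row_sum (hA : IsCombinationMatrix A) (k : Fin K) : ∑ l, A k l = 1 :=
  (mem_doublyStochastic_iff_sum.1 hA.stochastic).2.1 k

lemma col_sum (hA : IsCombinationMatrix A) (l : Fin K) : ∑ k, A k l = 1 :=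
  (mem_doublyStochastic_iff_sum.1 hA.stochastic).2.2 l

/-- Double stochasticity makes both square terms sum to `∑ x_k²`. The left side is nonnegative, so
`e² ≤ 1`, and equality forces `x_k = e x_l` along every edge. -/
lemma sum_mul_sub_sq (hA : IsCombinationMatrix A) {x : Fin K → ℝ} {e : ℝ}
    (hx : ∀ k, ∑ l, A k l * x l = e * x k) :
    ∑ k, ∑ l, A k l * (x k - e * x l) ^ 2 = (1 - e ^ 2) * ∑ k, x k ^ 2 := by
  have h1 : ∑ k, ∑ l, A k l * x k ^ 2 = ∑ k, x k ^ 2 := by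
    simp [← sum_mul, hA.row_sum]
  have h2 : ∑ k, ∑ l, A k l * x l ^ 2 = ∑ k, x k ^ 2 := by
    rw [sum_comm]
    simp [← sum_mul, hA.col_sum]
  have h3 : ∑ k, ∑ l, x k * (A k l * x l) = e * ∑ k, x k ^ 2 := by
    simp only [← mul_sum, hx]
    rw [mul_sum]
    exact sum_congr rfl fun k _ => by ring
  have h4 : ∀ k l, A k l * (x k - e * x l) ^ 2 =
      A k l * x k ^ 2 - 2 * e * (x k * (A k l * x l)) + e ^ 2 * (A k l * x l ^ 2) :=
    fun k l => by ring
  simp only [h4, sum_add_distrib, sum_sub_distrib, ← mul_sum] at h1 h2 h3 ⊢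
  rw [h1, h2, h3]
  ring

/-- The eigenvalues off the consensus direction lie in `(-1, 1)`. -/
lemma abs_eigenvalue_lt_one (hA : IsCombinationMatrix A) {x : Fin K → ℝ} {e : ℝ}
    (hx : ∀ k, ∑ l, A k l * x l = e * x k) (hx1 : ∑ k, x k = 0) (hx2 : ∑ k, x k ^ 2 = 1) :
    |e| < 1 := by
  have h1 := hA.sum_mul_sub_sq hx
  rw [hx2, mul_one] at h1
  have h0 : ∀ k l, 0 ≤ A k l * (x k - e * x l) ^ 2 := fun k l =>
    mul_nonneg (hA.nonneg k l) (sq_nonneg _)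
  have h2 : e ^ 2 ≤ 1 := by
    have := sum_nonneg fun k (_ : k ∈ univ) => sum_nonneg fun l (_ : l ∈ univ) => h0 k l
    linarith
  refine lt_of_le_of_ne (sq_le_one_iff_abs_le_one e |>.1 h2) fun he => ?_
  have he2 : e ^ 2 = 1 := by rw [← sq_abs, he, one_pow]
  rw [he2, sub_self] at h1
  have h3 : ∀ k l, 0 < A k l → x k = e * x l := by
    intro k l hkl
    have h4 := (sum_eq_zero_iff_of_nonneg fun k _ => sum_nonneg fun l _ => h0 k l).1 h1 k
      (mem_univ k)
    have h5 := (sum_eq_zero_iff_of_nonneg fun l _ => h0 k l).1 h4 l (mem_univ l)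
    have h6 := (mul_eq_zero.1 h5).resolve_left hkl.ne'
    linarith [pow_eq_zero_iff (two_ne_zero) |>.1 h6]
  -- If `|e| = 1`, connectivity makes `|x|` constant; the self-loop excludes `e = -1`; then `x`
  -- itself is constant, which contradicts its zero sum.
  have habs : ∀ k l, |x k| = |x l| := eq_of_isIrreducible hA.connected fun k l hkl => by
    rw [h3 k l hkl, abs_mul, he, one_mul]
  obtain ⟨k₀, hk₀⟩ := hA.selfLoop
  have hne : x k₀ ≠ 0 := by
    intro h
    have : ∀ k, x k = 0 := fun k => abs_eq_zero.1 (by rw [habs k k₀, h, abs_zero])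
    simp [this] at hx2
  have he1 : e = 1 := by
    have := h3 k₀ k₀ hk₀
    exact mul_right_cancel₀ hne (by linarith)
  have hconst : ∀ k, x k = x k₀ := fun k =>
    eq_of_isIrreducible hA.connected (fun k l hkl => by rw [h3 k l hkl, he1, one_mul]) k k₀
  simp only [hconst, sum_const, card_univ, Fintype.card_fin, nsmul_eq_mul] at hx1
  rcases mul_eq_zero.1 hx1 with h | h
  · exact (Nat.cast_ne_zero (R := ℝ)).2 (Fin.pos k₀).ne' h
  · exact hne h

end IsCombinationMatrix

namespace IsEigendecomposition

variable {Vα : Matrix (Fin K) (Fin (K - 1)) ℝ} {ev : Fin (K - 1) → ℝ}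

lemma mul_fullBasis (h : IsEigendecomposition A Vα ev) :
    A * fullBasis Vα =
      fullBasis Vα * Matrix.fromBlocks (1 : Matrix Unit Unit ℝ) 0 0 (Matrix.diagonal ev) := by
  conv_lhs => rw [h.decomp, Matrix.mul_assoc, h.orthonormal_cols, Matrix.mul_one]

lemma mul_basis (h : IsEigendecomposition A Vα ev) : A * Vα = Vα * Matrix.diagonal ev := by
  have h1 := h.mul_fullBasis
  ext k a
  have h2 := congrFun (congrFun h1 k) (Sum.inr a)
  simpa [Matrix.mul_apply, fullBasis, Matrix.diagonal_apply] using h2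

lemma abs_ev_lt_one (h : IsEigendecomposition A Vα ev) (hA : IsCombinationMatrix A)
    (a : Fin (K - 1)) : |ev a| < 1 := by
  refine hA.abs_eigenvalue_lt_one (x := fun k => Vα k a) (fun k => ?_) ?_ ?_
  · have := congrFun (congrFun h.mul_basis k) a
    simpa [Matrix.mul_apply, Matrix.diagonal_apply, mul_comm] using this
  · have := congrFun (congrFun h.orthonormal_cols (Sum.inl ())) (Sum.inr a)
    obtain ⟨k₀, -⟩ := hA.selfLoop
    have hK : (0 : ℝ) < K := Nat.cast_pos.2 (Fin.pos k₀)
    simp only [Matrix.mul_apply, Matrix.transpose_apply, fullBasis, Matrix.fromCols_apply_inl,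
      Matrix.of_apply, Matrix.fromCols_apply_inr, ← mul_sum, ne_eq, reduceCtorEq, not_false_eq_true,
      Matrix.one_apply_ne] at this
    exact (mul_eq_zero.1 this).resolve_left (by positivity)
  · have := congrFun (congrFun h.orthonormal_cols (Sum.inr a)) (Sum.inr a)
    simpa [Matrix.mul_apply, fullBasis, sq] using this

/-- The spectral gap. -/
lemma exists_gap (h : IsEigendecomposition A Vα ev) (hA : IsCombinationMatrix A) :
    ∃ q, 0 ≤ q ∧ q < 1 ∧ ∀ a, |ev a| ≤ q := by
  -- For a single agent there is no further eigenvalue and the gap is complete.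
  rcases isEmpty_or_nonempty (Fin (K - 1)) with h0 | h0
  · exact ⟨0, le_rfl, zero_lt_one, fun a => isEmptyElim a⟩
  · obtain ⟨a, ha⟩ := Finite.exists_max fun a => |ev a|
    exact ⟨|ev a|, abs_nonneg _, h.abs_ev_lt_one hA a, ha⟩

end IsEigendecomposition

end Spectrum

/-! ### Block vectors and their spectral coordinates -/

section Blocks

variable {K M : ℕ}

/-- Block vectors, with the Euclidean norm. -/
abbrev Blocks (K M : ℕ) : Type := PiLp 2 fun _ : Fin K => Param M

/-- The action of `A ⊗ I` on block vectors. -/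
noncomputable def blockMap (A : Matrix (Fin K) (Fin K) ℝ) : Blocks K M →ₗ[ℝ] Blocks K M where
  toFun x := WithLp.toLp 2 fun k => ∑ l, A k l • x l
  map_add' x y := by ext1 k; simp [sum_add_distrib]
  map_smul' c x := by ext1 k; simp [smul_sum, smul_comm c]

/-- A block diagonal operator. -/
noncomputable def blockDiag (F : Fin K → Param M →L[ℝ] Param M) :
    Blocks K M →ₗ[ℝ] Blocks K M where
  toFun x := WithLp.toLp 2 fun k => F k (x k)
  map_add' x y := by ext1 k; simp
  map_smul' c x := by ext1 k; simp

lemma blockMap_apply (A : Matrix (Fin K) (Fin K) ℝ) (x : Blocks K M) (k : Fin K) :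
    blockMap A x k = ∑ l, A k l • x l := rfl

lemma blockDiag_apply (F : Fin K → Param M →L[ℝ] Param M) (x : Blocks K M) (k : Fin K) :
    blockDiag F x k = F k (x k) := rfl

lemma blockMap_mul (A A' : Matrix (Fin K) (Fin K) ℝ) (x : Blocks K M) :
    blockMap (A * A') x = blockMap A (blockMap A' x) := by
  ext1 k
  simp only [blockMap_apply, Matrix.mul_apply, sum_smul, smul_sum, mul_smul]
  rw [sum_comm]

lemma blockMap_one (x : Blocks K M) : blockMap 1 x = x := by
  ext1 k
  simp [blockMap_apply, Matrix.one_apply]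

lemma inner_blockMap {A : Matrix (Fin K) (Fin K) ℝ} (hA : A.IsSymm) (x y : Blocks K M) :
    inner ℝ (blockMap A x) y = inner ℝ x (blockMap A y) := by
  rw [PiLp.inner_apply, PiLp.inner_apply]
  simp only [blockMap_apply, sum_inner, inner_sum, real_inner_smul_left, inner_smul_right]
  rw [sum_comm]
  exact sum_congr rfl fun k _ => sum_congr rfl fun l _ => by rw [hA.apply]

lemma norm_le_of_blocks {x y : Blocks K M} {c : ℝ} (hc : 0 ≤ c)
    (h : ∀ k, ‖y k‖ ≤ c * ‖x k‖) : ‖y‖ ≤ c * ‖x‖ := by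
  refine abs_le_of_sq_le_sq' ?_ (by positivity) |>.2
  rw [mul_pow, PiLp.norm_sq_eq_of_L2, PiLp.norm_sq_eq_of_L2, mul_sum]
  exact sum_le_sum fun k _ => by rw [← mul_pow]; gcongr; exact h k

lemma weightedSq_one (x : Blocks K M) : weightedSq 1 x.ofLp = ‖x‖ ^ 2 := by
  simp [weightedSq, PiLp.norm_sq_eq_of_L2]

/-- Parseval's identity: `V Vᵀ = 1` acts on the agent index and `H` on the parameter index, so they
do not interfere. -/
lemma weightedSq_blockRow {ι : Type*} [Fintype ι] (H : Param M →L[ℝ] Param M)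
    {V : Matrix (Fin K) ι ℝ} (hV : V * V.transpose = 1) (x : Fin K → Param M) :
    weightedSq H (blockRow x V) = weightedSq H x := by
  have h1 : ∀ k l, ∑ a, V k a * V l a = if k = l then 1 else 0 := fun k l => by
    have := congrFun (congrFun hV k) l
    simpa [Matrix.mul_apply, Matrix.one_apply] using this
  calc weightedSq H (blockRow x V) =
        ∑ a, ∑ k, ∑ l, V k a * V l a * inner ℝ (x k) (H (x l)) := by
        simp only [weightedSq, blockRow, map_sum, map_smul, sum_inner, inner_sum,
          real_inner_smul_left, inner_smul_right, mul_sum]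
        refine sum_congr rfl fun a _ => ?_
        rw [sum_comm]
        exact sum_congr rfl fun k _ => sum_congr rfl fun l _ => by ring
    _ = ∑ k, ∑ l, (∑ a, V k a * V l a) * inner ℝ (x k) (H (x l)) := by
        rw [sum_comm]
        refine sum_congr rfl fun k _ => ?_
        rw [sum_comm]
        exact sum_congr rfl fun l _ => by rw [sum_mul]
    _ = _ := by simp [h1, weightedSq]

lemma blockRow_blockMap {ι : Type*} {A : Matrix (Fin K) (Fin K) ℝ} (hA : A.IsSymm)
    (V : Matrix (Fin K) ι ℝ) (x : Blocks K M) :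
    blockRow (blockMap A x).ofLp V = blockRow x.ofLp (A * V) := by
  funext a
  simp only [blockRow, blockMap_apply, Matrix.mul_apply, smul_sum, sum_smul, smul_smul]
  rw [sum_comm]
  refine sum_congr rfl fun k _ => sum_congr rfl fun l _ => ?_
  rw [← hA.apply l k, mul_comm]

/-- The averaging matrix `(1 / K) 𝟙 𝟙ᵀ`. -/
noncomputable def avgMatrix (K : ℕ) : Matrix (Fin K) (Fin K) ℝ := Matrix.of fun _ _ => 1 / (K : ℝ)

lemma avgMatrix_isSymm : (avgMatrix K).IsSymm := by
  ext; simp [avgMatrix]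

lemma avgMatrix_mul {A : Matrix (Fin K) (Fin K) ℝ} (hA : ∀ l, ∑ k, A k l = 1) :
    avgMatrix K * A = avgMatrix K := by
  ext k l
  simp [avgMatrix, Matrix.mul_apply, ← mul_sum, hA]

lemma mul_avgMatrix {A : Matrix (Fin K) (Fin K) ℝ} (hA : ∀ k, ∑ l, A k l = 1) :
    A * avgMatrix K = avgMatrix K := by
  ext k l
  simp [avgMatrix, Matrix.mul_apply, ← sum_mul, hA]

lemma avgMatrix_row_sum (hK : 0 < K) (k : Fin K) : ∑ l, avgMatrix K k l = 1 := by
  have : (K : ℝ) ≠ 0 := Nat.cast_ne_zero.2 hK.ne'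
  simp [avgMatrix, this]

lemma avgMatrix_col_sum (hK : 0 < K) (l : Fin K) : ∑ k, avgMatrix K k l = 1 := by
  have : (K : ℝ) ≠ 0 := Nat.cast_ne_zero.2 hK.ne'
  simp [avgMatrix, this]

lemma blockMap_avgMatrix_apply (x : Blocks K M) (k : Fin K) :
    blockMap (avgMatrix K) x k = (1 / (K : ℝ)) • ∑ l, x l := by
  simp [blockMap_apply, avgMatrix, smul_sum]

lemma norm_blockMap_avgMatrix_le (hK : 0 < K) (x : Blocks K M) :
    ‖blockMap (avgMatrix K) x‖ ≤ ‖x‖ := by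
  have h1 : ‖blockMap (avgMatrix K) x‖ ^ 2 ≤ ‖blockMap (avgMatrix K) x‖ * ‖x‖ := by
    rw [← real_inner_self_eq_norm_sq, inner_blockMap avgMatrix_isSymm, ← blockMap_mul,
      avgMatrix_mul (avgMatrix_col_sum hK), real_inner_comm]
    exact real_inner_le_norm _ _
  nlinarith [norm_nonneg (blockMap (avgMatrix K) x), norm_nonneg x]

lemma sum_eq_zero_of_blockMap_avgMatrix (hK : 0 < K) {x : Blocks K M}
    (hx : blockMap (avgMatrix K) x = 0) : ∑ k, x k = 0 := by
  have h1 := blockMap_avgMatrix_apply x (⟨0, hK⟩ : Fin K)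
  rw [hx] at h1
  have : (1 / (K : ℝ)) ≠ 0 := by positivity
  exact (smul_eq_zero.1 h1.symm).resolve_left this

namespace IsEigendecomposition

variable {A : Matrix (Fin K) (Fin K) ℝ} {Vα : Matrix (Fin K) (Fin (K - 1)) ℝ}
  {ev : Fin (K - 1) → ℝ}

lemma weightedSq_eq (h : IsEigendecomposition A Vα ev) (H : Param M →L[ℝ] Param M)
    (x : Fin K → Param M) :
    weightedSq H x = inner ℝ ((1 / √(K : ℝ)) • ∑ k, x k) (H ((1 / √(K : ℝ)) • ∑ k, x k)) +
      weightedSq H (blockRow x Vα) := by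
  rw [← weightedSq_blockRow H h.orthonormal_rows x]
  simp [weightedSq, blockRow, fullBasis, Fintype.sum_sum_type, smul_sum]

lemma blockRow_blockMap (h : IsEigendecomposition A Vα ev) (hA : IsCombinationMatrix A)
    (x : Blocks K M) (a : Fin (K - 1)) :
    blockRow (blockMap A x).ofLp Vα a = ev a • blockRow x.ofLp Vα a := by
  rw [DistributedLearning.blockRow_blockMap hA.symm, h.mul_basis]
  simp [blockRow, smul_sum, smul_smul, mul_comm]

lemma sum_blockMap (hA : IsCombinationMatrix A) (x : Blocks K M) :
    ∑ k, blockMap A x k = ∑ k, x k := by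
  simp only [blockMap_apply]
  rw [sum_comm]
  simp [← sum_smul, hA.col_sum]

lemma norm_sq_eq (h : IsEigendecomposition A Vα ev) (x : Blocks K M) :
    ‖x‖ ^ 2 = ‖(1 / √(K : ℝ)) • ∑ k, x k‖ ^ 2 + ∑ a, ‖blockRow x.ofLp Vα a‖ ^ 2 := by
  rw [← weightedSq_one, h.weightedSq_eq]
  simp only [one_apply_eq_self, real_inner_self_eq_norm_sq, weightedSq]

lemma norm_blockMap_le (h : IsEigendecomposition A Vα ev) (hA : IsCombinationMatrix A)
    (x : Blocks K M) : ‖blockMap A x‖ ≤ ‖x‖ := by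
  refine abs_le_of_sq_le_sq' ?_ (norm_nonneg _) |>.2
  rw [h.norm_sq_eq, h.norm_sq_eq x, sum_blockMap hA]
  refine add_le_add_right (sum_le_sum fun a _ => ?_) _
  rw [h.blockRow_blockMap hA, norm_smul, mul_pow]
  refine mul_le_of_le_one_left (sq_nonneg _) ?_
  exact pow_le_one₀ (norm_nonneg _) (h.abs_ev_lt_one hA a).le

lemma norm_blockMap_le_gap (h : IsEigendecomposition A Vα ev) (hA : IsCombinationMatrix A)
    {q : ℝ} (hq : 0 ≤ q) (hev : ∀ a, |ev a| ≤ q) {x : Blocks K M} (hx : ∑ k, x k = 0) :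
    ‖blockMap A x‖ ≤ q * ‖x‖ := by
  refine abs_le_of_sq_le_sq' ?_ (by positivity) |>.2
  rw [mul_pow, h.norm_sq_eq, h.norm_sq_eq x, sum_blockMap hA, hx]
  simp only [smul_zero, norm_zero, ne_eq, OfNat.ofNat_ne_zero, not_false_eq_true, zero_pow,
    zero_add, mul_sum]
  refine sum_le_sum fun a _ => ?_
  rw [h.blockRow_blockMap hA, norm_smul, mul_pow]
  have := hev a
  rw [Real.norm_eq_abs]
  gcongr

lemma one_sub_diagonal_inv (h : IsEigendecomposition A Vα ev) (hA : IsCombinationMatrix A) :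
    (1 - Matrix.diagonal ev)⁻¹ = Matrix.diagonal fun a => (1 - ev a)⁻¹ := by
  refine Matrix.inv_eq_left_inv ?_
  rw [← Matrix.diagonal_one, Matrix.diagonal_sub, Matrix.diagonal_mul_diagonal]
  congr 1
  funext a
  have := abs_lt.1 (h.abs_ev_lt_one hA a)
  exact inv_mul_cancel₀ (by linarith)

/-- The geometric sums of the network, in spectral coordinates. -/
lemma blockRow_geom_sum (h : IsEigendecomposition A Vα ev) (hA : IsCombinationMatrix A)
    (x : Blocks K M) (n : ℕ) (a : Fin (K - 1)) :
    blockRow (∑ j ∈ range n, (blockMap A ^ j) x).ofLp Vα a =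
      ((1 - ev a)⁻¹ * (1 - ev a ^ n)) • blockRow x.ofLp Vα a := by
  have h1 : ∀ j, blockRow ((blockMap A ^ j) x).ofLp Vα a = ev a ^ j • blockRow x.ofLp Vα a := by
    intro j
    induction j with
    | zero => simp
    | succ j ih => rw [pow_succ', Module.End.mul_apply, h.blockRow_blockMap hA, ih, smul_smul,
        pow_succ']
  have h2 : blockRow (∑ j ∈ range n, (blockMap A ^ j) x).ofLp Vα a =
      ∑ j ∈ range n, blockRow ((blockMap A ^ j) x).ofLp Vα a := by
    simp only [blockRow, WithLp.ofLp_sum, Finset.sum_apply, smul_sum]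
    rw [sum_comm]
  have h3 := abs_lt.1 (h.abs_ev_lt_one hA a)
  rw [h2, sum_congr rfl fun j _ => h1 j, ← sum_smul]
  congr 1
  rw [geom_sum_eq (by linarith), ← neg_div_neg_eq, div_eq_inv_mul]
  ring

/-- Vectors of zero sum stay so under `A`, and each application gains a factor `q`. This supplies
the bound `g` on the drift per unit step size. -/
lemma norm_geom_sum_le (h : IsEigendecomposition A Vα ev) (hA : IsCombinationMatrix A)
    {q : ℝ} (hq : 0 ≤ q) (hq1 : q < 1) (hev : ∀ a, |ev a| ≤ q) {x : Blocks K M}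
    (hx : ∑ k, x k = 0) (n : ℕ) :
    ‖∑ j ∈ range n, (blockMap A ^ j) x‖ ≤ (1 - q)⁻¹ * ‖x‖ := by
  have h1 : ∀ j, ∑ k, (blockMap A ^ j) x k = 0 ∧ ‖(blockMap A ^ j) x‖ ≤ q ^ j * ‖x‖ := by
    intro j
    induction j with
    | zero => simp [hx]
    | succ j ih =>
      rw [pow_succ', Module.End.mul_apply, pow_succ', mul_assoc]
      exact ⟨by rw [sum_blockMap hA, ih.1], (h.norm_blockMap_le_gap hA hq hev ih.1).trans
        (mul_le_mul_of_nonneg_left ih.2 hq)⟩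
  refine (norm_sum_le _ _).trans ((sum_le_sum fun j _ => (h1 j).2).trans ?_)
  rw [← sum_mul]
  exact mul_le_mul_of_nonneg_right (sum_pow_le_inv hq hq1 n) (norm_nonneg _)

end IsEigendecomposition

end Blocks

end DistributedLearning

namespace DistributedLearning

open Finset
open scoped BigOperators

/-! ### Taylor estimates for functions of class C² -/

section Calculus

variable {F : Type*} [NormedAddCommGroup F] [InnerProductSpace ℝ F] [CompleteSpace F]

lemma gradient_eq_comp (f : F → ℝ) :
    gradient f = (InnerProductSpace.toDual ℝ F).symm ∘ fderiv ℝ f := rfl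

lemma contDiff_gradient {f : F → ℝ} (hf : ContDiff ℝ 2 f) : ContDiff ℝ 1 (gradient f) := by
  rw [gradient_eq_comp]
  exact (InnerProductSpace.toDual ℝ F).symm.contDiff.comp (hf.fderiv_right (by norm_num))

lemma hasFDerivAt_gradient {f : F → ℝ} (hf : ContDiff ℝ 2 f) (w : F) :
    HasFDerivAt (gradient f) (fderiv ℝ (gradient f) w) w :=
  ((contDiff_gradient hf).differentiable one_ne_zero w).hasFDerivAt

lemma hasFDerivAt_of_contDiff {f : F → ℝ} (hf : ContDiff ℝ 2 f) (w : F) :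
    HasFDerivAt f (innerSL ℝ (gradient f w)) w := by
  have h := (hf.differentiable two_ne_zero w).hasGradientAt
  exact h.hasFDerivAt

lemma inner_fderiv_gradient {f : F → ℝ} (hf : ContDiff ℝ 2 f) (w x y : F) :
    inner ℝ (fderiv ℝ (gradient f) w x) y = inner ℝ x (fderiv ℝ (gradient f) w y) := by
  have hd : DifferentiableAt ℝ (fderiv ℝ f) w :=
    (hf.fderiv_right (m := 1) (by norm_num)).differentiable one_ne_zero w
  have h1 : ∀ x, fderiv ℝ (gradient f) w x =
      (InnerProductSpace.toDual ℝ F).symm (fderiv ℝ (fderiv ℝ f) w x) := by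
    intro x
    rw [gradient_eq_comp, LinearIsometryEquiv.comp_fderiv]
    rfl
  have h2 : IsSymmSndFDerivAt ℝ f w :=
    hf.contDiffAt.isSymmSndFDerivAt (by simp)
  rw [h1, h1, InnerProductSpace.toDual_symm_apply, real_inner_comm,
    InnerProductSpace.toDual_symm_apply]
  exact h2 x y

omit [CompleteSpace F] in
-- Within a radius `r` differentiability provides `δ ‖y‖`. Beyond it the error is at most `2 L ‖y‖`
-- by the Lipschitz bound, and `1 ≤ ‖y‖² / r²` turns this into a cubic term.
lemma linearization_error_le {g : F → F} {g' : F →L[ℝ] F} {w : F} {L : ℝ} (hL : 0 ≤ L)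
    (hg : HasFDerivAt g g' w) (hLip : ∀ w₁ w₂, ‖g w₂ - g w₁‖ ≤ L * ‖w₂ - w₁‖)
    (hg' : ‖g'‖ ≤ L) {δ : ℝ} (hδ : 0 < δ) :
    ∃ C, 0 ≤ C ∧ ∀ y, ‖g (w - y) - g w + g' y‖ ≤ δ * ‖y‖ + C * ‖y‖ ^ 3 := by
  have h1 := hg.isLittleO.bound hδ
  obtain ⟨r, hr, h2⟩ := Metric.eventually_nhds_iff.1 h1
  refine ⟨2 * L / r ^ 2, by positivity, fun y => ?_⟩
  rcases lt_or_ge ‖y‖ r with hy | hy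
  · have h3 := @h2 (w - y) (by simpa using hy)
    simp only [sub_sub_cancel_left, map_neg, norm_neg, sub_neg_eq_add] at h3
    have : 0 ≤ 2 * L / r ^ 2 * ‖y‖ ^ 3 := by positivity
    linarith
  · have h3 : ‖g (w - y) - g w + g' y‖ ≤ 2 * L * ‖y‖ := by
      have h4 := hLip w (w - y)
      rw [sub_sub_cancel_left, norm_neg] at h4
      calc _ ≤ ‖g (w - y) - g w‖ + ‖g' y‖ := norm_add_le _ _
        _ ≤ L * ‖y‖ + L * ‖y‖ := add_le_add h4 (g'.le_of_opNorm_le hg' y)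
        _ = _ := by ring
    have h5 : 1 ≤ ‖y‖ ^ 2 / r ^ 2 := by
      rw [le_div_iff₀ (by positivity), one_mul]
      gcongr
    have h6 : 2 * L * ‖y‖ * 1 ≤ 2 * L * ‖y‖ * (‖y‖ ^ 2 / r ^ 2) := by gcongr
    have h7 : 2 * L * ‖y‖ * (‖y‖ ^ 2 / r ^ 2) = 2 * L / r ^ 2 * ‖y‖ ^ 3 := by ring
    have : 0 ≤ δ * ‖y‖ := by positivity
    linarith

omit [CompleteSpace F] in
-- Squaring the previous bound would produce a sixth power; multiplying it by the global bound `2 L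
-- ‖y‖` stops at the fourth, the highest moment that is controlled.
lemma linearization_error_sq_le {g : F → F} {g' : F →L[ℝ] F} {w : F} {L : ℝ} (hL : 0 ≤ L)
    (hg : HasFDerivAt g g' w) (hLip : ∀ w₁ w₂, ‖g w₂ - g w₁‖ ≤ L * ‖w₂ - w₁‖)
    (hg' : ‖g'‖ ≤ L) {δ : ℝ} (hδ : 0 < δ) :
    ∃ C, 0 ≤ C ∧ ∀ y, ‖g (w - y) - g w + g' y‖ ^ 2 ≤ δ * ‖y‖ ^ 2 + C * ‖y‖ ^ 4 := by
  obtain ⟨C, hC, h⟩ := linearization_error_le hL hg hLip hg'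
    (show 0 < δ / (2 * L + 1) by positivity)
  refine ⟨2 * L * C, by positivity, fun y => ?_⟩
  have h3 : ‖g (w - y) - g w + g' y‖ ≤ 2 * L * ‖y‖ := by
    have h4 := hLip w (w - y)
    rw [sub_sub_cancel_left, norm_neg] at h4
    calc _ ≤ ‖g (w - y) - g w‖ + ‖g' y‖ := norm_add_le _ _
      _ ≤ L * ‖y‖ + L * ‖y‖ := add_le_add h4 (g'.le_of_opNorm_le hg' y)
      _ = _ := by ring
  calc _ ≤ (2 * L * ‖y‖) * (δ / (2 * L + 1) * ‖y‖ + C * ‖y‖ ^ 3) := by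
        rw [sq]; gcongr; exact h y
    _ = (2 * L) * (δ / (2 * L + 1) * ‖y‖ ^ 2) + 2 * L * C * ‖y‖ ^ 4 := by ring
    _ ≤ _ := by
      gcongr ?_ + _
      exact NoisyRecursion.div_add_one_mul_le (by positivity) hδ (by positivity)

/-- The derivative of the second-order remainder is minus the linearization error of the gradient,
because the Hessian is symmetric and `gradient f w = 0`. The mean value inequality on the ball of
radius `‖y‖` adds one power of `‖y‖`. -/
lemma taylor_error_le {f : F → ℝ} (hf : ContDiff ℝ 2 f) {w : F} {L : ℝ} (hL : 0 ≤ L)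
    (hLip : ∀ w₁ w₂, ‖gradient f w₂ - gradient f w₁‖ ≤ L * ‖w₂ - w₁‖) (hw : gradient f w = 0)
    (hH : ‖fderiv ℝ (gradient f) w‖ ≤ L) {δ : ℝ} (hδ : 0 < δ) :
    ∃ C, 0 ≤ C ∧ ∀ y, |f (w - y) - f w - 1 / 2 * inner ℝ y (fderiv ℝ (gradient f) w y)| ≤
      δ * ‖y‖ ^ 2 + C * ‖y‖ ^ 4 := by
  set H := fderiv ℝ (gradient f) w with hHdef
  obtain ⟨C, hC, h⟩ := linearization_error_le hL (hasFDerivAt_gradient hf w) hLip hH hδ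
  refine ⟨C, hC, fun y => ?_⟩
  set φ : F → ℝ := fun v => f (w - v) - 1 / 2 * inner ℝ v (H v) with hφ
  have hd : ∀ v, HasFDerivAt φ (-innerSL ℝ (gradient f (w - v) - gradient f w + H v)) v := by
    intro v
    have h1 : HasFDerivAt (fun v => f (w - v)) (-(innerSL ℝ (gradient f (w - v)))) v := by
      have := (hasFDerivAt_of_contDiff hf (w - v)).comp v ((hasFDerivAt_id v).const_sub w)
      exact this.congr_fderiv (by ext; simp)
    have h2 : HasFDerivAt (fun v => inner ℝ v (H v)) ((2 : ℝ) • innerSL ℝ (H v)) v := by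
      have := (hasFDerivAt_id (𝕜 := ℝ) v).inner ℝ H.hasFDerivAt
      refine this.congr_fderiv ?_
      ext x
      have hs : inner ℝ (H v) x = inner ℝ v (H x) := inner_fderiv_gradient hf w v x
      have hs' : inner ℝ x (H v) = inner ℝ v (H x) := (real_inner_comm _ _).trans hs
      simp [two_mul, hs, hs']
    refine (h1.sub (h2.const_mul (1 / 2))).congr_fderiv ?_
    ext x
    simp [hw]
    ring
  have h0 : φ 0 = f w := by simp [hφ]
  have h1 := (convex_closedBall (0 : F) ‖y‖).norm_image_sub_le_of_norm_hasFDerivWithin_le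
    (f := φ) (C := δ * ‖y‖ + C * ‖y‖ ^ 3) (x := 0) (y := y)
    (fun v _ => (hd v).hasFDerivWithinAt) (fun v hv => by
      rw [norm_neg, innerSL_apply_norm]
      have hv' : ‖v‖ ≤ ‖y‖ := by simpa using hv
      refine (h v).trans ?_
      gcongr) (by simp) (by simp)
  rw [h0, sub_zero, Real.norm_eq_abs] at h1
  have h2 : φ y - f w = f (w - y) - f w - 1 / 2 * inner ℝ y (H y) := by simp only [hφ]; ring
  rw [← h2]
  refine h1.trans (le_of_eq ?_)
  ring

end Calculus

/-! ### Regularity of the risks at the minimizer -/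

section Regularity

variable {K M : ℕ} {𝒳 : Type v} {p : Problem K M 𝒳} {wstar : Param M} {L : ℝ}

/-- The standing assumptions on the losses: `wstar` is a local minimizer and the losses have
`L`-Lipschitz gradients of class `C¹`. -/
structure Problem.IsRegular (p : Problem K M 𝒳) (wstar : Param M) (L : ℝ) : Prop where
  pos : 0 < K
  nonneg : 0 ≤ L
  localMin : IsLocalMin p.risk wstar
  contDiff : ∀ k i, ContDiff ℝ 2 fun w => p.Q k w (p.x k i)
  lipschitz : ∀ k i w₁ w₂, ‖p.lossGrad k i w₂ - p.lossGrad k i w₁‖ ≤ L * ‖w₂ - w₁‖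

namespace Problem.IsRegular

variable (h : p.IsRegular wstar L)
include h

lemma contDiff_localRisk (k : Fin K) : ContDiff ℝ 2 (p.localRisk k) :=
  contDiff_const.mul (ContDiff.sum fun i _ => h.contDiff k i)

lemma contDiff_risk : ContDiff ℝ 2 p.risk :=
  contDiff_const.mul (ContDiff.sum fun k _ => h.contDiff_localRisk k)

lemma gradient_localRisk (k : Fin K) (w : Param M) :
    gradient (p.localRisk k) w = (1 / (p.N k : ℝ)) • ∑ i, p.lossGrad k i w := by
  refine HasGradientAt.gradient (hasGradientAt_iff_hasFDerivAt.2 ?_)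
  have h1 := (HasFDerivAt.fun_sum fun i (_ : i ∈ univ) =>
    hasFDerivAt_of_contDiff (h.contDiff k i) w).const_mul (1 / (p.N k : ℝ))
  refine h1.congr_fderiv ?_
  ext x
  simp [Problem.lossGrad]

lemma gradient_risk (w : Param M) :
    gradient p.risk w = (1 / (K : ℝ)) • ∑ k, gradient (p.localRisk k) w := by
  refine HasGradientAt.gradient (hasGradientAt_iff_hasFDerivAt.2 ?_)
  have h1 := (HasFDerivAt.fun_sum fun k (_ : k ∈ univ) =>
    hasFDerivAt_of_contDiff (h.contDiff_localRisk k) w).const_mul (1 / (K : ℝ))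
  refine h1.congr_fderiv ?_
  ext x
  simp

lemma norm_gradient_localRisk_sub_le (k : Fin K) (w₁ w₂ : Param M) :
    ‖gradient (p.localRisk k) w₂ - gradient (p.localRisk k) w₁‖ ≤ L * ‖w₂ - w₁‖ := by
  have hN : (0 : ℝ) < p.N k := Nat.cast_pos.2 (p.N_pos k)
  rw [h.gradient_localRisk, h.gradient_localRisk, ← smul_sub, ← sum_sub_distrib, norm_smul,
    Real.norm_of_nonneg (by positivity), div_mul_eq_mul_div, one_mul, div_le_iff₀ hN]
  refine (norm_sum_le _ _).trans ((sum_le_sum fun i _ => h.lipschitz k i w₁ w₂).trans ?_)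
  simp [mul_comm]

lemma norm_gradient_risk_sub_le (w₁ w₂ : Param M) :
    ‖gradient p.risk w₂ - gradient p.risk w₁‖ ≤ L * ‖w₂ - w₁‖ := by
  have hK : (0 : ℝ) < K := Nat.cast_pos.2 h.pos
  rw [h.gradient_risk, h.gradient_risk, ← smul_sub, ← sum_sub_distrib, norm_smul,
    Real.norm_of_nonneg (by positivity), div_mul_eq_mul_div, one_mul, div_le_iff₀ hK]
  refine (norm_sum_le _ _).trans
    ((sum_le_sum fun k _ => h.norm_gradient_localRisk_sub_le k w₁ w₂).trans ?_)
  simp [mul_comm]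

lemma gradient_risk_eq_zero : gradient p.risk wstar = 0 := by
  rw [gradient, h.localMin.fderiv_eq_zero, map_zero]

/-- First-order optimality for the global risk: the local gradients at `w⋆` need not vanish, but
they balance, so `d` lies in the disagreement subspace. -/
lemma sum_localGrad : ∑ k, p.localGrad wstar k = 0 := by
  have h1 := h.gradient_risk wstar
  rw [h.gradient_risk_eq_zero] at h1
  have : (1 / (K : ℝ)) ≠ 0 := by have := h.pos; positivity
  exact (smul_eq_zero.1 h1.symm).resolve_left this

lemma norm_hess_le (k : Fin K) : ‖p.hess wstar k‖ ≤ L :=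
  (hasFDerivAt_gradient (h.contDiff_localRisk k) wstar).le_of_lip' h.nonneg
    (Filter.Eventually.of_forall fun w => h.norm_gradient_localRisk_sub_le k wstar w)

lemma fderiv_gradient_risk : fderiv ℝ (gradient p.risk) wstar = p.meanHess wstar := by
  have h1 : gradient p.risk = fun w => (1 / (K : ℝ)) • ∑ k, gradient (p.localRisk k) w :=
    funext h.gradient_risk
  rw [h1]
  exact ((HasFDerivAt.fun_sum fun k (_ : k ∈ univ) =>
    hasFDerivAt_gradient (h.contDiff_localRisk k) wstar).const_smul (1 / (K : ℝ))).fderiv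

lemma norm_meanHess_le : ‖p.meanHess wstar‖ ≤ L := by
  rw [← h.fderiv_gradient_risk]
  exact (hasFDerivAt_gradient h.contDiff_risk wstar).le_of_lip' h.nonneg
    (Filter.Eventually.of_forall fun w => h.norm_gradient_risk_sub_le wstar w)

lemma inner_meanHess (x y : Param M) :
    inner ℝ (p.meanHess wstar x) y = inner ℝ x (p.meanHess wstar y) := by
  rw [← h.fderiv_gradient_risk]
  exact inner_fderiv_gradient h.contDiff_risk wstar x y

lemma continuous_lossGrad (k : Fin K) (i : Fin (p.N k)) : Continuous (p.lossGrad k i) :=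
  (contDiff_gradient (h.contDiff k i)).continuous

lemma continuous_gradient_localRisk (k : Fin K) : Continuous (gradient (p.localRisk k)) :=
  (contDiff_gradient (h.contDiff_localRisk k)).continuous

end Problem.IsRegular

end Regularity

/-! ### The algorithms as instances of the abstract recursion -/

section Recursion

variable {K M : ℕ}

/-- Combination matrices `M₁`, `M₂` that preserve averages, do not increase norms, contract
disagreements by the factor `q`, and keep the accumulated effect of `d` below `g`. -/
structure IsMixing (M₁ M₂ : Matrix (Fin K) (Fin K) ℝ) (d : Blocks K M) (q g : ℝ) : Prop where
  q_nonneg : 0 ≤ q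
  q_lt_one : q < 1
  g_nonneg : 0 ≤ g
  norm₁ : ∀ x : Blocks K M, ‖blockMap M₁ x‖ ≤ ‖x‖
  norm₂ : ∀ x : Blocks K M, ‖blockMap M₂ x‖ ≤ ‖x‖
  row₁ : ∀ k, ∑ l, M₁ k l = 1
  row₂ : ∀ k, ∑ l, M₂ k l = 1
  col₁ : ∀ l, ∑ k, M₁ k l = 1
  col₂ : ∀ l, ∑ k, M₂ k l = 1
  gap : ∀ x : Blocks K M, blockMap (avgMatrix K) x = 0 →
    ‖blockMap M₂ (blockMap M₁ x)‖ ≤ q * ‖x‖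
  norm_drift_sum : ∀ n : ℕ,
    ‖∑ j ∈ range n, ((blockMap M₂ ∘ₗ blockMap M₁ : Blocks K M →ₗ[ℝ] Blocks K M) ^ j)
      (blockMap M₂ d)‖ ≤ g

lemma sum_pi_eq_zero {ι : Type*} [Fintype ι] [DecidableEq ι] {β : ι → Type*} [∀ i, Fintype (β i)]
    {F : Type*} [AddCommGroup F] (i : ι) {f : β i → F} (hf : ∑ a, f a = 0) :
    ∑ t : (j : ι) → β j, f (t i) = 0 := by
  rw [Fintype.sum_equiv (Equiv.piSplitAt i β) (fun t => f (t i)) (fun r => f r.1) fun t => rfl,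
    Fintype.sum_prod_type, sum_comm]
  simp [hf]

variable {𝒳 : Type v} {p : Problem K M 𝒳} {wstar : Param M} {L : ℝ}

instance (p : Problem K M 𝒳) : Nonempty ((k : Fin K) → Fin (p.N k)) :=
  ⟨fun k => ⟨0, p.N_pos k⟩⟩

/-- The gradient noise of single samples, for the error vector `x`. -/
noncomputable def Problem.sampleNoise (p : Problem K M 𝒳) (wstar : Param M) (x : Blocks K M)
    (t : (k : Fin K) → Fin (p.N k)) : Blocks K M :=
  WithLp.toLp 2 fun k => p.lossGrad k (t k) (wstar - x k) - gradient (p.localRisk k) (wstar - x k)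

lemma Problem.IsRegular.norm_sampleNoise_sub_le (h : p.IsRegular wstar L) (x : Blocks K M)
    (t : (k : Fin K) → Fin (p.N k)) :
    ‖p.sampleNoise wstar x t - p.sampleNoise wstar 0 t‖ ≤ 2 * L * ‖x‖ := by
  have hL := h.nonneg
  refine norm_le_of_blocks (by positivity) fun k => ?_
  have h1 := h.lipschitz k (t k) wstar (wstar - x k)
  have h2 := h.norm_gradient_localRisk_sub_le k wstar (wstar - x k)
  rw [sub_sub_cancel_left, norm_neg] at h1 h2
  have h3 : (p.sampleNoise wstar x t - p.sampleNoise wstar 0 t) k =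
      (p.lossGrad k (t k) (wstar - x k) - p.lossGrad k (t k) wstar) -
        (gradient (p.localRisk k) (wstar - x k) - gradient (p.localRisk k) wstar) := by
    simp only [sampleNoise, PiLp.sub_apply, PiLp.zero_apply, sub_zero]
    abel
  rw [h3]
  refine (norm_sub_le _ _).trans ((add_le_add h1 h2).trans_eq ?_)
  ring

lemma Problem.IsRegular.sum_sampleNoise (h : p.IsRegular wstar L) (x : Blocks K M) :
    ∑ t, p.sampleNoise wstar x t = 0 := by
  have key : ∀ k, ∑ t : (k : Fin K) → Fin (p.N k), (p.lossGrad k (t k) (wstar - x k) -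
      gradient (p.localRisk k) (wstar - x k)) = 0 := fun k => by
    have hN : (p.N k : ℝ) ≠ 0 := Nat.cast_ne_zero.2 (p.N_pos k).ne'
    have hf : ∑ i, (p.lossGrad k i (wstar - x k) -
        gradient (p.localRisk k) (wstar - x k)) = 0 := by
      rw [sum_sub_distrib, sum_const, card_univ, Fintype.card_fin, h.gradient_localRisk,
        ← Nat.cast_smul_eq_nsmul ℝ, smul_smul, mul_one_div_cancel hN, one_smul, sub_self]
    exact sum_pi_eq_zero (β := fun k => Fin (p.N k)) k hf
  have hk : ∀ k, (∑ t, p.sampleNoise wstar x t) k = ∑ t, p.sampleNoise wstar x t k := fun k => by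
    rw [WithLp.ofLp_sum, Finset.sum_apply]
  ext1 k
  exact (hk k).trans (key k)

/-- The error recursion of an algorithm with combination matrices `M₁`, `M₂`. -/
noncomputable def Problem.IsRegular.recursion (h : p.IsRegular wstar L)
    {M₁ M₂ : Matrix (Fin K) (Fin K) ℝ} {q g ε : ℝ}
    (hM : IsMixing M₁ M₂ (WithLp.toLp 2 (p.localGrad wstar)) q g)
    (hε : ∀ k, ‖p.hess wstar k - p.meanHess wstar‖ ≤ ε) :
    NoisyRecursion (Blocks K M) ((k : Fin K) → Fin (p.N k)) where
  A₁ := blockMap M₁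
  A₂ := blockMap M₂
  H := blockDiag (p.hess wstar)
  Hm := blockDiag fun _ => p.meanHess wstar
  Pj := blockMap (avgMatrix K)
  d := WithLp.toLp 2 (p.localGrad wstar)
  G x := WithLp.toLp 2 fun k => gradient (p.localRisk k) (wstar - x k)
  z := p.sampleNoise wstar
  L := L
  q := q
  ε := ε
  g := g
  -- One constant serves two purposes: `2 L` is the Lipschitz constant of the noise, and the sum
  -- over the finitely many samples dominates the noise at the minimizer.
  σ := 2 * L + ∑ t, ‖p.sampleNoise wstar 0 t‖
  L_nonneg := h.nonneg
  q_nonneg := hM.q_nonneg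
  q_lt_one := hM.q_lt_one
  ε_nonneg := (norm_nonneg _).trans (hε ⟨0, h.pos⟩)
  g_nonneg := hM.g_nonneg
  σ_nonneg := add_nonneg (mul_nonneg zero_le_two h.nonneg) (sum_nonneg fun _ _ => norm_nonneg _)
  norm_A₁ := hM.norm₁
  norm_A₂ := hM.norm₂
  norm_H x := norm_le_of_blocks h.nonneg fun k =>
    (p.hess wstar k).le_of_opNorm_le (h.norm_hess_le k) (x k)
  norm_Hm x := norm_le_of_blocks h.nonneg fun k =>
    (p.meanHess wstar).le_of_opNorm_le h.norm_meanHess_le (x k)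
  norm_H_sub x := norm_le_of_blocks ((norm_nonneg _).trans (hε ⟨0, h.pos⟩)) fun k =>
    (p.hess wstar k - p.meanHess wstar).le_of_opNorm_le (hε k) (x k)
  Hm_symm x y := by
    rw [PiLp.inner_apply, PiLp.inner_apply]
    exact sum_congr rfl fun k _ => h.inner_meanHess _ _
  Pj_idem x := by rw [← blockMap_mul, avgMatrix_mul (avgMatrix_col_sum h.pos)]
  Pj_symm := inner_blockMap avgMatrix_isSymm
  Pj_A₁ x := by rw [← blockMap_mul, avgMatrix_mul hM.col₁]
  Pj_A₂ x := by rw [← blockMap_mul, avgMatrix_mul hM.col₂]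
  A₁_Pj x := by rw [← blockMap_mul, mul_avgMatrix hM.row₁]
  A₂_Pj x := by rw [← blockMap_mul, mul_avgMatrix hM.row₂]
  Hm_Pj x := by
    ext1 k
    simp only [blockDiag_apply, blockMap_avgMatrix_apply, map_smul, map_sum]
  Pj_H_Pj x := by
    ext1 k
    simp only [blockDiag_apply, blockMap_avgMatrix_apply, Problem.meanHess, _root_.smul_apply,
      _root_.sum_apply]
  Pj_d := by
    ext1 k
    rw [blockMap_avgMatrix_apply]
    simp [h.sum_localGrad]
  gap := hM.gap
  norm_drift_sum := hM.norm_drift_sum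
  norm_G_sub x := norm_le_of_blocks h.nonneg fun k => by
    have := h.norm_gradient_localRisk_sub_le k wstar (wstar - x k)
    rw [sub_sub_cancel_left, norm_neg] at this
    exact this
  remainder δ hδ := by
    choose C hC hle using fun k => linearization_error_sq_le h.nonneg
      (hasFDerivAt_gradient (h.contDiff_localRisk k) wstar)
      (h.norm_gradient_localRisk_sub_le k) (h.norm_hess_le k) hδ
    refine ⟨∑ k, C k, sum_nonneg fun k _ => hC k, fun x => ?_⟩
    have hx : ∀ k, ‖x k‖ ^ 2 ≤ ‖x‖ ^ 2 := fun k => by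
      rw [PiLp.norm_sq_eq_of_L2 _ x]
      exact single_le_sum (f := fun k => ‖x k‖ ^ 2) (fun k _ => sq_nonneg _) (mem_univ k)
    rw [PiLp.norm_sq_eq_of_L2]
    calc _ ≤ ∑ k, (δ * ‖x k‖ ^ 2 + C k * ‖x‖ ^ 4) := by
          refine sum_le_sum fun k _ => (hle k (x k)).trans ?_
          have h4 : ‖x k‖ ^ 4 ≤ ‖x‖ ^ 4 := by
            calc ‖x k‖ ^ 4 = (‖x k‖ ^ 2) ^ 2 := by ring
              _ ≤ (‖x‖ ^ 2) ^ 2 := pow_le_pow_left₀ (sq_nonneg _) (hx k) 2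
              _ = _ := by ring
          have := hC k
          gcongr
      _ = _ := by rw [sum_add_distrib, ← mul_sum, ← sum_mul, ← PiLp.norm_sq_eq_of_L2]
  sum_z := h.sum_sampleNoise
  norm_z_zero t := by
    have h1 := single_le_sum (f := fun t => ‖p.sampleNoise wstar 0 t‖)
      (fun t _ => norm_nonneg _) (mem_univ t)
    have := h.nonneg
    linarith
  norm_z_sub x t := (h.norm_sampleNoise_sub_le x t).trans (mul_le_mul_of_nonneg_right
    (le_add_of_nonneg_right (sum_nonneg fun _ _ => norm_nonneg _)) (norm_nonneg _))

end Recursion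

end DistributedLearning

/-! ### Random initial states -/

namespace DistributedLearning

open Finset
open scoped BigOperators

namespace NoisyRecursion

/-- A function of the states that dominates all fourth-order quantities and grows at most by a
constant factor in every step. -/
noncomputable def growth {E : Type*} [NormedAddCommGroup E] (y : E × E) : ℝ := 1 + ‖y.1‖ ^ 4 + ‖y.2‖ ^ 4

lemma growth_nonneg {E : Type*} [NormedAddCommGroup E] (y : E × E) : 0 ≤ growth y := by unfold growth; positivity

variable {E τ : Type*} [NormedAddCommGroup E] [InnerProductSpace ℝ E] [Fintype τ]
  (m : NoisyRecursion E τ)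

/-- Needed only for integrability, so the constant may be crude: `54 = 2 · 27`, for two components
and `(1 + a + b)⁴ ≤ 27 (1 + a⁴ + b⁴)`. -/
lemma growth_step_le {μ : ℝ} (hμ : 0 ≤ μ) {B : ℕ} (hB : 0 < B) (y : E × E) (s : Fin B → τ) :
    growth (m.step μ B y s) ≤ (1 + 54 * (1 + μ * (m.L + ‖m.d‖ + m.σ)) ^ 4) * growth y := by
  have hL := m.L_nonneg
  have hσ := m.σ_nonneg
  have h1 := norm_nonneg y.1
  have h2 := norm_nonneg y.2
  have hd := norm_nonneg m.d
  set D := 1 + μ * (m.L + ‖m.d‖ + m.σ) with hD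
  have hnoise := norm_smul_le hμ (m.norm_noise_le hB y.1 s)
  have hG : ‖m.G y.1‖ ≤ ‖m.d‖ + m.L * ‖y.1‖ := by
    calc ‖m.G y.1‖ = ‖m.d + (m.G y.1 - m.d)‖ := by congr 1; abel
      _ ≤ _ := (norm_add_le _ _).trans (add_le_add_right (m.norm_G_sub _) _)
  have hs1 : ‖(m.step μ B y s).1‖ ≤ D * (1 + ‖y.1‖ + ‖y.2‖) := by
    calc _ ≤ ‖m.A₁ y.1 + μ • m.G y.1 + μ • m.noise B y.1 s‖ := m.norm_A₂ _
      _ ≤ ‖y.1‖ + μ * (‖m.d‖ + m.L * ‖y.1‖) + μ * (m.σ * (1 + ‖y.1‖)) :=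
        (norm_add₃_le).trans (add_le_add (add_le_add (m.norm_A₁ _) (norm_smul_le hμ hG)) hnoise)
      _ = (1 + μ * (m.L + ‖m.d‖ + m.σ)) * (1 + ‖y.1‖ + ‖y.2‖) - (1 + ‖y.2‖ +
          μ * (m.L * (1 + ‖y.2‖) + ‖m.d‖ * (‖y.1‖ + ‖y.2‖) + m.σ * ‖y.2‖)) := by ring
      _ ≤ _ := sub_le_self _ (by positivity)
  have hs2 : ‖(m.step μ B y s).2‖ ≤ D * (1 + ‖y.1‖ + ‖y.2‖) := by
    calc _ ≤ ‖m.A₁ y.2 - μ • m.H y.2 + μ • m.d + μ • m.noise B y.1 s‖ := m.norm_A₂ _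
      _ ≤ ‖y.2‖ + μ * (m.L * ‖y.2‖) + μ * ‖m.d‖ + μ * (m.σ * (1 + ‖y.1‖)) := by
        refine (norm_add₃_le).trans (add_le_add (add_le_add ((norm_sub_le _ _).trans
          (add_le_add (m.norm_A₁ _) (norm_smul_le hμ (m.norm_H _)))) (norm_smul_le hμ le_rfl)) hnoise)
      _ = (1 + μ * (m.L + ‖m.d‖ + m.σ)) * (1 + ‖y.1‖ + ‖y.2‖) - (1 + ‖y.1‖ +
          μ * (m.L * (1 + ‖y.1‖) + ‖m.d‖ * (‖y.1‖ + ‖y.2‖) + m.σ * ‖y.2‖)) := by ring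
      _ ≤ _ := sub_le_self _ (by positivity)
  have hpow : (1 + ‖y.1‖ + ‖y.2‖) ^ 4 ≤ 27 * growth y := by
    have h3 : (1 + ‖y.1‖ + ‖y.2‖) ^ 2 ≤ 3 * (1 + ‖y.1‖ ^ 2 + ‖y.2‖ ^ 2) := by
      nlinarith [sq_nonneg (1 - ‖y.1‖), sq_nonneg (1 - ‖y.2‖), sq_nonneg (‖y.1‖ - ‖y.2‖)]
    calc (1 + ‖y.1‖ + ‖y.2‖) ^ 4 = ((1 + ‖y.1‖ + ‖y.2‖) ^ 2) ^ 2 := by ring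
      _ ≤ (3 * (1 + ‖y.1‖ ^ 2 + ‖y.2‖ ^ 2)) ^ 2 := by gcongr
      _ ≤ _ := by
        unfold growth
        nlinarith [sq_nonneg (1 - ‖y.1‖ ^ 2), sq_nonneg (1 - ‖y.2‖ ^ 2),
          sq_nonneg (‖y.1‖ ^ 2 - ‖y.2‖ ^ 2)]
  have h4 : ∀ z : E, ‖z‖ ≤ D * (1 + ‖y.1‖ + ‖y.2‖) → ‖z‖ ^ 4 ≤ D ^ 4 * (27 * growth y) :=
    fun z hz => by
      calc ‖z‖ ^ 4 ≤ (D * (1 + ‖y.1‖ + ‖y.2‖)) ^ 4 := by gcongr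
        _ = D ^ 4 * (1 + ‖y.1‖ + ‖y.2‖) ^ 4 := by ring
        _ ≤ _ := by gcongr
  have h5 : 1 ≤ growth y := by unfold growth; nlinarith [pow_nonneg h1 4, pow_nonneg h2 4]
  have h6 := h4 _ hs1
  have h7 := h4 _ hs2
  rw [growth]
  linarith

/-- The second moment is traded for the fourth by the arithmetic–geometric mean inequality with
weight `r s`, where `s = μ / B`: a fourth moment of at most `(r s)²` gives a second moment of at
most `r s`. The other terms of `tail` are the fourth moment and `μ` times `scale`. The majorant `h`
spares a separate treatment of `tail` itself. -/
lemma integral_tail_le {Ω : Type*} [MeasurableSpace Ω] {P : Measure Ω} [IsProbabilityMeasure P]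
    {x₀ : Ω → E} (hint : Integrable (fun ω => ‖x₀ ω‖ ^ 4) P) {μ r : ℝ} {B : ℕ} (hμ : 0 < μ)
    (hμ1 : μ ≤ 1) (hB : 0 < B) (hr : 0 < r) (hr1 : r ≤ 1)
    (hx : ∫ ω, ‖x₀ ω‖ ^ 4 ∂P ≤ r ^ 2 * (μ ^ 2 / (B : ℝ) ^ 2)) :
    ∃ h : Ω → ℝ, Integrable h P ∧ (∀ ω, m.tail μ B (x₀ ω) ≤ h ω) ∧
      ∫ ω, h ω ∂P ≤ (2 * r + μ) * m.scale μ B := by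
  have hb : 0 < (B : ℝ)⁻¹ := by positivity
  have hb1 : (B : ℝ)⁻¹ ≤ 1 := inv_le_one_of_one_le₀ (by exact_mod_cast hB)
  set s := μ * (B : ℝ)⁻¹ with hs
  have hs0 : 0 < s := by positivity
  have hs1 : s ≤ 1 := mul_le_one₀ hμ1 hb.le hb1
  have hx' : ∫ ω, ‖x₀ ω‖ ^ 4 ∂P ≤ (r * s) ^ 2 := hx.trans_eq (by rw [hs]; ring)
  refine ⟨fun ω => (r * s / 2 + μ * m.scale μ B) + (1 / (2 * (r * s)) + 1) * ‖x₀ ω‖ ^ 4,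
    (integrable_const _).add (hint.const_mul _), fun ω => ?_, ?_⟩
  · have h1 : ‖x₀ ω‖ ^ 2 ≤ r * s / 2 + 1 / (2 * (r * s)) * ‖x₀ ω‖ ^ 4 := by
      have hrs : 0 < r * s := by positivity
      rw [div_mul_eq_mul_div, one_mul, div_add_div _ _ two_ne_zero (by positivity),
        le_div_iff₀ (by positivity)]
      nlinarith [sq_nonneg (‖x₀ ω‖ ^ 2 - r * s)]
    have h2 : m.tail μ B (x₀ ω) = ‖x₀ ω‖ ^ 2 + ‖x₀ ω‖ ^ 4 + μ * m.scale μ B := by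
      unfold tail scale; ring
    rw [h2]
    linarith
  · rw [integral_add (integrable_const _) (hint.const_mul _), integral_const_mul]
    simp only [integral_const, probReal_univ, one_smul]
    have hsc : s ≤ m.scale μ B := by
      have : 0 ≤ m.g ^ 2 * μ ^ 2 := by positivity
      unfold scale
      linarith
    calc _ ≤ (r * s / 2 + μ * m.scale μ B) + (1 / (2 * (r * s)) + 1) * (r * s) ^ 2 := by gcongr
      _ = r * s + r * s * (r * s) + μ * m.scale μ B := by field_simp; ring
      _ ≤ r * s + r * s * 1 + μ * m.scale μ B := by
        gcongr
        exact mul_le_one₀ hr1 hs0.le hs1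
      _ ≤ _ := by nlinarith

section Expectation

variable [FiniteDimensional ℝ E]

lemma continuous_quad : Continuous m.quad :=
  continuous_id.inner m.Hm.continuous_of_finiteDimensional

lemma continuous_step (hG : Continuous m.G) (hz : ∀ t, Continuous fun x => m.z x t)
    (μ : ℝ) (B : ℕ) (s : Fin B → τ) : Continuous fun y => m.step μ B y s := by
  have hA₁ := m.A₁.continuous_of_finiteDimensional
  have hA₂ := m.A₂.continuous_of_finiteDimensional
  have hH := m.H.continuous_of_finiteDimensional
  have hn : Continuous fun y : E × E => m.noise B y.1 s :=
    ((continuous_finsetSum _ fun b _ => hz (s b)).const_smul (B : ℝ)⁻¹).comp continuous_fst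
  unfold step
  fun_prop

variable [MeasurableSpace E] [BorelSpace E] [Nonempty τ] [MeasurableSpace τ]
  [MeasurableSingletonClass τ]

/-- The expansion of the expected loss of the recursion and of the expected quadratic loss of its
linearization, for random initial states and independent uniform samples. -/
theorem abs_integral_sub_leading_le (hG : Continuous m.G) (hz : ∀ t, Continuous fun x => m.z x t)
    {T : ℝ} (hT : 0 ≤ T) {f : E → ℝ} (hfc : Continuous f)
    (hf : ∀ δ > 0, ∃ C, 0 ≤ C ∧ ∀ x, |f x - m.quad x| ≤ δ * ‖x‖ ^ 2 + C * ‖x‖ ^ 4)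
    {δ : ℝ} (hδ : 0 < δ) :
    ∃ κ > 0, ∃ μ₀ > 0, ∀ (μ : ℝ) (B n : ℕ), 0 < μ → μ < μ₀ → 0 < B → n * μ ≤ T →
      ∀ (Ω : Type u) [MeasurableSpace Ω] (P : Measure Ω) [IsProbabilityMeasure P]
        (x₀ : Ω → E) (ζ : ℕ → Ω → Fin B → τ), Measurable x₀ → (∀ n, Measurable (ζ n)) →
      (∀ n, IndepFun (fun ω => ((x₀ ω, x₀ ω), fun i : Fin n => ζ i ω)) (ζ n) P) →
      (∀ n s, P.real (ζ n ⁻¹' {s}) = (Fintype.card (Fin B → τ) : ℝ)⁻¹) →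
      Integrable (fun ω => ‖x₀ ω‖ ^ 4) P → ∫ ω, ‖x₀ ω‖ ^ 4 ∂P ≤ κ * (μ ^ 2 / (B : ℝ) ^ 2) →
      (Integrable (fun ω => f (run (m.step μ B) (x₀ ω, x₀ ω) (fun i => ζ i ω) n).1) P ∧
        |∫ ω, f (run (m.step μ B) (x₀ ω, x₀ ω) (fun i => ζ i ω) n).1 ∂P - m.leading μ B n| ≤
          2 * m.L * (Real.exp (m.L * T) * T) ^ 2 * (m.ε ^ 2 * m.g ^ 2 * μ ^ 2) +
            δ * m.scale μ B) ∧
      (Integrable (fun ω => m.quad (run (m.step μ B) (x₀ ω, x₀ ω) (fun i => ζ i ω) n).2) P ∧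
        |∫ ω, m.quad (run (m.step μ B) (x₀ ω, x₀ ω) (fun i => ζ i ω) n).2 ∂P - m.leading μ B n| ≤
          2 * m.L * (Real.exp (m.L * T) * T) ^ 2 * (m.ε ^ 2 * m.g ^ 2 * μ ^ 2) +
            δ * m.scale μ B) ∧
      ∀ φ : E → ℝ, Continuous φ → (∃ c, ∀ x, |φ x| ≤ c * (1 + ‖x‖ ^ 4)) →
        Integrable (fun ω => φ (run (m.step μ B) (x₀ ω, x₀ ω) (fun i => ζ i ω) n).1) P := by
  have hL := m.L_nonneg
  obtain ⟨C₁, hC₁, h₁⟩ := m.abs_iterMean_loss_sub_le hT hf (δ := δ / 4) (by positivity)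
  obtain ⟨C₂, hC₂, h₂⟩ := m.abs_iterMean_quad_sub_le hT (δ := δ / 4) (by positivity)
  obtain ⟨C₀, hC₀, h₀⟩ := hf 1 one_pos
  set C := C₁ + C₂ with hC
  have hC0 : 0 ≤ C := by positivity
  -- With the bound on `μ` below, `C (2 r + μ) ≤ δ / 2`, so the averaged tail takes up the remaining
  -- half of `δ`. The hypothesis is on fourth moments, which is why `κ = r²`.
  set r := min 1 (δ / (8 * (C + 1))) with hr
  have hr0 : 0 < r := by positivity
  refine ⟨r ^ 2, by positivity, min 1 (δ / (4 * (C + 1))), by positivity, ?_⟩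
  intro μ B n hμ hμlt hB hn Ω _ P _ x₀ ζ hx₀ hζ hind hunif hint hmom
  have hμ1 : μ ≤ 1 := (hμlt.trans_le (min_le_left _ _)).le
  have hμC : μ ≤ δ / (4 * (C + 1)) := (hμlt.trans_le (min_le_right _ _)).le
  obtain ⟨h, hhint, hh, hhle⟩ := m.integral_tail_le hint hμ hμ1 hB hr0 (min_le_left _ _) hmom
  have hsc := m.scale_nonneg hμ.le B
  have hCh : C * ∫ ω, h ω ∂P ≤ δ / 2 * m.scale μ B := by
    have h3 : C * (2 * r + μ) ≤ δ / 2 := by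
      have h4 : 2 * r + μ ≤ δ / 2 / (C + 1) := by
        have := min_le_right 1 (δ / (8 * (C + 1)))
        calc 2 * r + μ ≤ 2 * (δ / (8 * (C + 1))) + δ / (4 * (C + 1)) := by gcongr
          _ = _ := by field_simp; ring
      calc C * (2 * r + μ) ≤ C * (δ / 2 / (C + 1) * 1) := by rw [mul_one]; gcongr
        _ ≤ δ / 2 * 1 := div_add_one_mul_le hC0 (by positivity) zero_le_one
        _ = _ := mul_one _
    calc _ ≤ C * ((2 * r + μ) * m.scale μ B) := by gcongr
      _ = C * (2 * r + μ) * m.scale μ B := by ring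
      _ ≤ _ := by gcongr
  set R := 2 * m.L * (Real.exp (m.L * T) * T) ^ 2 * (m.ε ^ 2 * m.g ^ 2 * μ ^ 2) with hR
  have hgm : Measurable (growth : E × E → ℝ) := by
    have : Continuous (growth : E × E → ℝ) := by unfold growth; fun_prop
    exact this.measurable
  have hgint : Integrable (fun ω => growth (x₀ ω, x₀ ω)) P :=
    ((integrable_const 1).add hint).add hint
  have hrun := fun {φ : E × E → ℝ} (hφ : Measurable φ) {c : ℝ} (hc : ∀ y, |φ y| ≤ c * growth y) =>
    integral_run (fun s => (m.continuous_step hG hz μ B s).measurable)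
      (hx₀.prodMk hx₀) hζ hind hunif hgm growth_nonneg (m.growth_step_le hμ.le hB) hgint n hφ hc
  have key : ∀ {φ : E × E → ℝ}, Measurable φ → (∃ c, ∀ y, |φ y| ≤ c * growth y) →
      (∀ x, |iterMean (m.step μ B) n φ (x, x) - m.leading μ B n| ≤
        R + δ / 2 * m.scale μ B + C * m.tail μ B x) →
      Integrable (fun ω => φ (run (m.step μ B) (x₀ ω, x₀ ω) (fun i => ζ i ω) n)) P ∧
        |∫ ω, φ (run (m.step μ B) (x₀ ω, x₀ ω) (fun i => ζ i ω) n) ∂P - m.leading μ B n| ≤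
          R + δ * m.scale μ B := by
    rintro φ hφ ⟨c, hc⟩ hle
    obtain ⟨hi, hi', he⟩ := hrun hφ hc
    refine ⟨hi, ?_⟩
    have h4 : ∫ ω, iterMean (m.step μ B) n φ (x₀ ω, x₀ ω) ∂P - m.leading μ B n =
        ∫ ω, (iterMean (m.step μ B) n φ (x₀ ω, x₀ ω) - m.leading μ B n) ∂P := by
      rw [integral_sub hi' (integrable_const _)]
      simp
    rw [he, h4]
    have h5 := norm_integral_le_of_norm_le
      (f := fun ω => iterMean (m.step μ B) n φ (x₀ ω, x₀ ω) - m.leading μ B n)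
      (g := fun ω => (R + δ / 2 * m.scale μ B) + C * h ω)
      ((integrable_const _).add (hhint.const_mul C))
      (Filter.Eventually.of_forall fun ω => (hle (x₀ ω)).trans
        (add_le_add_right (mul_le_mul_of_nonneg_left (hh ω) hC0) _))
    rw [integral_add (integrable_const _) (hhint.const_mul C), integral_const_mul] at h5
    simp only [integral_const, probReal_univ, one_smul] at h5
    rw [Real.norm_eq_abs] at h5
    linarith
  have hsq : ∀ x : E, ‖x‖ ^ 2 ≤ 1 + ‖x‖ ^ 4 := fun x => by nlinarith [sq_nonneg (‖x‖ ^ 2 - 1)]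
  have hq : ∀ x : E, |m.quad x| ≤ m.L * (1 + ‖x‖ ^ 4) := fun x =>
    (m.abs_quad_le x).trans (mul_le_mul_of_nonneg_left (hsq x) hL)
  refine ⟨?_, ?_, fun φ hφ ⟨c, hc⟩ => (hrun (φ := fun y => φ y.1)
    (hφ.measurable.comp measurable_fst) (c := |c|) fun y => ?_).1⟩
  · refine key (φ := fun y => f y.1) (hfc.measurable.comp measurable_fst)
      ⟨m.L + 1 + C₀, fun y => ?_⟩ fun x => ?_
    · have h3 : |f y.1| ≤ |f y.1 - m.quad y.1| + |m.quad y.1| := by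
        simpa using abs_add_le (f y.1 - m.quad y.1) (m.quad y.1)
      have h4 := h₀ y.1
      have h5 := hq y.1
      have h6 := hsq y.1
      have h7 : 0 ≤ (m.L + 1 + C₀) * ‖y.2‖ ^ 4 := by positivity
      unfold growth
      linarith
    · have h3 := h₁ μ B n x hμ.le hμ1 hB hn
      have h4 := h₂ μ B n x hμ.le hμ1 hB hn
      calc _ ≤ _ := abs_sub_le _ (iterMean (m.step μ B) n (fun y => m.quad y.2) (x, x)) _
        _ ≤ _ := add_le_add h3 h4
        _ = _ := by rw [hC]; ring
  · refine key (φ := fun y => m.quad y.2) (m.continuous_quad.measurable.comp measurable_snd)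
      ⟨m.L, fun y => (hq y.2).trans ?_⟩ fun x => ?_
    · unfold growth
      gcongr ?_ * ?_
      have := pow_nonneg (norm_nonneg y.1) 4
      linarith
    · refine (h₂ μ B n x hμ.le hμ1 hB hn).trans ?_
      have := m.tail_nonneg hμ.le B x
      have h3 : C₂ * m.tail μ B x ≤ C * m.tail μ B x := by
        gcongr; linarith
      have : 0 ≤ δ / 4 * m.scale μ B := by positivity
      linarith
  · have h3 : 0 ≤ 1 + ‖y.1‖ ^ 4 := by positivity
    refine (hc y.1).trans ((mul_le_mul_of_nonneg_right (le_abs_self c) h3).trans ?_)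
    unfold growth
    gcongr ?_ * ?_
    exact le_add_of_nonneg_right (by positivity)

end Expectation

end NoisyRecursion

end DistributedLearning

namespace DistributedLearning

open Finset
open scoped BigOperators

variable {K M : ℕ}

/-! ### Mixing properties of the three methods -/

section Mixing

/-- Averaging annihilates all disagreement, including `d`, which has zero sum; hence `q = g = 0` and
neither a drift term nor an `ε` term appears. -/
lemma isMixing_centralized (hK : 0 < K) {d : Blocks K M} (hd : ∑ k, d k = 0) :
    IsMixing 1 (avgMatrix K) d 0 0 where
  q_nonneg := le_rfl
  q_lt_one := one_pos
  g_nonneg := le_rfl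
  norm₁ x := by rw [blockMap_one]
  norm₂ := norm_blockMap_avgMatrix_le hK
  row₁ k := by simp [Matrix.one_apply]
  row₂ := avgMatrix_row_sum hK
  col₁ l := by simp [Matrix.one_apply]
  col₂ := avgMatrix_col_sum hK
  gap x hx := by rw [blockMap_one, hx, norm_zero, zero_mul]
  norm_drift_sum n := by
    have h0 : blockMap (avgMatrix K) d = 0 := by
      ext1 k
      rw [blockMap_avgMatrix_apply, hd, smul_zero]
      rfl
    simp [h0]

variable {A : Matrix (Fin K) (Fin K) ℝ} {Vα : Matrix (Fin K) (Fin (K - 1)) ℝ}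
  {ev : Fin (K - 1) → ℝ}

lemma isMixing_consensus (h : IsEigendecomposition A Vα ev) (hA : IsCombinationMatrix A)
    (hK : 0 < K) {q : ℝ} (hq : 0 ≤ q) (hq1 : q < 1) (hev : ∀ a, |ev a| ≤ q) {d : Blocks K M}
    (hd : ∑ k, d k = 0) : IsMixing A 1 d q ((1 - q)⁻¹ * ‖d‖) where
  q_nonneg := hq
  q_lt_one := hq1
  g_nonneg := mul_nonneg (inv_nonneg.2 (by linarith)) (norm_nonneg _)
  norm₁ := h.norm_blockMap_le hA
  norm₂ x := by rw [blockMap_one]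
  row₁ := hA.row_sum
  row₂ k := by simp [Matrix.one_apply]
  col₁ := hA.col_sum
  col₂ l := by simp [Matrix.one_apply]
  gap x hx := by
    rw [blockMap_one]
    exact h.norm_blockMap_le_gap hA hq hev (sum_eq_zero_of_blockMap_avgMatrix hK hx)
  norm_drift_sum n := by
    have h1 : (blockMap 1 ∘ₗ blockMap A : Blocks K M →ₗ[ℝ] Blocks K M) = blockMap A :=
      LinearMap.ext fun x => blockMap_one _
    rw [h1, blockMap_one]
    exact h.norm_geom_sum_le hA hq hq1 hev hd n

lemma isMixing_diffusion (h : IsEigendecomposition A Vα ev) (hA : IsCombinationMatrix A)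
    (hK : 0 < K) {q : ℝ} (hq : 0 ≤ q) (hq1 : q < 1) (hev : ∀ a, |ev a| ≤ q) {d : Blocks K M}
    (hd : ∑ k, d k = 0) : IsMixing 1 A d q ((1 - q)⁻¹ * ‖d‖) where
  q_nonneg := hq
  q_lt_one := hq1
  g_nonneg := mul_nonneg (inv_nonneg.2 (by linarith)) (norm_nonneg _)
  norm₁ x := by rw [blockMap_one]
  norm₂ := h.norm_blockMap_le hA
  row₁ k := by simp [Matrix.one_apply]
  row₂ := hA.row_sum
  col₁ l := by simp [Matrix.one_apply]
  col₂ := hA.col_sum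
  gap x hx := by
    rw [blockMap_one]
    exact h.norm_blockMap_le_gap hA hq hev (sum_eq_zero_of_blockMap_avgMatrix hK hx)
  norm_drift_sum n := by
    have h1 : (blockMap A ∘ₗ blockMap 1 : Blocks K M →ₗ[ℝ] Blocks K M) = blockMap A :=
      LinearMap.ext fun x => congrArg (blockMap A) (blockMap_one x)
    rw [h1]
    refine (h.norm_geom_sum_le hA hq hq1 hev
      ((IsEigendecomposition.sum_blockMap hA d).trans hd) n).trans ?_
    have : 0 ≤ (1 - q)⁻¹ := inv_nonneg.2 (by linarith)
    gcongr
    exact h.norm_blockMap_le hA d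

end Mixing

/-! ### The drift terms in closed form -/

section Drift

variable {A : Matrix (Fin K) (Fin K) ℝ} {Vα : Matrix (Fin K) (Fin (K - 1)) ℝ}
  {ev : Fin (K - 1) → ℝ} {𝒳 : Type v} {p : Problem K M 𝒳} {wstar : Param M}

/-- A vector of zero sum has no component along `𝟙`, and on the eigenvector with index `a` the sum
of powers is the scalar `(1 - e_aⁿ) / (1 - e_a)`. -/
lemma weightedSq_geom_sum (h : IsEigendecomposition A Vα ev) (hA : IsCombinationMatrix A)
    (H : Param M →L[ℝ] Param M) {x : Blocks K M} (hx : ∑ k, x k = 0) (n : ℕ) :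
    weightedSq H (∑ j ∈ range n, (blockMap A ^ j) x).ofLp =
      ∑ a, ((1 - ev a)⁻¹ * (1 - ev a ^ n)) ^ 2 *
        inner ℝ (blockRow x.ofLp Vα a) (H (blockRow x.ofLp Vα a)) := by
  have h1 : ∀ j, ∑ k, (blockMap A ^ j) x k = 0 := by
    intro j
    induction j with
    | zero => exact hx
    | succ j ih => rw [pow_succ', Module.End.mul_apply, IsEigendecomposition.sum_blockMap hA, ih]
  have h2 : ∑ k, (∑ j ∈ range n, (blockMap A ^ j) x) k = 0 := by
    simp only [WithLp.ofLp_sum, Finset.sum_apply]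
    rw [sum_comm]
    exact sum_eq_zero fun j _ => h1 j
  rw [h.weightedSq_eq, h2]
  simp only [smul_zero, inner_zero_left, zero_add, weightedSq]
  refine sum_congr rfl fun a _ => ?_
  rw [h.blockRow_geom_sum hA, map_smul, real_inner_smul_left, inner_smul_right]
  ring

lemma consensusTerm_eq (h : IsEigendecomposition A Vα ev) (hA : IsCombinationMatrix A)
    (hd : ∑ k, p.localGrad wstar k = 0) (n : ℕ) :
    p.consensusTerm wstar Vα ev n = 1 / (2 * (K : ℝ)) * weightedSq (p.meanHess wstar)
      (∑ j ∈ range (n + 1), (blockMap A ^ j) (WithLp.toLp 2 (p.localGrad wstar))).ofLp := by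
  rw [Problem.consensusTerm, weightedSq_geom_sum h hA _ hd, weightedSq]
  congr 1
  refine sum_congr rfl fun a _ => ?_
  have h1 : blockRow (p.localGrad wstar)
      (Vα * (1 - Matrix.diagonal ev)⁻¹ * (1 - Matrix.diagonal ev ^ (n + 1))) a =
      ((1 - ev a)⁻¹ * (1 - ev a ^ (n + 1))) • blockRow (p.localGrad wstar) Vα a := by
    rw [h.one_sub_diagonal_inv hA, Matrix.diagonal_pow, ← Matrix.diagonal_one,
      Matrix.diagonal_sub]
    simp only [blockRow, smul_sum, smul_smul, Matrix.mul_diagonal, Pi.pow_apply]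
    exact sum_congr rfl fun k _ => by congr 1; ring
  rw [h1, map_smul, real_inner_smul_left, inner_smul_right]
  ring

lemma diffusionTerm_eq (h : IsEigendecomposition A Vα ev) (hA : IsCombinationMatrix A)
    (hd : ∑ k, p.localGrad wstar k = 0) (n : ℕ) :
    p.diffusionTerm wstar Vα ev n = 1 / (2 * (K : ℝ)) * weightedSq (p.meanHess wstar)
      (∑ j ∈ range (n + 1), (blockMap A ^ j)
        (blockMap A (WithLp.toLp 2 (p.localGrad wstar)))).ofLp := by
  rw [Problem.diffusionTerm, weightedSq_geom_sum h hA _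
    ((IsEigendecomposition.sum_blockMap hA _).trans hd), weightedSq]
  congr 1
  refine sum_congr rfl fun a _ => ?_
  have h1 : blockRow (p.localGrad wstar) (Vα * Matrix.diagonal ev *
      (1 - Matrix.diagonal ev)⁻¹ * (1 - Matrix.diagonal ev ^ (n + 1))) a =
      ((1 - ev a)⁻¹ * (1 - ev a ^ (n + 1))) • ev a • blockRow (p.localGrad wstar) Vα a := by
    rw [h.one_sub_diagonal_inv hA, Matrix.diagonal_pow, ← Matrix.diagonal_one,
      Matrix.diagonal_sub]
    simp only [blockRow, smul_sum, smul_smul, Matrix.mul_diagonal, Pi.pow_apply]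
    exact sum_congr rfl fun k _ => by congr 1; ring
  rw [h1, h.blockRow_blockMap hA, map_smul, real_inner_smul_left, inner_smul_right]
  ring

end Drift

/-! ### The leading terms in closed form -/

section Leading

variable {𝒳 : Type v} {p : Problem K M 𝒳} {wstar : Param M} {L : ℝ}

lemma trace_mul_rankOne (Φ : Param M →L[ℝ] Param M) (z : Param M) :
    LinearMap.trace ℝ (Param M) ((Φ * InnerProductSpace.rankOne ℝ z z :
      Param M →L[ℝ] Param M) : Param M →ₗ[ℝ] Param M) = inner ℝ z (Φ z) := by
  have h1 : Φ * InnerProductSpace.rankOne ℝ z z = InnerProductSpace.rankOne ℝ (Φ z) z := by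
    ext x
    simp
  rw [h1, InnerProductSpace.trace_rankOne]

/-- The network average of the gradient noise at the minimizer. -/
noncomputable def Problem.meanNoise (p : Problem K M 𝒳) (wstar : Param M)
    (t : (k : Fin K) → Fin (p.N k)) : Param M :=
  (1 / (K : ℝ)) • ∑ k, (p.lossGrad k (t k) wstar - p.localGrad wstar k)

/-- The covariance is an average of rank-one operators, so the trace is an average of `⟨z, (1 -
Ψ^{2(n+1)}) z⟩`; symmetry of `Ψ = 1 - μ H̄` moves half of the power to the other side. -/
lemma Problem.IsRegular.noiseTerm_eq (h : p.IsRegular wstar L) (μ : ℝ) (n : ℕ) :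
    p.noiseTerm wstar μ n = 1 / 4 * 𝔼 t, (‖p.meanNoise wstar t‖ ^ 2 -
      ‖((1 - μ • p.meanHess wstar) ^ (n + 1)) (p.meanNoise wstar t)‖ ^ 2) := by
  set Ψ := 1 - μ • p.meanHess wstar with hΨ
  have hsymm : ∀ n x y, inner ℝ ((Ψ ^ n) x) y = inner ℝ x ((Ψ ^ n) y) := by
    intro n
    induction n with
    | zero => simp
    | succ n ih =>
      intro x y
      have h1 : ∀ x y, inner ℝ (Ψ x) y = inner ℝ x (Ψ y) := fun x y => by
        simp [hΨ, inner_sub_left, inner_sub_right, real_inner_smul_left, inner_smul_right,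
          h.inner_meanHess]
      rw [pow_succ, mul_apply_eq_comp, ih, h1, ← mul_apply_eq_comp,
        ← pow_succ', pow_succ]
  have hz : ∀ z, inner ℝ z ((1 - Ψ ^ (2 * (n + 1))) z) = ‖z‖ ^ 2 - ‖(Ψ ^ (n + 1)) z‖ ^ 2 := by
    intro z
    rw [two_mul, pow_add, _root_.sub_apply, inner_sub_right,
      mul_apply_eq_comp, ← hsymm]
    simp
  rw [Problem.noiseTerm, Problem.noiseCov, Fintype.expect_eq_sum_div_card]
  congr 1
  have hsmul : ∀ (c : ℝ) (Φ Φ' : Param M →L[ℝ] Param M), Φ * (c • Φ') = c • (Φ * Φ') :=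
    fun c Φ Φ' => ContinuousLinearMap.comp_smul Φ c Φ'
  rw [hsmul, mul_sum, ContinuousLinearMap.toLinearMap_smul, map_smul, ContinuousLinearMap.toLinearMap_sum,
    map_sum, smul_eq_mul, one_div_mul_eq_div]
  congr 1
  exact sum_congr rfl fun t _ => (trace_mul_rankOne _ _).trans (hz _)

variable {M₁ M₂ : Matrix (Fin K) (Fin K) ℝ} {q g ε : ℝ}

/-- The centroid noise consists of `K` equal blocks, whose squared norm cancels the `1 / K` of the
excess risk. The `1 / 4` in `noiseTerm` is the `1 / 2` of the risk times the `1 / 2` of the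
telescoped energy. -/
lemma Problem.IsRegular.leading_eq (h : p.IsRegular wstar L)
    (hM : IsMixing M₁ M₂ (WithLp.toLp 2 (p.localGrad wstar)) q g)
    (hε : ∀ k, ‖p.hess wstar k - p.meanHess wstar‖ ≤ ε) (μ : ℝ) (B n : ℕ) :
    1 / (2 * (K : ℝ)) * (h.recursion hM hε).leading μ B (n + 1) =
      μ / B * p.noiseTerm wstar μ n + μ ^ 2 * (1 / (2 * (K : ℝ)) *
        weightedSq (p.meanHess wstar) (∑ j ∈ range (n + 1),
          ((blockMap M₂ ∘ₗ blockMap M₁ : Blocks K M →ₗ[ℝ] Blocks K M) ^ j)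
            (blockMap M₂ (WithLp.toLp 2 (p.localGrad wstar)))).ofLp) := by
  have hK : (K : ℝ) ≠ 0 := Nat.cast_ne_zero.2 h.pos.ne'
  set m := h.recursion hM hε with hm
  set Ψ := 1 - μ • p.meanHess wstar with hΨ
  have h1 : m.quad (m.drift μ (n + 1)) = μ ^ 2 * weightedSq (p.meanHess wstar)
      (∑ j ∈ range (n + 1), ((blockMap M₂ ∘ₗ blockMap M₁ : Blocks K M →ₗ[ℝ] Blocks K M) ^ j)
        (blockMap M₂ (WithLp.toLp 2 (p.localGrad wstar)))).ofLp := by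
    rw [NoisyRecursion.quad, NoisyRecursion.drift, map_smul, real_inner_smul_left,
      inner_smul_right, ← mul_assoc, ← sq, PiLp.inner_apply]
    rfl
  have h2 : ∀ t, m.centroidNoise t = WithLp.toLp 2 fun _ => p.meanNoise wstar t := by
    intro t
    ext1 k
    refine (blockMap_avgMatrix_apply _ k).trans (congrArg _ (sum_congr rfl fun l _ => ?_))
    change p.lossGrad l (t l) (wstar - 0) - gradient (p.localRisk l) (wstar - 0) = _
    rw [sub_zero]
    rfl
  have h3 : ∀ (i : ℕ) (v : Param M), (m.centroid μ ^ i) (WithLp.toLp 2 fun _ => v) =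
      WithLp.toLp 2 fun _ => (Ψ ^ i) v := by
    intro i v
    induction i with
    | zero => rfl
    | succ i ih =>
      rw [pow_succ', Module.End.mul_apply, ih, pow_succ']
      rfl
  have h4 : ∀ v : Param M, ‖(WithLp.toLp 2 fun _ => v : Blocks K M)‖ ^ 2 = K * ‖v‖ ^ 2 := by
    intro v
    rw [PiLp.norm_sq_eq_of_L2]
    simp
  have h5 : ∀ t, ‖m.centroidNoise t‖ ^ 2 - ‖(m.centroid μ ^ (n + 1)) (m.centroidNoise t)‖ ^ 2 =
      K * (‖p.meanNoise wstar t‖ ^ 2 - ‖(Ψ ^ (n + 1)) (p.meanNoise wstar t)‖ ^ 2) := by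
    intro t
    rw [h2, h3, h4, h4]
    ring
  rw [NoisyRecursion.leading, h1, h.noiseTerm_eq, expect_congr rfl fun t _ => h5 t, ← mul_expect]
  field_simp
  ring

end Leading

/-! ### Identification of the iterates with the abstract recursion -/

section Iterates

variable {𝒳 : Type v} {p : Problem K M 𝒳} {wstar : Param M} {L : ℝ}

/-- The iterates `w` of the algorithm with combination matrices `M₁`, `M₂`. -/
def Problem.IsIterate (p : Problem K M 𝒳) {B : ℕ} (M₁ M₂ : Matrix (Fin K) (Fin K) ℝ) (μ : ℝ)
    (j : p.Batches B) (w : ℕ → Fin K → Param M) : Prop :=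
  ∀ n k, w (n + 1) k = ∑ l, M₂ k l • ((∑ i, M₁ l i • w n i) - μ • p.batchGrad l (j l n) (w n l))

lemma isIterate_centralized {B : ℕ} (μ : ℝ) (hK : 0 < K) (j : p.Batches B) (w₀ : Param M) :
    p.IsIterate 1 (avgMatrix K) μ j fun n _ => p.centralized μ j w₀ n := by
  intro n k
  have : (K : ℝ) ≠ 0 := Nat.cast_ne_zero.2 hK.ne'
  simp only [Problem.centralized, avgMatrix, Matrix.of_apply, Matrix.one_apply, ite_smul, one_smul,
    zero_smul, sum_ite_eq, mem_univ, if_true, smul_sub, sum_sub_distrib, sum_const, card_univ,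
    Fintype.card_fin, ← Nat.cast_smul_eq_nsmul ℝ, smul_smul, smul_sum]
  rw [mul_one_div_cancel this, one_smul]
  simp only [mul_comm]

lemma isIterate_consensus {A : Matrix (Fin K) (Fin K) ℝ} (hA : A.IsSymm) {B : ℕ} (μ : ℝ)
    (j : p.Batches B) (w₀ : Fin K → Param M) :
    p.IsIterate A 1 μ j (p.consensus A μ j w₀) := by
  intro n k
  simp only [Problem.consensus, Matrix.one_apply, ite_smul, one_smul, zero_smul, sum_ite_eq,
    mem_univ, if_true, hA.apply]

lemma isIterate_diffusion {A : Matrix (Fin K) (Fin K) ℝ} (hA : A.IsSymm) {B : ℕ} (μ : ℝ)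
    (j : p.Batches B) (w₀ : Fin K → Param M) :
    p.IsIterate 1 A μ j (p.diffusion A μ j w₀) := by
  intro n k
  simp only [Problem.diffusion, Matrix.one_apply, ite_smul, one_smul, zero_smul, sum_ite_eq,
    mem_univ, if_true, hA.apply]

variable {M₁ M₂ : Matrix (Fin K) (Fin K) ℝ} {q g ε : ℝ}

lemma Problem.IsRegular.noise_recursion (h : p.IsRegular wstar L)
    (hM : IsMixing M₁ M₂ (WithLp.toLp 2 (p.localGrad wstar)) q g)
    (hε : ∀ k, ‖p.hess wstar k - p.meanHess wstar‖ ≤ ε) {B : ℕ} (hB : 0 < B) (j : p.Batches B)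
    (n : ℕ) (w : Fin K → Param M) (l : Fin K) :
    (h.recursion hM hε).noise B (WithLp.toLp 2 fun k => wstar - w k) (p.slice j n) l =
      p.noise l (j l n) (w l) := by
  have hB' : (B : ℝ) ≠ 0 := Nat.cast_ne_zero.2 hB.ne'
  have h1 : ∀ b, p.sampleNoise wstar (WithLp.toLp 2 fun k => wstar - w k) (p.slice j n b) l =
      p.lossGrad l (j l n b) (w l) - gradient (p.localRisk l) (w l) := fun b => by
    simp [sampleNoise, slice]
  have h2 : (∑ b, p.sampleNoise wstar (WithLp.toLp 2 fun k => wstar - w k) (p.slice j n b)) l =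
      ∑ b, (p.lossGrad l (j l n b) (w l) - gradient (p.localRisk l) (w l)) := by
    rw [WithLp.ofLp_sum, Finset.sum_apply]
    exact sum_congr rfl fun b _ => h1 b
  rw [NoisyRecursion.noise, PiLp.smul_apply]
  refine (congrArg _ h2).trans ?_
  rw [Problem.noise, Problem.batchGrad, sum_sub_distrib, smul_sub, sum_const, card_univ,
    Fintype.card_fin, ← Nat.cast_smul_eq_nsmul ℝ, smul_smul, inv_mul_cancel₀ hB', one_smul,
    one_div]

/-- Rows of the combination matrices sum to one, so `w⋆` passes through them unchanged and the
errors obey the same recursion as the iterates, with the sign of the gradient reversed. -/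
lemma Problem.IsRegular.run_recursion (h : p.IsRegular wstar L)
    (hM : IsMixing M₁ M₂ (WithLp.toLp 2 (p.localGrad wstar)) q g)
    (hε : ∀ k, ‖p.hess wstar k - p.meanHess wstar‖ ≤ ε) {B : ℕ} (hB : 0 < B) {μ : ℝ}
    {j : p.Batches B} {w : ℕ → Fin K → Param M} (hw : p.IsIterate M₁ M₂ μ j w) (n : ℕ) :
    run ((h.recursion hM hε).step μ B)
        (WithLp.toLp 2 fun k => wstar - w 0 k, WithLp.toLp 2 fun k => wstar - w 0 k)
        (p.slice j) n =
      (WithLp.toLp 2 fun k => wstar - w n k,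
        WithLp.toLp 2 (p.shortTerm M₁ M₂ wstar μ j w n)) := by
  induction n with
  | zero => rfl
  | succ n ih =>
    rw [run, ih]
    have hn := h.noise_recursion hM hε hB j n (w n)
    refine Prod.ext ?_ ?_
    · ext1 k
      have h1 : ∀ l, (∑ i, M₁ l i • (wstar - w n i)) = wstar - ∑ i, M₁ l i • w n i := fun l => by
        simp only [smul_sub, sum_sub_distrib, ← sum_smul, hM.row₁, one_smul]
      have h2 : ∀ v : Fin K → Param M, ∑ l, M₂ k l • (wstar - v l) =
          wstar - ∑ l, M₂ k l • v l := fun v => by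
        simp only [smul_sub, sum_sub_distrib, ← sum_smul, hM.row₂, one_smul]
      refine Eq.trans ?_ (congrArg (wstar - ·) (hw n k).symm)
      rw [← h2]
      refine (blockMap_apply M₂ _ k).trans (sum_congr rfl fun l _ => congrArg (M₂ k l • ·) ?_)
      change (∑ i, M₁ l i • (wstar - w n i)) +
        μ • gradient (p.localRisk l) (wstar - (wstar - w n l)) +
        μ • (h.recursion hM hε).noise B (WithLp.toLp 2 fun k => wstar - w n k) (p.slice j n) l = _
      rw [hn, h1, sub_sub_cancel, Problem.noise, smul_sub]
      abel
    · ext1 k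
      refine (blockMap_apply M₂ _ k).trans (sum_congr rfl fun l _ => congrArg (M₂ k l • ·) ?_)
      change (∑ i, M₁ l i • p.shortTerm M₁ M₂ wstar μ j w n i) -
        μ • p.hess wstar l (p.shortTerm M₁ M₂ wstar μ j w n l) + μ • p.localGrad wstar l +
        μ • (h.recursion hM hε).noise B (WithLp.toLp 2 fun k => wstar - w n k) (p.slice j n) l = _
      rw [hn]

end Iterates

end DistributedLearning

/-! ### Expansion of the excess risk for a general method -/

namespace DistributedLearning

open Finset
open scoped BigOperators

variable {K M : ℕ}

lemma sum_norm_pow_four_le (x : Blocks K M) : ∑ k, ‖x k‖ ^ 4 ≤ ‖x‖ ^ 4 := by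
  have h1 : ∀ k, ‖x k‖ ^ 2 ≤ ‖x‖ ^ 2 := fun k => by
    rw [PiLp.norm_sq_eq_of_L2 _ x]
    exact single_le_sum (f := fun k => ‖x k‖ ^ 2) (fun k _ => sq_nonneg _) (mem_univ k)
  calc ∑ k, ‖x k‖ ^ 4 ≤ ∑ k, ‖x k‖ ^ 2 * ‖x‖ ^ 2 := sum_le_sum fun k _ => by
        have := mul_le_mul_of_nonneg_left (h1 k) (sq_nonneg ‖x k‖)
        linarith [show ‖x k‖ ^ 4 = ‖x k‖ ^ 2 * ‖x k‖ ^ 2 by ring]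
    _ = _ := by rw [← sum_mul, ← PiLp.norm_sq_eq_of_L2]; ring

lemma norm_pow_four_le (x : Blocks K M) : ‖x‖ ^ 4 ≤ K * ∑ k, ‖x k‖ ^ 4 := by
  have h1 := sq_sum_le_card_mul_sum_sq (s := (univ : Finset (Fin K))) (f := fun k => ‖x k‖ ^ 2)
  rw [← PiLp.norm_sq_eq_of_L2, card_univ, Fintype.card_fin] at h1
  calc ‖x‖ ^ 4 = (‖x‖ ^ 2) ^ 2 := by ring
    _ ≤ _ := h1
    _ = _ := by congr 1; exact sum_congr rfl fun k _ => by ring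

section Expansion

variable {𝒳 : Type v} {p : Problem K M 𝒳} {wstar : Param M} {L : ℝ}

/-- Twice the total excess risk of all agents, for the error vector `x`. -/
noncomputable def Problem.totalLoss (p : Problem K M 𝒳) (wstar : Param M) (x : Blocks K M) : ℝ :=
  ∑ k, 2 * (p.risk (wstar - x k) - p.risk wstar)

lemma Problem.IsRegular.continuous_totalLoss (h : p.IsRegular wstar L) :
    Continuous (p.totalLoss wstar) := by
  have := h.contDiff_risk.continuous
  unfold Problem.totalLoss
  fun_prop

lemma Problem.IsRegular.exists_abs_risk_sub_le (h : p.IsRegular wstar L) {δ : ℝ} (hδ : 0 < δ) :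
    ∃ C, 0 ≤ C ∧ ∀ y, |p.risk (wstar - y) - p.risk wstar -
      1 / 2 * inner ℝ y (p.meanHess wstar y)| ≤ δ * ‖y‖ ^ 2 + C * ‖y‖ ^ 4 := by
  have h1 := taylor_error_le h.contDiff_risk h.nonneg h.norm_gradient_risk_sub_le
    h.gradient_risk_eq_zero (by rw [h.fderiv_gradient_risk]; exact h.norm_meanHess_le) hδ
  rwa [h.fderiv_gradient_risk] at h1

lemma Problem.IsRegular.exists_abs_totalLoss_sub_le (h : p.IsRegular wstar L) {δ : ℝ}
    (hδ : 0 < δ) : ∃ C, 0 ≤ C ∧ ∀ x : Blocks K M,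
      |p.totalLoss wstar x - weightedSq (p.meanHess wstar) x.ofLp| ≤
        δ * ‖x‖ ^ 2 + C * ‖x‖ ^ 4 := by
  obtain ⟨C, hC, hle⟩ := h.exists_abs_risk_sub_le (half_pos hδ)
  refine ⟨2 * C, by positivity, fun x => ?_⟩
  rw [totalLoss, weightedSq, ← sum_sub_distrib]
  calc _ ≤ ∑ k, (δ * ‖x k‖ ^ 2 + 2 * C * ‖x k‖ ^ 4) := by
        refine (abs_sum_le_sum_abs _ _).trans (sum_le_sum fun k _ => ?_)
        have h1 := hle (x k)
        have h2 : 2 * (p.risk (wstar - x k) - p.risk wstar) -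
            inner ℝ (x k) (p.meanHess wstar (x k)) = 2 * (p.risk (wstar - x k) - p.risk wstar -
              1 / 2 * inner ℝ (x k) (p.meanHess wstar (x k))) := by ring
        rw [h2, abs_mul, abs_two]
        linarith
    _ = δ * ‖x‖ ^ 2 + 2 * C * ∑ k, ‖x k‖ ^ 4 := by
        rw [sum_add_distrib, ← mul_sum, ← mul_sum, ← PiLp.norm_sq_eq_of_L2]
    _ ≤ _ := by
        gcongr
        exact sum_norm_pow_four_le x

/-- Makes the risk of each single agent integrable; the expansion itself controls only their sum. -/
lemma Problem.IsRegular.exists_abs_risk_le (h : p.IsRegular wstar L) :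
    ∃ c, ∀ (k : Fin K) (x : Blocks K M), |p.risk (wstar - x k)| ≤ c * (1 + ‖x‖ ^ 4) := by
  obtain ⟨C, hC, hle⟩ := h.exists_abs_risk_sub_le one_pos
  have hL := h.nonneg
  refine ⟨|p.risk wstar| + L + 1 + C, fun k x => ?_⟩
  have h1 := hle (x k)
  have h2 : |inner ℝ (x k) (p.meanHess wstar (x k))| ≤ L * ‖x k‖ ^ 2 := by
    refine (abs_real_inner_le_norm _ _).trans ?_
    have := (p.meanHess wstar).le_of_opNorm_le h.norm_meanHess_le (x k)
    nlinarith [mul_le_mul_of_nonneg_left this (norm_nonneg (x k))]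
  have h3 : ‖x k‖ ^ 4 ≤ ‖x‖ ^ 4 :=
    (single_le_sum (f := fun k => ‖x k‖ ^ 4) (fun k _ => by positivity) (mem_univ k)).trans
      (sum_norm_pow_four_le x)
  have h4 : ‖x k‖ ^ 2 ≤ 1 + ‖x‖ ^ 4 := by nlinarith [sq_nonneg (‖x k‖ ^ 2 - 1)]
  have h5 : ∀ a b c : ℝ, |a| ≤ |b| + |c| / 2 + |a - b - 1 / 2 * c| := fun a b c => by
    have h6 := abs_add_three b (1 / 2 * c) (a - b - 1 / 2 * c)
    rw [abs_mul, abs_of_pos (by norm_num : (0 : ℝ) < 1 / 2)] at h6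
    calc |a| = |b + 1 / 2 * c + (a - b - 1 / 2 * c)| := by congr 1; ring
      _ ≤ _ := h6
      _ = _ := by ring
  have h6 := h5 (p.risk (wstar - x k)) (p.risk wstar) (inner ℝ (x k) (p.meanHess wstar (x k)))
  have h7 : L * ‖x k‖ ^ 2 ≤ L * (1 + ‖x‖ ^ 4) := by gcongr
  have h8 : C * ‖x k‖ ^ 4 ≤ C * (1 + ‖x‖ ^ 4) := by gcongr; linarith
  have h9 : |p.risk wstar| * 1 ≤ |p.risk wstar| * (1 + ‖x‖ ^ 4) := by
    gcongr
    exact le_add_of_nonneg_right (by positivity)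
  have h10 : 0 ≤ L * ‖x k‖ ^ 2 := by positivity
  linarith

variable {Ω : Type u} [MeasurableSpace Ω] {P : Measure Ω}

lemma measurable_error : Measurable fun w : Fin K → Param M =>
    (WithLp.toLp 2 fun k => wstar - w k : Blocks K M) := by
  have : Continuous fun w : Fin K → Param M => (WithLp.toLp 2 fun k => wstar - w k : Blocks K M) :=
    (PiLp.continuous_toLp 2 _).comp (by fun_prop)
  exact this.measurable

lemma Problem.StartsNear.mono {B : ℕ} {ξ : Ω → p.Batches B} {w₀ : Ω → Fin K → Param M} {r r' : ℝ}
    (h : p.StartsNear P ξ wstar w₀ r) (hr : r ≤ r') : p.StartsNear P ξ wstar w₀ r' :=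
  ⟨h.measurable, h.indep, h.integrable, fun k => (h.moment k).trans hr⟩

lemma Problem.StartsNear.integral_norm_pow_four_le {B : ℕ} {ξ : Ω → p.Batches B}
    {w₀ : Ω → Fin K → Param M} {r : ℝ} (h : p.StartsNear P ξ wstar w₀ r) :
    Integrable (fun ω => ‖(WithLp.toLp 2 fun k => wstar - w₀ ω k : Blocks K M)‖ ^ 4) P ∧
      ∫ ω, ‖(WithLp.toLp 2 fun k => wstar - w₀ ω k : Blocks K M)‖ ^ 4 ∂P ≤ (K : ℝ) ^ 2 * r := by
  have hle : ∀ ω, ‖(WithLp.toLp 2 fun k => wstar - w₀ ω k : Blocks K M)‖ ^ 4 ≤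
      K * ∑ k, ‖w₀ ω k - wstar‖ ^ 4 := fun ω => by
    refine (norm_pow_four_le _).trans_eq ?_
    congr 1
    exact sum_congr rfl fun k _ => congrArg (· ^ 4) (norm_sub_rev _ _)
  have hint : Integrable (fun ω => K * ∑ k, ‖w₀ ω k - wstar‖ ^ 4) P :=
    (integrable_finsetSum _ fun k _ => h.integrable k).const_mul _
  have hint' : Integrable
      (fun ω => ‖(WithLp.toLp 2 fun k => wstar - w₀ ω k : Blocks K M)‖ ^ 4) P :=
    hint.mono' ((measurable_error.comp h.measurable).norm.pow_const 4).aestronglyMeasurable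
      (Filter.Eventually.of_forall fun ω => by
        rw [Real.norm_of_nonneg (by positivity)]
        exact hle ω)
  refine ⟨hint', (integral_mono hint' hint hle).trans ?_⟩
  rw [integral_const_mul, integral_finsetSum _ fun k _ => h.integrable k]
  calc _ ≤ (K : ℝ) * ∑ _k : Fin K, r := by
        gcongr with k
        exact h.moment k
    _ = _ := by simp; ring

variable {M₁ M₂ : Matrix (Fin K) (Fin K) ℝ} {q g ε : ℝ}

/-- The expansion of the excess risk of an algorithm with combination matrices `M₁`, `M₂`. -/
theorem Problem.IsRegular.exists_expansion (h : p.IsRegular wstar L)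
    (hM : IsMixing M₁ M₂ (WithLp.toLp 2 (p.localGrad wstar)) q g)
    (hε : ∀ k, ‖p.hess wstar k - p.meanHess wstar‖ ≤ ε) {T : ℝ} (hT : 0 ≤ T) {δ : ℝ}
    (hδ : 0 < δ) :
    ∃ κ > 0, ∃ μ₀ > 0, ∀ (μ : ℝ) (B n : ℕ), 0 < μ → μ < μ₀ → 0 < B → n * μ ≤ T →
      ∀ (Ω : Type u) [MeasurableSpace Ω] (P : Measure Ω) [IsProbabilityMeasure P]
        (ξ : Ω → p.Batches B), p.IsUniformSampling P ξ →
      ∀ w : Ω → ℕ → Fin K → Param M, (∀ ω, p.IsIterate M₁ M₂ μ (ξ ω) (w ω)) →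
      p.StartsNear P ξ wstar (fun ω => w ω 0) (κ * (μ ^ 2 / (B : ℝ) ^ 2)) →
      p.ExcessRiskExpansion P wstar (fun ω => w ω n)
        (fun ω => p.shortTerm M₁ M₂ wstar μ (ξ ω) (w ω) n)
        (1 / (2 * (K : ℝ)) * (h.recursion hM hε).leading μ B n)
        (1 / (2 * (K : ℝ)) * (2 * L * (Real.exp (L * T) * T) ^ 2 * (ε ^ 2 * g ^ 2 * μ ^ 2) +
          δ * (μ * (B : ℝ)⁻¹ + g ^ 2 * μ ^ 2))) := by
  have hK : (0 : ℝ) < K := Nat.cast_pos.2 h.pos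
  set m := h.recursion hM hε with hm
  have hG : Continuous m.G := by
    have := h.continuous_gradient_localRisk
    refine (PiLp.continuous_toLp 2 _).comp (continuous_pi fun k => (this k).comp ?_)
    fun_prop
  have hz : ∀ t, Continuous fun x => m.z x t := fun t => by
    refine (PiLp.continuous_toLp 2 _).comp (continuous_pi fun k => ?_)
    have h1 := h.continuous_gradient_localRisk k
    have h2 := h.continuous_lossGrad k (t k)
    exact (h2.comp (by fun_prop)).sub (h1.comp (by fun_prop))
  have hquad : ∀ x, m.quad x = weightedSq (p.meanHess wstar) x.ofLp := fun x =>
    PiLp.inner_apply _ _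
  obtain ⟨κ, hκ, μ₀, hμ₀, hmain⟩ := NoisyRecursion.abs_integral_sub_leading_le.{u} m hG hz hT
    h.continuous_totalLoss (fun δ hδ => by
      simp only [hquad]
      exact h.exists_abs_totalLoss_sub_le hδ) hδ
  -- The fourth power of the block norm is at most `K` times the sum of `K` individual fourth
  -- powers, which costs `K²`.
  refine ⟨κ / (K : ℝ) ^ 2, by positivity, μ₀, hμ₀, ?_⟩
  intro μ B n hμ hμlt hB hn Ω _ P _ ξ hξ w hw hstart
  obtain ⟨hint, hmom⟩ := hstart.integral_norm_pow_four_le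
  obtain ⟨⟨-, hf⟩, ⟨hqi, hq⟩, hφ⟩ := hmain μ B n hμ hμlt hB hn Ω P
    (fun ω => WithLp.toLp 2 fun k => wstar - w ω 0 k) (fun n ω => p.slice (ξ ω) n)
    (measurable_error.comp hstart.measurable)
    (fun n => (Problem.measurable_slice n).comp hξ.measurable_batches)
    (hξ.indepFun_start_slice hstart.measurable hstart.indep
      (measurable_error.prodMk measurable_error))
    (fun n s => hξ.real_slice_eq n s) hint (hmom.trans_eq (by field_simp))
  have hrun : ∀ ω, run (m.step μ B) (WithLp.toLp 2 fun k => wstar - w ω 0 k,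
      WithLp.toLp 2 fun k => wstar - w ω 0 k) (fun i => p.slice (ξ ω) i) n =
        (WithLp.toLp 2 fun k => wstar - w ω n k,
          WithLp.toLp 2 (p.shortTerm M₁ M₂ wstar μ (ξ ω) (w ω) n)) := fun ω =>
    h.run_recursion hM hε hB (hw ω) n
  simp only [hrun, hquad] at hf hqi hq hφ
  obtain ⟨c, hc⟩ := h.exists_abs_risk_le
  have hrisk : ∀ k, Integrable (fun ω => p.risk (w ω n k)) P := fun k => by
    have := hφ (fun x => p.risk (wstar - x k))
      (h.contDiff_risk.continuous.comp (by fun_prop)) ⟨c, hc k⟩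
    simpa only [sub_sub_cancel] using this
  have hER : p.excessRisk P wstar (fun ω => w ω n) = 1 / (2 * (K : ℝ)) *
      ∫ ω, p.totalLoss wstar (WithLp.toLp 2 fun k => wstar - w ω n k) ∂P := by
    have h1 : ∫ ω, p.totalLoss wstar (WithLp.toLp 2 fun k => wstar - w ω n k) ∂P =
        ∑ k, 2 * (∫ ω, p.risk (w ω n k) ∂P - p.risk wstar) := by
      have h2 : ∀ k ∈ univ, Integrable (fun ω => 2 * (p.risk (w ω n k) - p.risk wstar)) P :=
        fun k _ => ((hrisk k).sub (integrable_const _)).const_mul 2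
      simp only [totalLoss, sub_sub_cancel]
      rw [integral_finsetSum _ h2]
      refine sum_congr rfl fun k _ => ?_
      rw [integral_const_mul, integral_sub (hrisk k) (integrable_const _)]
      simp
    rw [h1, ← mul_sum, sum_sub_distrib, excessRisk]
    simp only [sum_const, card_univ, Fintype.card_fin, nsmul_eq_mul]
    field_simp
  have hscale : ∀ {a b R : ℝ}, |a - b| ≤ R →
      |1 / (2 * (K : ℝ)) * a - 1 / (2 * (K : ℝ)) * b| ≤ 1 / (2 * (K : ℝ)) * R := fun hab => by
    rw [← mul_sub, abs_mul, abs_of_pos (by positivity)]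
    gcongr
  exact ⟨hrisk, hqi, by rw [hER]; exact hscale hf, hscale hq⟩

end Expansion

end DistributedLearning

/-! ### The theorem -/

namespace DistributedLearning

open Finset
open scoped BigOperators

section Main

variable {K M : ℕ} {𝒳 : Type v} {p : Problem K M 𝒳} {wstar : Param M}

lemma Problem.ExcessRiskExpansion.mono {Ω : Type u} [MeasurableSpace Ω] {P : Measure Ω}
    {w W : Ω → Fin K → Param M} {main main' err err' : ℝ}
    (h : p.ExcessRiskExpansion P wstar w W main err) (hm : main = main') (he : err ≤ err') :
    p.ExcessRiskExpansion P wstar w W main' err' :=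
  ⟨h.integrable, h.integrable_shortTerm, hm ▸ h.bound.trans he, hm ▸ h.bound_shortTerm.trans he⟩

/-- Dividing `δ` by `|c| + s + 1` in advance absorbs both `c` from the bound on the batch size and,
in `remainder_le`, the factor `s = g²` of the `μ²` part of `scale`. -/
lemma mul_inv_le_mul_rpow {δ c s η μ : ℝ} {B : ℕ} (hδ : 0 ≤ δ) (hs : 0 ≤ s) (hμ : 0 < μ)
    (hc : 1 / (B : ℝ) ≤ c * μ ^ η) : δ / (|c| + s + 1) * (μ * (B : ℝ)⁻¹) ≤ δ * μ ^ (1 + η) := by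
  have hη : 0 < μ ^ η := Real.rpow_pos_of_pos hμ η
  have h1 : (B : ℝ)⁻¹ ≤ (|c| + s + 1) * μ ^ η := by
    rw [← one_div]
    refine hc.trans (mul_le_mul_of_nonneg_right ?_ hη.le)
    linarith [le_abs_self c]
  have h2 : 0 < |c| + s + 1 := by positivity
  rw [Real.rpow_add hμ, Real.rpow_one]
  calc _ ≤ δ / (|c| + s + 1) * (μ * ((|c| + s + 1) * μ ^ η)) := by gcongr
    _ = _ := by field_simp

/-- The remainder of the general expansion, for step sizes and batch sizes in the regime of
interest. -/
lemma remainder_le {k δ c s η μ R : ℝ} {B : ℕ} (hk1 : k ≤ 1) (hδ : 0 ≤ δ)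
    (hs : 0 ≤ s) (hμ : 0 < μ) (hc : 1 / (B : ℝ) ≤ c * μ ^ η) :
    k * (R + δ / (|c| + s + 1) * (μ * (B : ℝ)⁻¹ + s * μ ^ 2)) ≤
      k * R + δ * μ ^ 2 + δ * μ ^ (1 + η) := by
  have h1 := mul_inv_le_mul_rpow hδ hs hμ hc
  have h2 : 0 < |c| + s + 1 := by positivity
  have h3 : δ / (|c| + s + 1) * (s * μ ^ 2) ≤ δ * μ ^ 2 := by
    calc _ = s / (|c| + s + 1) * (δ * μ ^ 2) := by ring
      _ ≤ 1 * (δ * μ ^ 2) := by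
        gcongr
        rw [div_le_one h2]
        linarith [abs_nonneg c]
      _ = _ := one_mul _
  have h4 : 0 ≤ δ / (|c| + s + 1) * (μ * (B : ℝ)⁻¹ + s * μ ^ 2) := by positivity
  have h5 := mul_le_of_le_one_left h4 hk1
  linarith

end Main

end DistributedLearning

theorem theorem1 {K M : ℕ} (A : Matrix (Fin K) (Fin K) ℝ)
    (hA : DistributedLearning.IsCombinationMatrix A) (L T : ℝ) :
    ∃ C : ℝ, ∀ (𝒳 : Type v) (p : DistributedLearning.Problem K M 𝒳)
      (wstar : DistributedLearning.Param M), IsLocalMin p.risk wstar →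
      (∀ k i, ContDiff ℝ 2 (fun w => p.Q k w (p.x k i))) →
      (∀ k i w₁ w₂, ‖p.lossGrad k i w₂ - p.lossGrad k i w₁‖ ≤ L * ‖w₂ - w₁‖) →
      ∀ (Vα : Matrix (Fin K) (Fin (K - 1)) ℝ) (ev : Fin (K - 1) → ℝ),
      DistributedLearning.IsEigendecomposition A Vα ev →
      ∀ ε : ℝ, (∀ k, ‖p.hess wstar k - p.meanHess wstar‖ ≤ ε) →
      ∀ η c : ℝ, 0 ≤ η → ∀ δ > 0, ∃ κ > 0, ∃ μ₀ > 0,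
      ∀ (μ : ℝ) (B : ℕ), 0 < μ → μ < μ₀ → 0 < B → 1 / (B : ℝ) ≤ c * μ ^ η →
      ∀ (Ω : Type u) [MeasurableSpace Ω] (P : Measure Ω) [IsProbabilityMeasure P]
        (ξ : Ω → p.Batches B), p.IsUniformSampling P ξ →
      ∀ n : ℕ, (n : ℝ) ≤ T / μ →
      (∀ w₀ : Ω → DistributedLearning.Param M,
        p.StartsNear P ξ wstar (fun ω _ => w₀ ω) (κ * (μ ^ 2 / (B : ℝ) ^ 2)) →
        p.ExcessRiskExpansion P wstar
          (fun ω _ => p.centralized μ (ξ ω) (w₀ ω) (n + 1))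
          (fun ω => p.shortTerm 1 (Matrix.of fun _ _ => 1 / (K : ℝ)) wstar μ (ξ ω)
            (fun m _ => p.centralized μ (ξ ω) (w₀ ω) m) (n + 1))
          (μ / B * p.noiseTerm wstar μ n)
          (δ * μ ^ (1 + η))) ∧
      (∀ w₀ : Ω → Fin K → DistributedLearning.Param M,
        p.StartsNear P ξ wstar w₀ (κ * (μ ^ 2 / (B : ℝ) ^ 2)) →
        p.ExcessRiskExpansion P wstar
          (fun ω => p.consensus A μ (ξ ω) (w₀ ω) (n + 1))
          (fun ω => p.shortTerm A 1 wstar μ (ξ ω) (p.consensus A μ (ξ ω) (w₀ ω)) (n + 1))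
          (μ / B * p.noiseTerm wstar μ n + μ ^ 2 * p.consensusTerm wstar Vα ev n)
          (C * ε ^ 2 * (∑ k, ‖p.localGrad wstar k‖ ^ 2) * μ ^ 2 +
            δ * μ ^ 2 + δ * μ ^ (1 + η)) ∧
        p.ExcessRiskExpansion P wstar
          (fun ω => p.diffusion A μ (ξ ω) (w₀ ω) (n + 1))
          (fun ω => p.shortTerm 1 A wstar μ (ξ ω) (p.diffusion A μ (ξ ω) (w₀ ω)) (n + 1))
          (μ / B * p.noiseTerm wstar μ n + μ ^ 2 * p.diffusionTerm wstar Vα ev n)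
          (C * ε ^ 2 * (∑ k, ‖p.localGrad wstar k‖ ^ 2) * μ ^ 2 +
            δ * μ ^ 2 + δ * μ ^ (1 + η))) := by
  obtain ⟨k₀, -⟩ := hA.selfLoop
  have hK : 0 < K := k₀.pos
  have hK' : (0 : ℝ) < K := Nat.cast_pos.2 hK
  have hK1 : (1 : ℝ) ≤ K := Nat.one_le_cast.2 hK
  have hk1 : 1 / (2 * (K : ℝ)) ≤ 1 := by rw [div_le_one (by positivity)]; linarith
  -- The recursions store the `n`-th iterate at index `n + 1`; since `μ < 1`, the extra step
  -- lengthens the horizon by at most one.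
  have hT : 0 ≤ |T| + 1 := by positivity
  -- The constant precedes the given eigendecomposition in the quantifiers, so the gap `q` is taken
  -- from an auxiliary one, chosen from `A` alone; without any decomposition the claim is vacuous.
  by_cases hE : ∃ Vα ev, DistributedLearning.IsEigendecomposition A Vα ev
  swap
  · exact ⟨0, fun _ _ _ _ _ _ Vα ev h => (hE ⟨Vα, ev, h⟩).elim⟩
  obtain ⟨Vα₀, ev₀, h₀⟩ := hE
  obtain ⟨q, hq, hq1, hev⟩ := h₀.exists_gap hA
  refine ⟨1 / (2 * (K : ℝ)) * (2 * |L| * (Real.exp (|L| * (|T| + 1)) * (|T| + 1)) ^ 2) *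
    (1 - q)⁻¹ ^ 2, ?_⟩
  intro 𝒳 p wstar hmin hsmooth hLip Vα ev hV ε hε η c hη δ hδ
  -- No sign is assumed for `L`, and `|L|` is a Lipschitz constant as well.
  have h : p.IsRegular wstar |L| := ⟨hK, abs_nonneg L, hmin, hsmooth, fun k i w₁ w₂ =>
    (hLip k i w₁ w₂).trans (mul_le_mul_of_nonneg_right (le_abs_self L) (norm_nonneg _))⟩
  have hd := h.sum_localGrad
  set d : DistributedLearning.Blocks K M := WithLp.toLp 2 (p.localGrad wstar) with hd_def
  set s := ((1 - q)⁻¹ * ‖d‖) ^ 2 with hs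
  have hs0 : 0 ≤ s := sq_nonneg _
  have hsd : s = (1 - q)⁻¹ ^ 2 * ∑ k, ‖p.localGrad wstar k‖ ^ 2 := by
    rw [hs, mul_pow, PiLp.norm_sq_eq_of_L2]
  have hcen := DistributedLearning.isMixing_centralized (d := d) hK hd
  have hcon := DistributedLearning.isMixing_consensus h₀ hA hK hq hq1 hev (d := d) hd
  have hdif := DistributedLearning.isMixing_diffusion h₀ hA hK hq hq1 hev (d := d) hd
  -- This accuracy may depend on `d`, `c` and `ε`, since `κ` and `μ₀` are chosen after them; only
  -- the constant of the `ε²` term must be uniform over problems.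
  have hδ' : 0 < δ / (|c| + s + 1) := by positivity
  obtain ⟨κ₁, hκ₁, μ₁, hμ₁, H₁⟩ := h.exists_expansion.{u} hcen hε hT hδ'
  obtain ⟨κ₂, hκ₂, μ₂, hμ₂, H₂⟩ := h.exists_expansion.{u} hcon hε hT hδ'
  obtain ⟨κ₃, hκ₃, μ₃, hμ₃, H₃⟩ := h.exists_expansion.{u} hdif hε hT hδ'
  refine ⟨min κ₁ (min κ₂ κ₃), by positivity, min 1 (min μ₁ (min μ₂ μ₃)), by positivity, ?_⟩
  intro μ B hμ hμlt hB hBc Ω _ P _ ξ hξ n hn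
  simp only [lt_min_iff] at hμlt
  obtain ⟨hμ1, hlt₁, hlt₂, hlt₃⟩ := hμlt
  have hn' : ((n + 1 : ℕ) : ℝ) * μ ≤ |T| + 1 := by
    have h1 := (le_div_iff₀ hμ).1 hn
    have h2 := le_abs_self T
    push_cast
    linarith
  have hr : 0 ≤ μ ^ 2 / (B : ℝ) ^ 2 := by positivity
  have herr : 1 / (2 * (K : ℝ)) * (2 * |L| * (Real.exp (|L| * (|T| + 1)) * (|T| + 1)) ^ 2 *
      (ε ^ 2 * s * μ ^ 2) + δ / (|c| + s + 1) * (μ * (B : ℝ)⁻¹ + s * μ ^ 2)) ≤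
      1 / (2 * (K : ℝ)) * (2 * |L| * (Real.exp (|L| * (|T| + 1)) * (|T| + 1)) ^ 2) *
        (1 - q)⁻¹ ^ 2 * ε ^ 2 * (∑ k, ‖p.localGrad wstar k‖ ^ 2) * μ ^ 2 + δ * μ ^ 2 +
        δ * μ ^ (1 + η) := by
    refine (DistributedLearning.remainder_le hk1 hδ.le hs0 hμ hBc).trans_eq ?_
    rw [hsd]
    ring
  refine ⟨fun w₀ hw₀ => ?_, fun w₀ hw₀ => ⟨?_, ?_⟩⟩
  · have hw := hw₀.mono (mul_le_mul_of_nonneg_right (min_le_left κ₁ (min κ₂ κ₃)) hr)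
    refine (H₁ μ B (n + 1) hμ hlt₁ hB hn' Ω P ξ hξ
      (fun ω m _ => p.centralized μ (ξ ω) (w₀ ω) m)
      (fun ω => DistributedLearning.isIterate_centralized μ hK (ξ ω) (w₀ ω)) hw).mono ?_ ?_
    -- With `g = 0` the accumulated drift vanishes, so the main term reduces to the noise term.
    · have h1 := norm_le_zero_iff.1 (hcen.norm_drift_sum (n + 1))
      rw [h.leading_eq, h1]
      simp [DistributedLearning.weightedSq]
    · have h1 := DistributedLearning.mul_inv_le_mul_rpow hδ.le hs0 hμ hBc
      have h2 : 0 ≤ δ / (|c| + s + 1) * (μ * (B : ℝ)⁻¹) := by positivity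
      refine le_trans (le_of_eq ?_) ((mul_le_of_le_one_left h2 hk1).trans h1)
      ring
  · have hw := hw₀.mono (mul_le_mul_of_nonneg_right
      ((min_le_right κ₁ (min κ₂ κ₃)).trans (min_le_left _ _)) hr)
    refine (H₂ μ B (n + 1) hμ hlt₂ hB hn' Ω P ξ hξ (fun ω => p.consensus A μ (ξ ω) (w₀ ω))
      (fun ω => DistributedLearning.isIterate_consensus hA.symm μ (ξ ω) (w₀ ω)) hw).mono ?_ herr
    have h1 : (DistributedLearning.blockMap 1 ∘ₗ DistributedLearning.blockMap A :
        DistributedLearning.Blocks K M →ₗ[ℝ] DistributedLearning.Blocks K M) =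
        DistributedLearning.blockMap A :=
      LinearMap.ext fun x => DistributedLearning.blockMap_one _
    rw [h.leading_eq, DistributedLearning.consensusTerm_eq hV hA hd, h1,
      DistributedLearning.blockMap_one]
  · have hw := hw₀.mono (mul_le_mul_of_nonneg_right
      ((min_le_right κ₁ (min κ₂ κ₃)).trans (min_le_right _ _)) hr)
    refine (H₃ μ B (n + 1) hμ hlt₃ hB hn' Ω P ξ hξ (fun ω => p.diffusion A μ (ξ ω) (w₀ ω))
      (fun ω => DistributedLearning.isIterate_diffusion hA.symm μ (ξ ω) (w₀ ω)) hw).mono ?_ herr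
    have h1 : (DistributedLearning.blockMap A ∘ₗ DistributedLearning.blockMap 1 :
        DistributedLearning.Blocks K M →ₗ[ℝ] DistributedLearning.Blocks K M) =
        DistributedLearning.blockMap A :=
      LinearMap.ext fun x => congrArg (DistributedLearning.blockMap A)
        (DistributedLearning.blockMap_one x)
    rw [h.leading_eq, DistributedLearning.diffusionTerm_eq hV hA hd, h1]
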